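/- Let $G=(V,E)$ be a finite simple graph and $M$ a matching in $G$. Edges in $M$ are matched, the others unmatched; a vertex is unmatched if no edge of $M$ meets it. An alternating path is a simple path (possibly of length $0$) whose edges alternate between $M$ and $E\setminus M$; an augmenting path is an alternating path joining two distinct unmatched vertices, and $l_m\in\mathbb N\cup\{\infty\}$ is the minimum length of one ($\infty$ if there is none). *Levels.* $\mathrm{evenlevel}(v)$ (resp. $\mathrm{oddlevel}(v)$) is the minimum length of an even (resp. odd) length alternating path from an unmatched vertex to $v$, or $\infty$ if there is none; the paths attaining it are the evenlevel$(v)$ (oddlevel$(v)$) paths. $\mathrm{minlevel}(v)$ and $\mathrm{maxlevel}(v)$ are the smaller and the larger of the two levels, and the paths from unmatched vertices attaining them are the minlevel$(v)$ and maxlevel$(v)$ paths. $v$ is outer if $\mathrm{evenlevel}(v)<\mathrm{oddlevel}(v)$. *Tenacity and bridges.* $\tau(v)=\mathrm{evenlevel}(v)+\mathrm{oddlevel}(v)$; for an edge, $\tau(u,v)=\mathrm{evenlevel}(u)+\mathrm{evenlevel}(v)+1$ if it is unmatched and $\tau(u,v)=\mathrm{oddlevel}(u)+\mathrm{oddlevel}(v)+1$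 if it is matched. $t_m=\min_v\tau(v)$; $t$ is an eligible tenacity if it is an odd natural number with $t_m\le t<l_m$. An edge is a prop if it is the last edge of a minlevel$(w)$ path for some vertex $w$, and a bridge otherwise. *Bases and blossoms.* For a vertex $v$ of eligible tenacity and an evenlevel$(v)$ or oddlevel$(v)$ path $p$, let $F(p,v)$ be the vertex farthest along $p$ among the vertices of $p$ of tenacity $>\tau(v)$, and let $B(v)$ be the set of all $F(p,v)$. If $B(v)$ is a singleton, $\mathrm{base}(v)$ is its element. For odd $t<l_m$ and an outer vertex $b$ with $\tau(b)>t$ the blossom of tenacity $t$ and base $b$ is defined recursively by $\mathcal B_{b,1}=\emptyset$ and $$\mathcal B_{b,t}=S_{b,t}\cup\bigcup_{w\in S_{b,t}\cup\{b\},\ w\text{ outer}}\mathcal B_{w,t-2},\qquad S_{b,t}=\{w:\tau(w)=t,\ \mathrm{base}(w)=b\}\qquad(t\ge 3).$$ An evenlevel$(b;u)$ (oddlevel$(b;u)$) path is a path of minimum length among the even (odd) length alternating paths from $b$ to $u$ that start with an unmatched edge. **Theorem.** Let $t$ be an eligible tenacity and $v$ a vertex with $\tau(v)=t$. Then: 1.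 $F(p,v)$ exists for every evenlevel$(v)$ or oddlevel$(v)$ path $p$, and $B(v)$ is a singleton. 2. Every maxlevel$(v)$ path contains a unique bridge of tenacity $t$. 3. The blossoms of tenacity at most $t$ form a laminar family: any two of them are disjoint or one contains the other. 4. Let $b=\mathrm{base}(v)$ and $u\in\mathcal B_{b,t}$. Every evenlevel$(u)$ (resp. oddlevel$(u)$) path is the concatenation of an evenlevel$(b)$ path and an evenlevel$(b;u)$ (resp. oddlevel$(b;u)$) path. Moreover, every evenlevel$(b;u)$ and every oddlevel$(b;u)$ path lies in $\mathcal B_{b,t}\cup\{b\}$, and all its edges have tenacity $\le t$. 5. Let $b=\mathrm{base}(v)$ and let $p$ be an evenlevel$(v)$ or oddlevel$(v)$ path. Then $b$ lies on $p$, and for every vertex $u\ne b$ on the part $p[b\text{ to }v]$ of $p$ from $b$ to $v$, $\mathrm{base}(u)$ is defined and lies on $p[b\text{ to }v]$. Additionally, for every vertex $v$ of tenacity $l_m$, every maxlevel$(v)$ path contains a unique bridge of tenacity $l_m$. -/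

import Mathlib

namespace MV

variable {V : Type*} {G : SimpleGraph V}

/-- `p` is an alternating path: it is simple and its consecutive edges alternate between matched
and unmatched. A path of length zero is alternating. -/
def IsAltPath (M : G.Subgraph) {u v : V} (p : G.Walk u v) : Prop :=
  p.IsPath ∧ p.edges.IsChain (fun e e' => e ∈ M.edgeSet ↔ e' ∉ M.edgeSet)

/-- The vertex `v` is unmatched. -/
def IsUnmatched (M : G.Subgraph) (v : V) : Prop := ∀ w, ¬ M.Adj v w

/-- `p` is an alternating path starting at an unmatched vertex. -/
def IsAltPathFromFree (M : G.Subgraph) {f v : V} (p : G.Walk f v) : Prop :=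
  IsUnmatched M f ∧ IsAltPath M p

/-- `p` is an augmenting path: it joins two distinct unmatched vertices. -/
def IsAugmentingPath (M : G.Subgraph) {f g : V} (p : G.Walk f g) : Prop :=
  IsAltPath M p ∧ IsUnmatched M f ∧ IsUnmatched M g ∧ f ≠ g

/-- `l_m`, the length of a minimum length augmenting path, `⊤` if there is none. -/
noncomputable def lm (M : G.Subgraph) : ℕ∞ :=
  sInf {l | ∃ (f g : V) (p : G.Walk f g), IsAugmentingPath M p ∧ l = p.length}

noncomputable def evenlevel (M : G.Subgraph) (v : V) : ℕ∞ :=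
  sInf {l | ∃ (f : V) (p : G.Walk f v), IsAltPathFromFree M p ∧ Even p.length ∧ l = p.length}

noncomputable def oddlevel (M : G.Subgraph) (v : V) : ℕ∞ :=
  sInf {l | ∃ (f : V) (p : G.Walk f v), IsAltPathFromFree M p ∧ Odd p.length ∧ l = p.length}

/-- `p` is an `evenlevel(v)` path. -/
def IsEvenlevelPath (M : G.Subgraph) {f v : V} (p : G.Walk f v) : Prop :=
  IsAltPathFromFree M p ∧ Even p.length ∧ (p.length : ℕ∞) = evenlevel M v

/-- `p` is an `oddlevel(v)` path. -/
def IsOddlevelPath (M : G.Subgraph) {f v : V} (p : G.Walk f v) : Prop :=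
  IsAltPathFromFree M p ∧ Odd p.length ∧ (p.length : ℕ∞) = oddlevel M v

/-- `p` is an `evenlevel(v)` or `oddlevel(v)` path. -/
def IsLevelPath (M : G.Subgraph) {f v : V} (p : G.Walk f v) : Prop :=
  IsEvenlevelPath M p ∨ IsOddlevelPath M p

noncomputable def minlevel (M : G.Subgraph) (v : V) : ℕ∞ := min (evenlevel M v) (oddlevel M v)

noncomputable def maxlevel (M : G.Subgraph) (v : V) : ℕ∞ := max (evenlevel M v) (oddlevel M v)

/-- `p` is a `minlevel(v)` path. -/
def IsMinlevelPath (M : G.Subgraph) {f v : V} (p : G.Walk f v) : Prop :=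
  IsLevelPath M p ∧ (p.length : ℕ∞) = minlevel M v

/-- `p` is a `maxlevel(v)` path. -/
def IsMaxlevelPath (M : G.Subgraph) {f v : V} (p : G.Walk f v) : Prop :=
  IsLevelPath M p ∧ (p.length : ℕ∞) = maxlevel M v

/-- The vertex `v` is outer. (The inequality forces `evenlevel(v)` to be finite.) -/
def IsOuter (M : G.Subgraph) (v : V) : Prop := evenlevel M v < oddlevel M v

/-- The tenacity of a vertex. -/
noncomputable def tenacity (M : G.Subgraph) (v : V) : ℕ∞ := evenlevel M v + oddlevel M v

open Classical in
/-- The tenacity of an edge. -/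
noncomputable def edgeTenacity (M : G.Subgraph) (e : Sym2 V) : ℕ∞ :=
  if e ∈ M.edgeSet then
    Sym2.lift ⟨fun u v => oddlevel M u + oddlevel M v + 1, fun u v => by
      simp only [add_comm]⟩ e
  else
    Sym2.lift ⟨fun u v => evenlevel M u + evenlevel M v + 1, fun u v => by
      simp only [add_comm]⟩ e

/-- `t_m`, the minimum tenacity of a vertex. -/
noncomputable def tm (M : G.Subgraph) : ℕ∞ := ⨅ v, tenacity M v

/-- `t` is an eligible tenacity. -/
def Eligible (M : G.Subgraph) (t : ℕ) : Prop := Odd t ∧ tm M ≤ t ∧ (t : ℕ∞) < lm M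

/-- `u` is a predecessor of `v`: some `minlevel(v)` path has `(u, v)` as its last edge. -/
def IsPredecessor (M : G.Subgraph) (u v : V) : Prop :=
  ∃ (f : V) (p : G.Walk f v), IsMinlevelPath M p ∧ ¬ p.Nil ∧ p.penultimate = u

/-- The edge `e` is a prop. -/
def IsPropEdge (M : G.Subgraph) (e : Sym2 V) : Prop :=
  ∃ u v, IsPredecessor M u v ∧ e = s(u, v)

/-- The edge `e` is a bridge, i.e. not a prop. -/
def IsBridgeEdge (M : G.Subgraph) (e : Sym2 V) : Prop :=
  e ∈ G.edgeSet ∧ ¬ IsPropEdge M e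

/-- `F(p, v) = b`: `b` is the highest vertex of tenacity `> tenacity(v)` on the path `p` to `v`. -/
def IsBaseOn (M : G.Subgraph) {f v : V} (p : G.Walk f v) (b : V) : Prop :=
  tenacity M v < tenacity M b ∧
    ∃ (q : G.Walk f b) (r : G.Walk b v), p = q.append r ∧
      ∀ x ∈ r.support, tenacity M v < tenacity M x → x = b

/-- The set `B(v)` of all `F(p, v)`, over `evenlevel(v)` and `oddlevel(v)` paths `p`. -/
def baseSet (M : G.Subgraph) (v : V) : Set V :=
  {b | ∃ (f : V) (p : G.Walk f v), IsLevelPath M p ∧ IsBaseOn M p b}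

/-- `base(v) = b`, i.e. `B(v)` is a singleton and `b` is its element. -/
def HasBase (M : G.Subgraph) (v b : V) : Prop := baseSet M v = {b}

/-- The set `S_{b,t}`. -/
def blossomCore (M : G.Subgraph) (b : V) (t : ℕ) : Set V :=
  {v | tenacity M v = t ∧ HasBase M v b}

/-- The blossom of tenacity `t` and base `b`, meaningful for odd `t`. -/
def blossom (M : G.Subgraph) : ℕ → V → Set V
  | 0, _ => ∅
  | 1, _ => ∅
  | t + 2, b => blossomCore M b (t + 2) ∪
      ⋃ v ∈ {v | v ∈ blossomCore M b (t + 2) ∪ {b} ∧ IsOuter M v}, blossom M t v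

/-- The family of all blossoms of tenacity at most `t`. -/
def blossomFamily (M : G.Subgraph) (t : ℕ) : Set (Set V) :=
  {B | ∃ (b : V) (t' : ℕ), Odd t' ∧ t' ≤ t ∧ IsOuter M b ∧ (t' : ℕ∞) < tenacity M b ∧
    B = blossom M t' b}

/-- Any two members of the family are disjoint or one contains the other. -/
def IsLaminar (F : Set (Set V)) : Prop :=
  ∀ A ∈ F, ∀ B ∈ F, Disjoint A B ∨ A ⊆ B ∨ B ⊆ A

/-- `p` is an alternating path whose first edge (if any) is unmatched. -/
def IsAltPathUnmatchedStart (M : G.Subgraph) {b v : V} (p : G.Walk b v) : Prop :=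
  IsAltPath M p ∧ ∀ e ∈ p.edges.head?, e ∉ M.edgeSet

/-- `p` is an `evenlevel(b; v)` path: of minimum length among the even length alternating paths
from `b` to `v` that start with an unmatched edge. -/
def IsEvenlevelPathFrom (M : G.Subgraph) {b v : V} (p : G.Walk b v) : Prop :=
  IsAltPathUnmatchedStart M p ∧ Even p.length ∧
    ∀ q : G.Walk b v, IsAltPathUnmatchedStart M q → Even q.length → p.length ≤ q.length

/-- `p` is an `oddlevel(b; v)` path: of minimum length among the odd length alternating paths
from `b` to `v` that start with an unmatched edge. -/
def IsOddlevelPathFrom (M : G.Subgraph) {b v : V} (p : G.Walk b v) : Prop :=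
  IsAltPathUnmatchedStart M p ∧ Odd p.length ∧
    ∀ q : G.Walk b v, IsAltPathUnmatchedStart M q → Odd q.length → p.length ≤ q.length

end MV

/-!
The argument is linear programming duality. A feasible dual of stage `n` consists of base functions
for the stages `j ≤ n`, whose fibres are classes of vertices, and of lower bounds for the levels.
Each edge of an alternating path from an unmatched vertex raises the lower bound plus twice the
number of unbased classes (those met by the path while their base is not) by at most one. Hence the
length of the path is at least the bound at its end plus twice the number of unbased classes.

A path attaining a level below the cutoff `2 * n` is tight: it leaves no class unbased, enters the
class of its end at the base, and stays there. This gives the statements on bases and on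
decompositions of paths. On any tight path, the number of bridges of tenacity `2 * n + 1` equals the
number of unbased classes of stage `n`, plus one if the end is its own base and the length has the
parity of its maxlevel. On a maxlevel path of a vertex of tenacity `2 * n + 1` this is `0 + 1`.

The dual of stage `n + 1` arises from that of stage `n` by contracting classes to nodes, which are
layered by minlevel. The ends of a bridge of tenacity `2 * n + 1` have a common dominator in this
layering, since disjoint chains down to unmatched vertices would form an augmenting path of length
`2 * n + 1`. The bridge merges the nodes above the highest common dominator, which becomes their
base. The classes of all stages are nested, and a blossom is a class without its base.
-/

namespace MV

open SimpleGraph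

section Alternation

variable {V : Type*} {G : SimpleGraph V} {M : G.Subgraph} {u v w : V}

/-- The edges of the walk alternate between matched and unmatched, the first edge (if any) being
matched iff `s = true`. -/
def AltFrom (M : G.Subgraph) : Bool → {u v : V} → G.Walk u v → Prop
  | _, _, _, .nil => True
  | s, u, _, .cons (v := w) _ p => (M.Adj u w ↔ s = true) ∧ AltFrom M (!s) p

@[simp] lemma altFrom_nil (s : Bool) (u : V) : AltFrom M s (Walk.nil : G.Walk u u) := trivial

@[simp] lemma altFrom_cons (s : Bool) (h : G.Adj u v) (p : G.Walk v w) :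
    AltFrom M s (.cons h p) ↔ (M.Adj u v ↔ s = true) ∧ AltFrom M (!s) p := Iff.rfl

lemma altFrom_append (s : Bool) (p : G.Walk u v) (q : G.Walk v w) :
    AltFrom M s (p.append q) ↔ AltFrom M s p ∧ AltFrom M (s ^^ p.length.bodd) q := by
  induction p generalizing s with
  | nil => simp
  | cons h p ih => simp [ih, and_assoc]

lemma altFrom_concat (s : Bool) (p : G.Walk u v) (h : G.Adj v w) :
    AltFrom M s (p.concat h) ↔ AltFrom M s p ∧ (M.Adj v w ↔ (s ^^ p.length.bodd) = true) := by
  simp [Walk.concat_eq_append, altFrom_append]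

lemma AltFrom.reverse {s : Bool} {p : G.Walk u v} (hp : AltFrom M s p) :
    AltFrom M (s ^^ !p.length.bodd) p.reverse := by
  induction p generalizing s with
  | nil => simp
  | @cons a b c h p ih =>
    rw [altFrom_cons] at hp
    rw [Walk.reverse_cons, altFrom_append]
    refine ⟨by simpa using ih hp.2, ?_⟩
    simp only [altFrom_cons, altFrom_nil, and_true, M.adj_comm b a, hp.1]
    cases s <;> cases hb : p.length.bodd <;> simp [hb]

lemma altFrom_iff_isChain (s : Bool) (p : G.Walk u v) :
    AltFrom M s p ↔ p.edges.IsChain (fun e e' => e ∈ M.edgeSet ↔ e' ∉ M.edgeSet) ∧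
      ∀ e ∈ p.edges.head?, (e ∈ M.edgeSet ↔ s = true) := by
  induction p generalizing s with
  | nil => simp
  | cons h p ih =>
    rw [altFrom_cons, ih, Walk.edges_cons, List.isChain_cons]
    simp only [List.head?_cons, Option.mem_def, Option.some.injEq, forall_eq', Subgraph.mem_edgeSet]
    cases s <;> grind

lemma isAltPathUnmatchedStart_iff {p : G.Walk u v} :
    IsAltPathUnmatchedStart M p ↔ p.IsPath ∧ AltFrom M false p := by
  simp [IsAltPathUnmatchedStart, IsAltPath, altFrom_iff_isChain, and_assoc]

lemma isAltPathFromFree_iff {p : G.Walk u v} :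
    IsAltPathFromFree M p ↔ IsUnmatched M u ∧ IsAltPathUnmatchedStart M p := by
  refine and_congr_right fun hu => ⟨fun hp => ⟨hp, ?_⟩, And.left⟩
  cases p with
  | nil => simp
  | cons h p => simpa using hu _

lemma IsAltPathFromFree.unmatchedStart {p : G.Walk u v} (hp : IsAltPathFromFree M p) :
    IsAltPathUnmatchedStart M p := (isAltPathFromFree_iff.1 hp).2

lemma bodd_eq_true_iff (n : ℕ) : n.bodd = true ↔ n % 2 = 1 := by
  rw [Nat.mod_two_of_bodd]; cases n.bodd <;> simp

lemma bodd_eq_false_iff (n : ℕ) : n.bodd = false ↔ n % 2 = 0 := by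
  rw [Nat.mod_two_of_bodd]; cases n.bodd <;> simp

lemma isAltPathUnmatchedStart_concat_iff {p : G.Walk u v} {h : G.Adj v w} :
    IsAltPathUnmatchedStart M (p.concat h) ↔
      IsAltPathUnmatchedStart M p ∧ w ∉ p.support ∧ (M.Adj v w ↔ p.length % 2 = 1) := by
  rw [isAltPathUnmatchedStart_iff, isAltPathUnmatchedStart_iff, Walk.concat_isPath_iff,
    altFrom_concat, Bool.false_xor, bodd_eq_true_iff]
  tauto

lemma isAltPathFromFree_concat_iff {p : G.Walk u v} {h : G.Adj v w} :
    IsAltPathFromFree M (p.concat h) ↔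
      IsAltPathFromFree M p ∧ w ∉ p.support ∧ (M.Adj v w ↔ p.length % 2 = 1) := by
  rw [isAltPathFromFree_iff, isAltPathFromFree_iff, isAltPathUnmatchedStart_concat_iff, and_assoc]

lemma IsAltPathFromFree.of_append_left {p : G.Walk u v} {q : G.Walk v w}
    (h : IsAltPathFromFree M (p.append q)) : IsAltPathFromFree M p := by
  rw [isAltPathFromFree_iff, isAltPathUnmatchedStart_iff, altFrom_append] at h
  rw [isAltPathFromFree_iff, isAltPathUnmatchedStart_iff]
  exact ⟨h.1, h.2.1.of_append_left, h.2.2.1⟩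

lemma isPath_append {p : G.Walk u v} {q : G.Walk v w} (hp : p.IsPath) (hq : q.IsPath)
    (h : ∀ x ∈ p.support, x ∈ q.support → x = v) : (p.append q).IsPath := by
  rw [Walk.isPath_def, Walk.support_append, List.nodup_append']
  have hq' := hq.support_nodup
  rw [← Walk.cons_tail_support, List.nodup_cons] at hq'
  refine ⟨hp.support_nodup, hq'.2, fun x hx hx' => hq'.1 ?_⟩
  exact h x hx (List.mem_of_mem_tail hx') ▸ hx'

lemma IsAltPathUnmatchedStart.append {p : G.Walk u v} {q : G.Walk v w}
    (hp : IsAltPathUnmatchedStart M p) (hq : IsAltPathUnmatchedStart M q)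
    (heven : p.length % 2 = 0) (h : ∀ x ∈ p.support, x ∈ q.support → x = v) :
    IsAltPathUnmatchedStart M (p.append q) := by
  rw [isAltPathUnmatchedStart_iff] at hp hq ⊢
  refine ⟨isPath_append hp.1 hq.1 h, (altFrom_append _ _ _).2 ⟨hp.2, ?_⟩⟩
  rw [(bodd_eq_false_iff _).2 heven]
  exact hq.2

lemma IsAltPathUnmatchedStart.of_append_right {p : G.Walk u v} {q : G.Walk v w}
    (h : IsAltPathUnmatchedStart M (p.append q)) (heven : p.length % 2 = 0) :
    IsAltPathUnmatchedStart M q := by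
  rw [isAltPathUnmatchedStart_iff, altFrom_append, (bodd_eq_false_iff _).2 heven] at h
  exact isAltPathUnmatchedStart_iff.2 ⟨h.1.of_append_right, h.2.2⟩

lemma IsAltPathFromFree.append {p : G.Walk u v} {q : G.Walk v w} (hp : IsAltPathFromFree M p)
    (hq : IsAltPathUnmatchedStart M q) (heven : p.length % 2 = 0)
    (h : ∀ x ∈ p.support, x ∈ q.support → x = v) : IsAltPathFromFree M (p.append q) :=
  isAltPathFromFree_iff.2 ⟨hp.1, hp.unmatchedStart.append hq heven h⟩

/-- Some alternating path from `u` to `v`, whose first edge is matched iff `s = true`, has length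
`n` and all its vertices in `X`. -/
def HasAltPath (M : G.Subgraph) (s : Bool) (n : ℕ) (X : Set V) (u v : V) : Prop :=
  ∃ p : G.Walk u v, p.IsPath ∧ AltFrom M s p ∧ p.length = n ∧ ∀ x ∈ p.support, x ∈ X

namespace HasAltPath

variable {s : Bool} {n : ℕ} {X Y : Set V}

lemma nil (s : Bool) (hu : u ∈ X) : HasAltPath M s 0 X u u :=
  ⟨.nil, by simp, by simp, rfl, by simpa using hu⟩

lemma single (h : G.Adj u v) (hs : M.Adj u v ↔ s = true) (hu : u ∈ X) (hv : v ∈ X) :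
    HasAltPath M s 1 X u v :=
  ⟨.cons h .nil, by simp [h.ne], by simpa using hs, rfl, by simp [hu, hv]⟩

lemma trans {s' : Bool} {k : ℕ} (h : HasAltPath M s n X u v) (h' : HasAltPath M s' k Y v w)
    (hs : s' = (s ^^ n.bodd)) (hXY : ∀ x ∈ X, x ∈ Y → x = v) :
    HasAltPath M s (n + k) (X ∪ Y) u w := by
  obtain ⟨p, hp, ha, rfl, hX⟩ := h
  obtain ⟨q, hq, ha', rfl, hY⟩ := h'
  subst hs
  refine ⟨p.append q, isPath_append hp hq fun x hx hx' => hXY x (hX x hx) (hY x hx'),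
    (altFrom_append _ _ _).2 ⟨ha, ha'⟩, by simp, fun x hx => ?_⟩
  exact ((Walk.mem_support_append_iff _ _).1 hx).imp (hX x) (hY x)

lemma reverse (h : HasAltPath M s n X u v) : HasAltPath M (s ^^ !n.bodd) n X v u := by
  obtain ⟨p, hp, ha, rfl, hX⟩ := h
  exact ⟨p.reverse, hp.reverse, ha.reverse, by simp, by simpa using hX⟩

lemma mono (h : HasAltPath M s n X u v) (hXY : X ⊆ Y) : HasAltPath M s n Y u v := by
  obtain ⟨p, hp, ha, hn, hX⟩ := h
  exact ⟨p, hp, ha, hn, fun x hx => hXY (hX x hx)⟩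

end HasAltPath

lemma mem_support_concat {x : V} (p : G.Walk u v) (h : G.Adj v w) :
    x ∈ (p.concat h).support ↔ x ∈ p.support ∨ x = w := by
  simp [Walk.support_concat]

lemma exists_eq_concat (p : G.Walk u v) (hp : p.length ≠ 0) :
    ∃ (w : V) (q : G.Walk u w) (h : G.Adj w v), p = q.concat h :=
  ⟨_, _, _, (Walk.concat_dropLast (Walk.adj_penultimate
    (Walk.not_nil_iff_lt_length.2 (by omega)))).symm⟩

lemma IsAltPathFromFree.mate_mem_support (hM : M.IsMatching) {f : V} {p : G.Walk f v}
    (hp : IsAltPathFromFree M p) :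
    ∀ z ∈ p.support, ∀ y, M.Adj z y → y ∈ p.support ∨ (z = v ∧ p.length % 2 = 1) := by
  induction p using Walk.concatRec with
  | Hnil =>
    intro z hz y hy
    rw [Walk.support_nil, List.mem_singleton] at hz
    exact absurd hy (hz ▸ hp.1 y)
  | @Hconcat u v w p h ih =>
    obtain ⟨hp, -, hlast⟩ := isAltPathFromFree_concat_iff.1 hp
    intro z hz y hy
    rw [mem_support_concat] at hz ⊢
    rw [Walk.length_concat]
    rcases hz with hz | rfl
    · rcases ih hp z hz y hy with hmem | ⟨rfl, hodd⟩
      · exact Or.inl (Or.inl hmem)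
      · exact Or.inl (Or.inr (hM.eq_of_adj_left hy (hlast.2 hodd)))
    · by_cases hodd : p.length % 2 = 1
      · rw [hM.eq_of_adj_left hy (hlast.2 hodd).symm]
        exact Or.inl (Or.inl p.end_mem_support)
      · exact Or.inr ⟨rfl, by omega⟩

lemma IsAltPathFromFree.mate_notMem_support (hM : M.IsMatching) {f : V} {p : G.Walk f u}
    (hp : IsAltPathFromFree M p) (hodd : p.length % 2 = 1) (hv : M.Adj u v) : v ∉ p.support := by
  obtain ⟨w, q, h, rfl⟩ := exists_eq_concat p (by omega)
  obtain ⟨hq, hu, -⟩ := isAltPathFromFree_concat_iff.1 hp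
  rw [Walk.length_concat] at hodd
  rw [mem_support_concat]
  rintro (hvq | rfl)
  · rcases hq.mate_mem_support hM v hvq u hv.symm with huq | ⟨-, hq_odd⟩
    exacts [hu huq, by omega]
  · exact hv.ne rfl

end Alternation

section Levels

variable {V : Type*} {G : SimpleGraph V} {M : G.Subgraph} {f v x y : V}

/-- The natural number standing for `∞` in the truncated levels below. It is even and more than
twice the length of every path. -/
noncomputable def levelCap (V : Type*) : ℕ := 2 * (Nat.card V + 2)

open Classical in
/-- The even level as a natural number, `∞` being replaced by `levelCap V`. -/
noncomputable def elev (M : G.Subgraph) (v : V) : ℕ :=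
  if evenlevel M v = ⊤ then levelCap V else (evenlevel M v).toNat

open Classical in
/-- The odd level as a natural number, `∞` being replaced by `levelCap V + 1`, which keeps the
parity. -/
noncomputable def olev (M : G.Subgraph) (v : V) : ℕ :=
  if oddlevel M v = ⊤ then levelCap V + 1 else (oddlevel M v).toNat

lemma levelCap_mod (V : Type*) : levelCap V % 2 = 0 := Nat.mul_mod_right _ _

lemma two_mul_length_lt_levelCap [Finite V] {p : G.Walk f v} (hp : p.IsPath) :
    2 * p.length + 4 < levelCap V := by
  have := Fintype.ofFinite V
  have hlt := hp.length_lt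
  rw [← Nat.card_eq_fintype_card] at hlt
  unfold levelCap
  omega

lemma sInf_mem_of_ne_top {S : Set ℕ∞} (h : sInf S ≠ ⊤) : sInf S ∈ S :=
  csInf_mem (Set.nonempty_iff_ne_empty.2 fun hS => h (by rw [hS, sInf_empty]))

lemma exists_evenlevelPath (h : evenlevel M v ≠ ⊤) :
    ∃ (f : V) (p : G.Walk f v), IsEvenlevelPath M p := by
  obtain ⟨f, p, hp, heven, hlen⟩ := sInf_mem_of_ne_top h
  exact ⟨f, p, hp, heven, hlen.symm⟩

lemma exists_oddlevelPath (h : oddlevel M v ≠ ⊤) :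
    ∃ (f : V) (p : G.Walk f v), IsOddlevelPath M p := by
  obtain ⟨f, p, hp, hodd, hlen⟩ := sInf_mem_of_ne_top h
  exact ⟨f, p, hp, hodd, hlen.symm⟩

lemma evenlevel_cases (M : G.Subgraph) (v : V) :
    evenlevel M v = elev M v ∨ (evenlevel M v = ⊤ ∧ elev M v = levelCap V) := by
  by_cases h : evenlevel M v = ⊤
  · exact Or.inr ⟨h, if_pos h⟩
  · exact Or.inl (by rw [elev, if_neg h, ENat.natCast_toNat h])

lemma oddlevel_cases (M : G.Subgraph) (v : V) :
    oddlevel M v = olev M v ∨ (oddlevel M v = ⊤ ∧ olev M v = levelCap V + 1) := by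
  by_cases h : oddlevel M v = ⊤
  · exact Or.inr ⟨h, if_pos h⟩
  · exact Or.inl (by rw [olev, if_neg h, ENat.natCast_toNat h])

lemma evenlevel_of_lt (h : elev M v < levelCap V) : evenlevel M v = elev M v :=
  (evenlevel_cases M v).resolve_right fun h' => by omega

lemma oddlevel_of_lt (h : olev M v < levelCap V) : oddlevel M v = olev M v :=
  (oddlevel_cases M v).resolve_right fun h' => by omega

lemma IsEvenlevelPath.length_eq {p : G.Walk f v} (hp : IsEvenlevelPath M p) :
    p.length = elev M v := by
  rw [elev, ← hp.2.2, if_neg (ENat.natCast_ne_top _), ENat.toNat_natCast]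

lemma IsOddlevelPath.length_eq {p : G.Walk f v} (hp : IsOddlevelPath M p) :
    p.length = olev M v := by
  rw [olev, ← hp.2.2, if_neg (ENat.natCast_ne_top _), ENat.toNat_natCast]

lemma elev_le {p : G.Walk f v} (hp : IsAltPathFromFree M p) (heven : p.length % 2 = 0) :
    elev M v ≤ p.length := by
  have hle : evenlevel M v ≤ p.length := sInf_le ⟨f, p, hp, Nat.even_iff.2 heven, rfl⟩
  obtain h | ⟨h, -⟩ := evenlevel_cases M v
  · exact_mod_cast h ▸ hle
  · simp [h] at hle

lemma olev_le {p : G.Walk f v} (hp : IsAltPathFromFree M p) (hodd : p.length % 2 = 1) :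
    olev M v ≤ p.length := by
  have hle : oddlevel M v ≤ p.length := sInf_le ⟨f, p, hp, Nat.odd_iff.2 hodd, rfl⟩
  obtain h | ⟨h, -⟩ := oddlevel_cases M v
  · exact_mod_cast h ▸ hle
  · simp [h] at hle

lemma elev_or_olev_le {p : G.Walk f v} (hp : IsAltPathFromFree M p) :
    elev M v ≤ p.length ∨ olev M v ≤ p.length :=
  (Nat.mod_two_eq_zero_or_one p.length).imp (elev_le hp) (olev_le hp)

lemma exists_length_eq_elev (h : elev M v < levelCap V) :
    ∃ (f : V) (p : G.Walk f v), IsAltPathFromFree M p ∧ p.length = elev M v := by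
  obtain ⟨f, p, hp⟩ := exists_evenlevelPath (M := M) (evenlevel_of_lt h ▸ ENat.natCast_ne_top _)
  exact ⟨f, p, hp.1, hp.length_eq⟩

lemma exists_length_eq_olev (h : olev M v < levelCap V) :
    ∃ (f : V) (p : G.Walk f v), IsAltPathFromFree M p ∧ p.length = olev M v := by
  obtain ⟨f, p, hp⟩ := exists_oddlevelPath (M := M) (oddlevel_of_lt h ▸ ENat.natCast_ne_top _)
  exact ⟨f, p, hp.1, hp.length_eq⟩

lemma elev_mod (M : G.Subgraph) (v : V) : elev M v % 2 = 0 := by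
  by_cases h : evenlevel M v = ⊤
  · rw [elev, if_pos h, levelCap_mod]
  · obtain ⟨f, p, hp⟩ := exists_evenlevelPath h
    rw [← hp.length_eq, ← Nat.even_iff]
    exact hp.2.1

lemma olev_mod (M : G.Subgraph) (v : V) : olev M v % 2 = 1 := by
  by_cases h : oddlevel M v = ⊤
  · rw [olev, if_pos h, Nat.add_mod, levelCap_mod]
  · obtain ⟨f, p, hp⟩ := exists_oddlevelPath h
    rw [← hp.length_eq, ← Nat.odd_iff]
    exact hp.2.1

lemma elev_of_isUnmatched (hf : IsUnmatched M f) : elev M f = 0 := by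
  have hnil : IsAltPathFromFree M (Walk.nil : G.Walk f f) := ⟨hf, by simp [IsAltPath]⟩
  simpa using elev_le hnil rfl

lemma isUnmatched_of_elev_eq_zero (h : elev M f = 0) : IsUnmatched M f := by
  obtain ⟨g, p, hp, hlen⟩ := exists_length_eq_elev (M := M) (v := f) (by unfold levelCap; omega)
  cases p with
  | nil => exact hp.1
  | cons _ _ => simp [h] at hlen

lemma elev_ne_zero_of_adj (h : M.Adj x y) : elev M x ≠ 0 :=
  fun h0 => isUnmatched_of_elev_eq_zero h0 y h

lemma elev_mate_le (hM : M.IsMatching) (h : M.Adj x y) (hx : olev M x < levelCap V) :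
    elev M y ≤ olev M x + 1 := by
  obtain ⟨f, p, hp, hlen⟩ := exists_length_eq_olev hx
  have hodd : p.length % 2 = 1 := hlen ▸ olev_mod M x
  have hle := elev_le (isAltPathFromFree_concat_iff.2
    ⟨hp, hp.mate_notMem_support hM hodd h, iff_of_true h hodd⟩ : IsAltPathFromFree M
      (p.concat h.adj_sub)) (by rw [Walk.length_concat]; omega)
  rwa [Walk.length_concat, hlen] at hle

lemma olev_mate_lt (hM : M.IsMatching) (h : M.Adj x y) (hy : elev M y < levelCap V) :
    olev M x < elev M y := by
  obtain ⟨f, p, hp, hlen⟩ := exists_length_eq_elev hy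
  have hpos := elev_ne_zero_of_adj h.symm
  have heven := elev_mod M y
  obtain ⟨w, q, hwy, rfl⟩ := exists_eq_concat p (by omega)
  obtain ⟨hq, -, hlast⟩ := isAltPathFromFree_concat_iff.1 hp
  rw [Walk.length_concat] at hlen
  obtain rfl := hM.eq_of_adj_right h (hlast.2 (by omega))
  have := olev_le hq (by omega)
  omega

lemma elev_mate (hM : M.IsMatching) (h : M.Adj x y) :
    elev M y = olev M x + 1 ∨ (levelCap V ≤ elev M y ∧ levelCap V ≤ olev M x) := by
  have hle := elev_mate_le hM h
  have hlt := olev_mate_lt hM h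
  have hcap := levelCap_mod V
  have hodd := olev_mod M x
  omega

lemma elev_or_olev_le_of_mem {p : G.Walk f v} (hp : IsAltPathFromFree M p)
    (hx : x ∈ p.support) : elev M x ≤ p.length ∨ olev M x ≤ p.length := by
  obtain ⟨q, r, rfl⟩ := Walk.mem_support_iff_exists_append.1 hx
  have := elev_or_olev_le hp.of_append_left
  rw [Walk.length_append]
  omega

lemma olev_le_of_adj (h : G.Adj x y) (hn : ¬ M.Adj x y) (hx : elev M x < levelCap V) :
    olev M y ≤ elev M x + 1 ∨ elev M y ≤ elev M x := by
  obtain ⟨f, p, hp, hlen⟩ := exists_length_eq_elev hx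
  have heven := elev_mod M x
  by_cases hy : y ∈ p.support
  · have := elev_or_olev_le_of_mem hp hy
    omega
  · have hle := olev_le (isAltPathFromFree_concat_iff.2 ⟨hp, hy, iff_of_false hn (by omega)⟩ :
      IsAltPathFromFree M (p.concat h)) (by rw [Walk.length_concat]; omega)
    rw [Walk.length_concat] at hle
    omega

lemma tenacity_of_lt (h : elev M v + olev M v < levelCap V) :
    tenacity M v = (elev M v + olev M v : ℕ) := by
  rw [tenacity, evenlevel_of_lt (by omega), oddlevel_of_lt (by omega), Nat.cast_add]

lemma le_tenacity_of_le {k : ℕ} (h : k ≤ elev M v + olev M v) : (k : ℕ∞) ≤ tenacity M v := by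
  unfold tenacity
  obtain he | ⟨he, -⟩ := evenlevel_cases M v
  · obtain ho | ⟨ho, -⟩ := oddlevel_cases M v
    · rw [he, ho]
      exact_mod_cast h
    · simp [ho]
  · simp [he]

lemma elev_add_olev_of_tenacity {k : ℕ} (h : tenacity M v = k) : elev M v + olev M v = k := by
  unfold tenacity at h
  obtain he | ⟨he, -⟩ := evenlevel_cases M v
  · obtain ho | ⟨ho, -⟩ := oddlevel_cases M v
    · rw [he, ho] at h
      exact_mod_cast h
    · simp [ho] at h
  · simp [he] at h

lemma IsLevelPath.isAltPathFromFree {p : G.Walk f v} (hp : IsLevelPath M p) :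
    IsAltPathFromFree M p := hp.elim And.left And.left

lemma IsLevelPath.length_eq {p : G.Walk f v} (hp : IsLevelPath M p) :
    p.length = elev M v ∨ p.length = olev M v :=
  hp.imp IsEvenlevelPath.length_eq IsOddlevelPath.length_eq

lemma isEvenlevelPath_of_length_eq [Finite V] {p : G.Walk f v} (hp : IsAltPathFromFree M p)
    (h : p.length = elev M v) : IsEvenlevelPath M p := by
  have hlt := two_mul_length_lt_levelCap hp.2.1
  exact ⟨hp, Nat.even_iff.2 (h ▸ elev_mod M v), by rw [evenlevel_of_lt (by omega), h]⟩

lemma isOddlevelPath_of_length_eq [Finite V] {p : G.Walk f v} (hp : IsAltPathFromFree M p)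
    (h : p.length = olev M v) : IsOddlevelPath M p := by
  have hlt := two_mul_length_lt_levelCap hp.2.1
  exact ⟨hp, Nat.odd_iff.2 (h ▸ olev_mod M v), by rw [oddlevel_of_lt (by omega), h]⟩

end Levels

section Unbased

variable {V : Type*}

/-- The classes (fibres of the base function `β`) that are met by `S` while their base is not in
`S`. -/
def unbased (β : V → V) (S : Set V) : Set V := {c | c ∉ S ∧ ∃ x ∈ S, β x = c}

variable {β : V → V} {S : Set V} {x y : V}

lemma mem_of_unbased_eq_empty (h : unbased β S = ∅) (hx : x ∈ S) : β x ∈ S := by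
  by_contra hβ
  exact Set.eq_empty_iff_forall_notMem.1 h (β x) ⟨hβ, x, hx, rfl⟩

lemma unbased_insert_subset_insert (β : V → V) (S : Set V) (y : V) :
    unbased β (insert y S) ⊆ insert (β y) (unbased β S) := by
  rintro c ⟨hc, z, rfl | hz, rfl⟩
  · exact Set.mem_insert _ _
  · exact Set.mem_insert_of_mem _ ⟨fun h => hc (Set.mem_insert_of_mem _ h), z, hz, rfl⟩

lemma unbased_insert_subset_of_mem (hy : β y ∈ S) : unbased β (insert y S) ⊆ unbased β S :=
  fun _ hc => (unbased_insert_subset_insert β S y hc).resolve_left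
    fun h => hc.1 (Set.mem_insert_of_mem _ (h ▸ hy))

lemma unbased_insert_subset (hx : x ∈ S) (h : β y ≠ y → β x = β y) :
    unbased β (insert y S) ⊆ unbased β S := by
  rintro c ⟨hc, z, hz, rfl⟩
  rw [Set.mem_insert_iff, not_or] at hc
  refine ⟨hc.2, ?_⟩
  rcases hz with rfl | hz
  exacts [⟨x, hx, h hc.1⟩, ⟨z, hz, rfl⟩]

open Classical in
lemma ncard_unbased_insert_le [Finite V] (hx : x ∈ S) (hy : y ∉ S) :
    (unbased β (insert y S)).ncard + (if β x = β y then 1 else 0) ≤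
      (unbased β S).ncard + (if β y ≠ y then 1 else 0) := by
  by_cases hxy : β x = β y <;> by_cases hβ : β y = y
  · have hsub := unbased_insert_subset hx fun _ => hxy
    have hlt : unbased β (insert y S) ⊂ unbased β S :=
      ⟨hsub, fun h => (h ⟨hy, x, hx, hxy.trans hβ⟩).1 (Set.mem_insert _ _)⟩
    simpa [hxy, hβ] using Set.ncard_lt_ncard hlt
  · simpa [hxy, hβ] using Set.ncard_le_ncard (unbased_insert_subset hx fun _ => hxy)
  · rw [if_neg hxy, if_neg (not_not.2 hβ)]
    exact Set.ncard_le_ncard (unbased_insert_subset hx fun h => absurd hβ h)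
  · simpa [hxy, hβ] using (Set.ncard_le_ncard (unbased_insert_subset_insert β S y)).trans
      (Set.ncard_insert_le _ _)

end Unbased

section Potential

variable {V : Type*} {G : SimpleGraph V} {M : G.Subgraph} {n : ℕ} {B : ℕ → V → V} {E O : V → ℕ}
  {b u v w x y : V}

open Classical in
/-- The number of `j ≤ n` such that `x` and `y` lie in the same class of `B j`. -/
noncomputable def sharedCount (n : ℕ) (B : ℕ → V → V) (x y : V) : ℕ :=
  Nat.count (fun j => B j x = B j y) (n + 1)

open Classical in
/-- The number of `j ≤ n` such that `x` is not the base of its class of `B j`. -/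
noncomputable def properCount (n : ℕ) (B : ℕ → V → V) (x : V) : ℕ :=
  Nat.count (fun j => B j x ≠ x) (n + 1)

/-- A feasible dual solution: class functions `B j`, `j ≤ n`, and lower bounds `E`, `O` for the
lengths of even and odd alternating paths, under which no edge decreases the slack of a path. -/
structure IsDual (M : G.Subgraph) (n : ℕ) (B : ℕ → V → V) (E O : V → ℕ) : Prop where
  mate : ∀ j ≤ n, ∀ x y, M.Adj x y → B j x ≠ x → B j y = B j x ∧ B j y ≠ y
  matched : ∀ x y, M.Adj x y → E y ≤ O x + 1
  unmatched : ∀ x y, G.Adj x y → ¬ M.Adj x y →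
    O y + 2 * properCount n B y ≤ E x + 1 + 2 * sharedCount n B x y

/-- The vertices of a walk, as a set. -/
def supportSet (p : G.Walk u v) : Set V := {x | x ∈ p.support}

/-- The lower bound at `x` for paths whose length has the parity of `k`. -/
def levelBound (E O : V → ℕ) (k : ℕ) (x : V) : ℕ := if k % 2 = 0 then E x else O x

/-- The number of pairs of a `j ≤ n` and an unbased class of `B j`. -/
noncomputable def totalUnbased (n : ℕ) (B : ℕ → V → V) (S : Set V) : ℕ :=
  ∑ j ∈ Finset.range (n + 1), (unbased (B j) S).ncard

/-- The path attains the lower bound of `IsDual.levelBound_add_le`. -/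
def IsTight (n : ℕ) (B : ℕ → V → V) (E O : V → ℕ) (p : G.Walk b x) : Prop :=
  E b + p.length = levelBound E O p.length x + 2 * totalUnbased n B (supportSet p)

lemma supportSet_concat (p : G.Walk u v) (h : G.Adj v w) :
    supportSet (p.concat h) = insert w (supportSet p) :=
  Set.ext fun _ => (mem_support_concat p h).trans or_comm

lemma levelBound_of_even {k : ℕ} (h : k % 2 = 0) (x : V) : levelBound E O k x = E x := if_pos h

lemma levelBound_of_odd {k : ℕ} (h : k % 2 = 1) (x : V) : levelBound E O k x = O x :=
  if_neg (by omega)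

lemma count_eq_sum (P : ℕ → Prop) [DecidablePred P] (k : ℕ) :
    Nat.count P k = ∑ j ∈ Finset.range k, if P j then 1 else 0 := by
  rw [Nat.count_eq_card_filter_range, Finset.card_filter]

lemma unbased_nil {β : V → V} (hb : β b = b) :
    unbased β (supportSet (Walk.nil : G.Walk b b)) = ∅ := by
  refine Set.eq_empty_iff_forall_notMem.2 ?_
  rintro c ⟨hc, x, hx, rfl⟩
  obtain rfl : x = b := by simpa [supportSet] using hx
  exact hc (by rwa [hb])

lemma totalUnbased_nil (hb : ∀ j ≤ n, B j b = b) :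
    totalUnbased n B (supportSet (Walk.nil : G.Walk b b)) = 0 := by
  refine Finset.sum_eq_zero fun j hj => ?_
  rw [unbased_nil (hb j (Finset.mem_range_succ_iff.1 hj)), Set.ncard_empty]

lemma totalUnbased_insert_add_le [Finite V] {S : Set V} (hx : x ∈ S) (hy : y ∉ S) :
    totalUnbased n B (insert y S) + sharedCount n B x y ≤
      totalUnbased n B S + properCount n B y := by
  unfold totalUnbased sharedCount properCount
  rw [count_eq_sum, count_eq_sum, ← Finset.sum_add_distrib, ← Finset.sum_add_distrib]
  exact Finset.sum_le_sum fun j _ => ncard_unbased_insert_le hx hy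

open Classical in
lemma ncard_unbased_insert_eq [Finite V] {S : Set V} (hx : x ∈ S) (hy : y ∉ S)
    (h : totalUnbased n B S + properCount n B y ≤
      totalUnbased n B (insert y S) + sharedCount n B x y)
    {j : ℕ} (hj : j ≤ n) :
    (unbased (B j) (insert y S)).ncard + (if B j x = B j y then 1 else 0) =
      (unbased (B j) S).ncard + (if B j y ≠ y then 1 else 0) := by
  have heq := (totalUnbased_insert_add_le hx hy).antisymm h
  unfold totalUnbased sharedCount properCount at heq
  rw [count_eq_sum, count_eq_sum, ← Finset.sum_add_distrib, ← Finset.sum_add_distrib] at heq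
  exact (Finset.sum_eq_sum_iff_of_le fun j _ => ncard_unbased_insert_le hx hy).1 heq j
    (Finset.mem_range_succ_iff.2 hj)

namespace IsDual

lemma unbased_insert_subset (D : IsDual M n B E O) {j : ℕ} (hj : j ≤ n) {S : Set V}
    (h : M.Adj x y) (hx : x ∈ S) : unbased (B j) (insert y S) ⊆ unbased (B j) S :=
  MV.unbased_insert_subset hx fun hy => (D.mate j hj y x h.symm hy).1

variable [Finite V]

lemma totalUnbased_insert_le (D : IsDual M n B E O) {S : Set V} (h : M.Adj x y) (hx : x ∈ S) :
    totalUnbased n B (insert y S) ≤ totalUnbased n B S :=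
  Finset.sum_le_sum fun _ hj =>
    Set.ncard_le_ncard (D.unbased_insert_subset (Finset.mem_range_succ_iff.1 hj) h hx)

lemma unbased_insert_eq (D : IsDual M n B E O) {S : Set V} (h : M.Adj x y) (hx : x ∈ S)
    (hle : totalUnbased n B S ≤ totalUnbased n B (insert y S)) {j : ℕ} (hj : j ≤ n) :
    unbased (B j) (insert y S) = unbased (B j) S := by
  refine Set.eq_of_subset_of_ncard_le (D.unbased_insert_subset hj h hx) ?_
  exact ((Finset.sum_eq_sum_iff_of_le fun j hj => Set.ncard_le_ncard
    (D.unbased_insert_subset (Finset.mem_range_succ_iff.1 hj) h hx)).1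
    ((D.totalUnbased_insert_le h hx).antisymm hle) j (Finset.mem_range_succ_iff.2 hj)).ge

lemma levelBound_concat_le (D : IsDual M n B E O) {p : G.Walk b x} {h : G.Adj x y}
    (hp : IsAltPathUnmatchedStart M (p.concat h)) :
    levelBound E O (p.concat h).length y + 2 * totalUnbased n B (supportSet (p.concat h)) ≤
      levelBound E O p.length x + 2 * totalUnbased n B (supportSet p) + 1 := by
  obtain ⟨-, hy, hlast⟩ := isAltPathUnmatchedStart_concat_iff.1 hp
  have hx : x ∈ supportSet p := p.end_mem_support
  rw [supportSet_concat, Walk.length_concat]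
  rcases Nat.mod_two_eq_zero_or_one p.length with heven | hodd
  · rw [levelBound_of_even heven, levelBound_of_odd (by omega)]
    have hOE := D.unmatched x y h (by rw [hlast]; omega)
    have htotal := totalUnbased_insert_add_le (n := n) (B := B) hx hy
    omega
  · rw [levelBound_of_odd hodd, levelBound_of_even (by omega)]
    have hEO := D.matched x y (hlast.2 hodd)
    have htotal := D.totalUnbased_insert_le (hlast.2 hodd) hx
    omega

lemma levelBound_add_le (D : IsDual M n B E O) {p : G.Walk b x} (hb : ∀ j ≤ n, B j b = b)
    (hp : IsAltPathUnmatchedStart M p) :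
    levelBound E O p.length x + 2 * totalUnbased n B (supportSet p) ≤ E b + p.length := by
  induction p using Walk.concatRec with
  | Hnil => simp [totalUnbased_nil hb, levelBound]
  | Hconcat p h ih =>
    have hle := ih hb (isAltPathUnmatchedStart_concat_iff.1 hp).1
    have hstep := D.levelBound_concat_le hp
    rw [Walk.length_concat] at hstep ⊢
    omega

lemma isTight_of_concat (D : IsDual M n B E O) {p : G.Walk b x} {h : G.Adj x y}
    (hb : ∀ j ≤ n, B j b = b) (hp : IsAltPathUnmatchedStart M (p.concat h))
    (ht : IsTight n B E O (p.concat h)) : IsTight n B E O p := by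
  have hle := D.levelBound_add_le hb (isAltPathUnmatchedStart_concat_iff.1 hp).1
  have hstep := D.levelBound_concat_le hp
  unfold IsTight at ht ⊢
  rw [Walk.length_concat] at ht hstep
  omega

lemma tight_matched (D : IsDual M n B E O) {p : G.Walk b x} {h : G.Adj x y}
    (hb : ∀ j ≤ n, B j b = b) (hp : IsAltPathUnmatchedStart M (p.concat h))
    (ht : IsTight n B E O (p.concat h)) (hodd : p.length % 2 = 1) :
    E y = O x + 1 ∧
      ∀ j ≤ n, unbased (B j) (supportSet (p.concat h)) = unbased (B j) (supportSet p) := by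
  have ht' := D.isTight_of_concat hb hp ht
  have hm : M.Adj x y := (isAltPathUnmatchedStart_concat_iff.1 hp).2.2.2 hodd
  have hx : x ∈ supportSet p := p.end_mem_support
  unfold IsTight at ht ht'
  rw [Walk.length_concat, levelBound_of_even (by omega), supportSet_concat] at ht
  rw [levelBound_of_odd hodd] at ht'
  have hEO := D.matched x y hm
  have htotal := D.totalUnbased_insert_le hm hx
  refine ⟨by omega, fun j hj => ?_⟩
  rw [supportSet_concat]
  exact D.unbased_insert_eq hm hx (by omega) hj

open Classical in
lemma tight_unmatched (D : IsDual M n B E O) {p : G.Walk b x} {h : G.Adj x y}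
    (hb : ∀ j ≤ n, B j b = b) (hp : IsAltPathUnmatchedStart M (p.concat h))
    (ht : IsTight n B E O (p.concat h)) (heven : p.length % 2 = 0) :
    O y + 2 * properCount n B y = E x + 1 + 2 * sharedCount n B x y ∧
      ∀ j ≤ n, (unbased (B j) (supportSet (p.concat h))).ncard +
          (if B j x = B j y then 1 else 0) =
        (unbased (B j) (supportSet p)).ncard + (if B j y ≠ y then 1 else 0) := by
  have ht' := D.isTight_of_concat hb hp ht
  obtain ⟨-, hy, hlast⟩ := isAltPathUnmatchedStart_concat_iff.1 hp
  have hx : x ∈ supportSet p := p.end_mem_support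
  unfold IsTight at ht ht'
  rw [Walk.length_concat, levelBound_of_odd (by omega), supportSet_concat] at ht
  rw [levelBound_of_even heven] at ht'
  have hOE := D.unmatched x y h (by rw [hlast]; omega)
  have htotal := totalUnbased_insert_add_le (n := n) (B := B) hx hy
  refine ⟨by omega, fun j hj => ?_⟩
  rw [supportSet_concat]
  exact ncard_unbased_insert_eq hx hy (by omega) hj

lemma base_eq_of_tight_concat (D : IsDual M n B E O) {p : G.Walk b x} {h : G.Adj x y}
    (hb : ∀ j ≤ n, B j b = b) (hp : IsAltPathUnmatchedStart M (p.concat h))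
    (ht : IsTight n B E O (p.concat h)) {j : ℕ} (hj : j ≤ n) (hy : B j y ≠ y)
    (hmem : B j y ∈ p.support) : B j x = B j y := by
  rcases Nat.mod_two_eq_zero_or_one p.length with heven | hodd
  · by_contra hxy
    have hcount := (D.tight_unmatched hb hp ht heven).2 j hj
    rw [if_neg hxy, if_pos hy, supportSet_concat] at hcount
    have hle := Set.ncard_le_ncard
      (unbased_insert_subset_of_mem (show B j y ∈ supportSet p from hmem))
    omega
  · have hm : M.Adj x y := (isAltPathUnmatchedStart_concat_iff.1 hp).2.2.2 hodd
    exact (D.mate j hj y x hm.symm hy).1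

lemma exists_eq_append_of_tight (D : IsDual M n B E O) {p : G.Walk b x}
    (hb : ∀ j ≤ n, B j b = b) (hp : IsAltPathUnmatchedStart M p) (ht : IsTight n B E O p)
    {j : ℕ} (hj : j ≤ n) (hmem : B j x ∈ p.support) :
    ∃ (q : G.Walk b (B j x)) (r : G.Walk (B j x) x), p = q.append r ∧
      ∀ z ∈ r.support, B j z = B j x := by
  induction p using Walk.concatRec with
  | @Hnil u =>
    rw [hb j hj]
    exact ⟨.nil, .nil, rfl, by simp [hb j hj]⟩
  | @Hconcat u v w p h ih =>
    by_cases hw : B j w = w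
    · rw [hw]
      exact ⟨p.concat h, .nil, by simp, by simp [hw]⟩
    have hmem' := ((mem_support_concat _ _).1 hmem).resolve_right hw
    have hvw := D.base_eq_of_tight_concat hb hp ht hj hw hmem'
    obtain ⟨q, r, hqr, hr⟩ := ih hb (isAltPathUnmatchedStart_concat_iff.1 hp).1
      (D.isTight_of_concat hb hp ht) (by rwa [hvw])
    rw [← hvw]
    refine ⟨q, r.concat h, by rw [hqr, Walk.append_concat], fun z hz => ?_⟩
    rcases (mem_support_concat _ _).1 hz with hz | rfl
    exacts [hr z hz, hvw.symm]

lemma eq_of_mem_tight_even (D : IsDual M n B E O) {c z : V} {p : G.Walk b c}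
    (hb : ∀ j ≤ n, B j b = b) (hp : IsAltPathUnmatchedStart M p) (ht : IsTight n B E O p)
    (heven : p.length % 2 = 0) {j : ℕ} (hj : j ≤ n) (hz : z ∈ p.support) (hc : B j z = c) :
    z = c := by
  by_cases hlen : p.length = 0
  · cases p with
    | nil => simpa using hz
    | cons _ _ => simp at hlen
  obtain ⟨w, q, h, rfl⟩ := exists_eq_concat p hlen
  rw [Walk.length_concat] at heven
  have hunbased := (D.tight_matched hb hp ht (by omega)).2 j hj
  refine ((mem_support_concat _ _).1 hz).resolve_left fun hzq => ?_
  have hcq : c ∈ unbased (B j) (supportSet q) :=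
    ⟨(isAltPathUnmatchedStart_concat_iff.1 hp).2.1, z, hzq, hc⟩
  rw [← hunbased] at hcq
  exact hcq.1 (Walk.end_mem_support _)

end IsDual

end Potential

section Layering

variable {V : Type*} {R : V → V → Prop} {S : V → Prop} {m : V → ℕ} {a b c d x y z : V}
  {l L K T : List V}

/-- The list starts with the given vertex, descends along `R` (where `R c a` says that `c` is a
predecessor of `a`) and ends in a source, i.e. a vertex satisfying `S`. -/
inductive DescChain (R : V → V → Prop) (S : V → Prop) : V → List V → Prop
  | base {a : V} : S a → DescChain R S a [a]
  | step {c a : V} {l : List V} : R c a → DescChain R S c l → DescChain R S a (a :: l)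

/-- The vertex `d` lies on every descending chain from `a`. -/
def Dominates (R : V → V → Prop) (S : V → Prop) (d a : V) : Prop :=
  ∀ l, DescChain R S a l → d ∈ l

/-- Some descending chain starts at `a`. -/
def HasChain (R : V → V → Prop) (S : V → Prop) (a : V) : Prop := ∃ l, DescChain R S a l

namespace DescChain

lemma head_mem (h : DescChain R S a l) : a ∈ l := by
  cases h <;> simp

lemma eq_or_lt (hm : ∀ c a, R c a → m c < m a) (h : DescChain R S a l) (hx : x ∈ l) :
    x = a ∨ m x < m a := by
  induction h with
  | base _ => exact Or.inl (List.mem_singleton.1 hx)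
  | @step c a l hc _ ih =>
    refine (List.mem_cons.1 hx).imp_right fun hx => ?_
    rcases ih hx with rfl | h
    exacts [hm _ _ hc, h.trans (hm _ _ hc)]

lemma le (hm : ∀ c a, R c a → m c < m a) (h : DescChain R S a l) (hx : x ∈ l) : m x ≤ m a := by
  rcases h.eq_or_lt hm hx with rfl | h
  exacts [le_rfl, h.le]

lemma exists_eq_append (hm : ∀ c a, R c a → m c < m a) (h : DescChain R S a l) (hx : x ∈ l) :
    ∃ l₁ l₂, l = l₁ ++ l₂ ∧ DescChain R S x l₂ ∧
      (∀ l', DescChain R S x l' → DescChain R S a (l₁ ++ l')) ∧ ∀ y ∈ l₁, m x < m y := by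
  induction h with
  | @base a ha =>
    obtain rfl := List.mem_singleton.1 hx
    exact ⟨[], [x], rfl, .base ha, fun _ h => h, by simp⟩
  | @step c a l hc hl ih =>
    rcases List.mem_cons.1 hx with rfl | hx
    · exact ⟨[], x :: l, rfl, .step hc hl, fun _ h => h, by simp⟩
    · obtain ⟨l₁, l₂, rfl, hl₂, hreplace, hlt⟩ := ih hx
      refine ⟨a :: l₁, l₂, rfl, hl₂, fun l' h' => .step hc (hreplace l' h'), ?_⟩
      rintro y (_ | ⟨_, hy⟩)
      exacts [(hl.le hm hx).trans_lt (hm _ _ hc), hlt y hy]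

lemma exists_succ (h : DescChain R S a l) (hx : x ∈ l) (hxa : x ≠ a) : ∃ y ∈ l, R x y := by
  induction h with
  | base _ => exact absurd (List.mem_singleton.1 hx) hxa
  | @step c a l hc _ ih =>
    by_cases hxc : x = c
    · exact ⟨a, by simp, hxc ▸ hc⟩
    · obtain ⟨y, hy, hxy⟩ := ih ((List.mem_cons.1 hx).resolve_left hxa) hxc
      exact ⟨y, List.mem_cons_of_mem _ hy, hxy⟩

lemma hasChain (h : DescChain R S a l) (hx : x ∈ l) : HasChain R S x := by
  induction h with
  | base h => exact ⟨_, .base (List.mem_singleton.1 hx ▸ h)⟩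
  | step hc hl ih =>
    rcases List.mem_cons.1 hx with rfl | hx
    exacts [⟨_, .step hc hl⟩, ih hx]

end DescChain

namespace Dominates

lemma refl (a : V) : Dominates R S a a := fun _ h => h.head_mem

lemma hasChain (h : Dominates R S d a) : HasChain R S a → HasChain R S d :=
  fun ⟨l, hl⟩ => hl.hasChain (h l hl)

lemma trans (hm : ∀ c a, R c a → m c < m a) (h : Dominates R S d b) (h' : Dominates R S b a) :
    Dominates R S d a := by
  intro l hl
  obtain ⟨l₁, l₂, rfl, hl₂, -, -⟩ := hl.exists_eq_append hm (h' l hl)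
  exact List.mem_append_right _ (h l₂ hl₂)

lemma of_mem (hm : ∀ c a, R c a → m c < m a) (hl : DescChain R S a l) (hb : b ∈ l)
    (h : Dominates R S d a) (hdb : m d ≤ m b) : Dominates R S d b := by
  intro l' hl'
  obtain ⟨l₁, l₂, rfl, -, hreplace, hlt⟩ := hl.exists_eq_append hm hb
  exact (List.mem_append.1 (h _ (hreplace l' hl'))).resolve_left
    fun hd => (hlt d hd).not_ge hdb

end Dominates

/-- There are descending chains from `a` and `c` meeting only up to the level of a common
dominator of `a` and `c`. -/
def MeetBelowDominator (R : V → V → Prop) (S : V → Prop) (m : V → ℕ) (a c : V) : Prop :=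
  ∃ b L K, Dominates R S b a ∧ Dominates R S b c ∧ DescChain R S a L ∧ DescChain R S c K ∧
    ∀ x ∈ L, x ∈ K → m x ≤ m b

lemma MeetBelowDominator.symm (h : MeetBelowDominator R S m a c) :
    MeetBelowDominator R S m c a := by
  obtain ⟨b, L, K, hba, hbc, hL, hK, hmeet⟩ := h
  exact ⟨b, K, L, hbc, hba, hK, hL, fun x hxK hxL => hmeet x hxL hxK⟩

lemma meetBelowDominator_of_pred (hm : ∀ c a, R c a → m c < m a) (ha : HasChain R S a)
    (hc : HasChain R S c) (hS : ¬ S a) (hnot : ∀ K, DescChain R S c K → a ∉ K)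
    (hpred : ∀ a', R a' a → HasChain R S a' → MeetBelowDominator R S m a' c) :
    MeetBelowDominator R S m a c := by
  -- Among the dominators obtained from all predecessors, the lowest one is common to all of them.
  let P : V → Prop := fun b => ∃ a' L K, R a' a ∧ Dominates R S b a' ∧ Dominates R S b c ∧
    DescChain R S a' L ∧ DescChain R S c K ∧ ∀ x ∈ L, x ∈ K → m x ≤ m b
  have hP : ∃ b, P b := by
    obtain ⟨_, h | ⟨hR, hl⟩⟩ := ha
    · exact absurd h hS
    · obtain ⟨b, L, K, h⟩ := hpred _ hR ⟨_, hl⟩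
      exact ⟨b, _, L, K, hR, h⟩
  obtain ⟨b, ⟨a', L, K, hR, -, hbc, hL, hK, hmeet⟩, hmin⟩ :=
    exists_minimalFor_of_wellFoundedLT P m hP
  refine ⟨b, a :: L, K, ?_, hbc, .step hR hL, hK, ?_⟩
  · rintro _ (h | ⟨hR', hl⟩)
    · exact absurd h hS
    · obtain ⟨b', L', K', h⟩ := hpred _ hR' ⟨_, hl⟩
      have hle : m b ≤ m b' :=
        (le_total (m b) (m b')).elim id (hmin ⟨_, L', K', hR', h⟩)
      obtain ⟨K₀, hK₀⟩ := hc
      have hbb' : Dominates R S b b' := .of_mem hm hK₀ (h.2.1 _ hK₀) hbc hle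
      exact List.mem_cons_of_mem _ (hbb'.trans hm h.1 _ hl)
  · rintro x (_ | ⟨_, hx⟩) hxK
    exacts [absurd hxK (hnot K hK), hmeet x hx hxK]

lemma meetBelowDominator_of_forall_meet (hm : ∀ c a, R c a → m c < m a) (ha : HasChain R S a)
    (hc : HasChain R S c)
    (hmeet : ∀ L K, DescChain R S a L → DescChain R S c K → ∃ x ∈ L, x ∈ K) :
    MeetBelowDominator R S m a c := by
  induction hN : m a + m c using Nat.strong_induction_on generalizing a c with
  | _ N ih =>
  subst hN
  wlog hca : m c ≤ m a generalizing a c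
  · refine (this hc ha (fun L K hL hK => ?_) (fun N hN a c ha hc hmeet hac => ?_) (by omega)).symm
    · obtain ⟨x, hxK, hxL⟩ := hmeet K L hK hL
      exact ⟨x, hxL, hxK⟩
    · exact ih N (by omega) ha hc hmeet hac
  by_cases hac : a = c
  · subst hac
    obtain ⟨l, hl⟩ := ha
    exact ⟨a, l, l, .refl a, .refl a, hl, hl, fun x hx _ => hl.le hm hx⟩
  have hnot : ∀ K, DescChain R S c K → a ∉ K := fun K hK haK => by
    rcases hK.eq_or_lt hm haK with h | h
    exacts [hac h, absurd h (by omega)]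
  refine meetBelowDominator_of_pred hm ha hc (fun hS => ?_) hnot fun a' hR ha' =>
    ih _ (by have := hm _ _ hR; omega) ha' hc (fun L K hL hK => ?_) rfl
  · obtain ⟨K, hK⟩ := hc
    obtain ⟨x, hx, hxK⟩ := hmeet [a] K (.base hS) hK
    exact hnot K hK (List.mem_singleton.1 hx ▸ hxK)
  · obtain ⟨x, _ | ⟨_, hx⟩, hxK⟩ := hmeet (a :: L) K (.step hR hL) hK
    exacts [absurd hxK (hnot K hK), ⟨x, hx, hxK⟩]

variable {Br : V → V → Prop}

/-- The vertex `z` lies on a chain from one end of a bridge whose part from `z` upwards avoids some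
chain from the other end: going up to the bridge and down again reaches `z` from above. -/
def Merged (R : V → V → Prop) (S : V → Prop) (m : V → ℕ) (Br : V → V → Prop) (z : V) : Prop :=
  ∃ a c L K, Br a c ∧ DescChain R S a L ∧ DescChain R S c K ∧ z ∈ L ∧
    ∀ x ∈ L, m z ≤ m x → x ∉ K

lemma merged_of_mem_splice (hm : ∀ c a, R c a → m c < m a) (hbr : Br a c)
    (hL : DescChain R S a L) (hK : DescChain R S c K) (hLK : ∀ x ∈ L, x ∈ K → m x < m z)
    (hyL : y ∈ L) (hT : DescChain R S y T) (hz : z ∈ T)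
    (hTLK : ∀ x ∈ T, m z ≤ m x → x ∈ K → x = y) : Merged R S m Br z := by
  obtain ⟨L₁, L₂, rfl, -, hreplace, -⟩ := hL.exists_eq_append hm hyL
  refine ⟨a, c, L₁ ++ T, K, hbr, hreplace T hT, hK, List.mem_append_right _ hz,
    fun x hx hzx hxK => ?_⟩
  rcases List.mem_append.1 hx with hx | hx
  · exact (hLK x (List.mem_append_left _ hx) hxK).not_ge hzx
  · obtain rfl := hTLK x hx hzx hxK
    exact (hLK x hyL hxK).not_ge hzx

lemma merged_of_mem_of_lt (hm : ∀ c a, R c a → m c < m a) (hsymm : ∀ a c, Br a c → Br c a)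
    (hbr : Br a c) (hL : DescChain R S a L) (hK : DescChain R S c K)
    (hLK : ∀ x ∈ L, x ∈ K → m x ≤ m b) {L' : List V} (hL' : DescChain R S a L')
    (hz : z ∈ L') (hbz : m b < m z) : Merged R S m Br z := by
  -- Leave `L ∪ K` along `L'` at the last possible vertex above `z`.
  obtain ⟨y, ⟨hyL', hyLK, hzy⟩, hmin⟩ := exists_minimalFor_of_wellFoundedLT
    (fun y => y ∈ L' ∧ (y ∈ L ∨ y ∈ K) ∧ m z ≤ m y) m
    ⟨a, hL'.head_mem, Or.inl hL.head_mem, hL'.le hm hz⟩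
  obtain ⟨T₁, T, rfl, hT, -, hlt⟩ := hL'.exists_eq_append hm hyL'
  have hzT : z ∈ T := (List.mem_append.1 hz).resolve_left fun h => (hlt z h).not_ge hzy
  have hTLK : ∀ x ∈ T, m z ≤ m x → x ∈ L ∨ x ∈ K → x = y := fun x hx hzx hxLK =>
    (hT.eq_or_lt hm hx).resolve_right fun hxy =>
      (hmin ⟨List.mem_append_right _ hx, hxLK, hzx⟩ hxy.le).not_gt hxy
  rcases hyLK with hyL | hyK
  · exact merged_of_mem_splice hm hbr hL hK (fun x hxL hxK => (hLK x hxL hxK).trans_lt hbz) hyL hT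
      hzT fun x hx hzx hxK => hTLK x hx hzx (Or.inr hxK)
  · exact merged_of_mem_splice hm (hsymm _ _ hbr) hK hL
      (fun x hxK hxL => (hLK x hxL hxK).trans_lt hbz) hyK hT hzT
      fun x hx hzx hxL => hTLK x hx hzx (Or.inl hxL)

/-- The dominators of `x` that are not merged. -/
def unmergedDominators (R : V → V → Prop) (S : V → Prop) (m : V → ℕ) (Br : V → V → Prop) (x : V) :
    Set V :=
  {d | Dominates R S d x ∧ ¬ Merged R S m Br d}

/-- The highest dominator of `x` that is not merged. It is an arbitrary vertex if there is none,
which does not happen if `x` has a chain in a `BridgedLayering`. -/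
noncomputable def topDominator (R : V → V → Prop) (S : V → Prop) (m : V → ℕ) (Br : V → V → Prop)
    (x : V) : V :=
  @Classical.epsilon V ⟨x⟩ fun d => d ∈ unmergedDominators R S m Br x ∧
    ∀ d' ∈ unmergedDominators R S m Br x, m d' ≤ m d

lemma topDominator_congr (h : unmergedDominators R S m Br x = unmergedDominators R S m Br y) :
    topDominator R S m Br x = topDominator R S m Br y := by
  unfold topDominator
  rw [h]

/-- A layered graph with bridges whose ends do not have disjoint chains to sources. -/
structure BridgedLayering (R : V → V → Prop) (S : V → Prop) (m : V → ℕ) (Br : V → V → Prop) :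
    Prop where
  lt : ∀ c a, R c a → m c < m a
  symm : ∀ a c, Br a c → Br c a
  hasChain : ∀ a c, Br a c → HasChain R S a
  meet : ∀ a c, Br a c → ∀ L K, DescChain R S a L → DescChain R S c K → ∃ x ∈ L, x ∈ K

namespace BridgedLayering

lemma meetBelowDominator (D : BridgedLayering R S m Br) (h : Br a c) :
    MeetBelowDominator R S m a c :=
  meetBelowDominator_of_forall_meet D.lt (D.hasChain a c h) (D.hasChain c a (D.symm a c h))
    (D.meet a c h)

lemma exists_dominates_lt (D : BridgedLayering R S m Br) (hbr : Br a c) (hL : DescChain R S a L)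
    (hK : DescChain R S c K) (hx : x ∈ L) (havoid : ∀ y ∈ L, m x ≤ m y → y ∉ K) :
    ∃ b L' K', Dominates R S b a ∧ Dominates R S b x ∧ m b < m x ∧ DescChain R S a L' ∧
      DescChain R S c K' ∧ ∀ y ∈ L', y ∈ K' → m y ≤ m b := by
  obtain ⟨b, L', K', hba, hbc, hL', hK', hmeet⟩ := D.meetBelowDominator hbr
  have hlt : m b < m x := not_le.1 fun hle => havoid b (hba L hL) hle (hbc K hK)
  exact ⟨b, L', K', hba, .of_mem D.lt hL hx hba hlt.le, hlt, hL', hK', hmeet⟩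

lemma unmergedDominators_bridge (D : BridgedLayering R S m Br) (h : Br a c) :
    unmergedDominators R S m Br a = unmergedDominators R S m Br c := by
  have hsub : ∀ a c, Br a c → unmergedDominators R S m Br a ⊆ unmergedDominators R S m Br c := by
    intro a c h d hd
    obtain ⟨b, L, K, hba, hbc, hL, hK, hmeet⟩ := D.meetBelowDominator h
    have hdb : m d ≤ m b := not_lt.1 fun hlt =>
      hd.2 (merged_of_mem_of_lt D.lt D.symm h hL hK hmeet hL (hd.1 _ hL) hlt)
    exact ⟨(Dominates.of_mem D.lt hL (hba _ hL) hd.1 hdb).trans D.lt hbc, hd.2⟩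
  exact (hsub a c h).antisymm (hsub c a (D.symm a c h))

lemma unmergedDominators_nonempty (D : BridgedLayering R S m Br) (hx : HasChain R S x) :
    (unmergedDominators R S m Br x).Nonempty := by
  induction hN : m x using Nat.strong_induction_on generalizing x with
  | _ N ih =>
  subst hN
  by_cases hmx : Merged R S m Br x
  · obtain ⟨a, c, L, K, hbr, hL, hK, hxL, havoid⟩ := hmx
    obtain ⟨b, -, -, hba, hbx, hlt, -⟩ := D.exists_dominates_lt hbr hL hK hxL havoid
    obtain ⟨d, hd⟩ := ih _ hlt (hba.hasChain ⟨L, hL⟩) rfl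
    exact ⟨d, hd.1.trans D.lt hbx, hd.2⟩
  · exact ⟨x, .refl x, hmx⟩

lemma topDominator_spec (D : BridgedLayering R S m Br) (hx : HasChain R S x) :
    topDominator R S m Br x ∈ unmergedDominators R S m Br x ∧
      ∀ d ∈ unmergedDominators R S m Br x, m d ≤ m (topDominator R S m Br x) := by
  obtain ⟨l, hl⟩ := id hx
  obtain ⟨d, hd, hmax⟩ := Set.exists_max_image _ m
    (l.finite_toSet.subset fun d (hd : d ∈ unmergedDominators R S m Br x) => hd.1 l hl)
    (D.unmergedDominators_nonempty hx)
  exact @Classical.epsilon_spec V (fun d => d ∈ unmergedDominators R S m Br x ∧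
    ∀ d' ∈ unmergedDominators R S m Br x, m d' ≤ m d) ⟨d, hd, hmax⟩

lemma hasChain_topDominator (D : BridgedLayering R S m Br) (hx : HasChain R S x) :
    HasChain R S (topDominator R S m Br x) :=
  (D.topDominator_spec hx).1.1.hasChain hx

lemma topDominator_ne_iff (D : BridgedLayering R S m Br) (hx : HasChain R S x) :
    topDominator R S m Br x ≠ x ↔ Merged R S m Br x := by
  obtain ⟨hmem, hmax⟩ := D.topDominator_spec hx
  refine ⟨fun hne => ?_, fun h heq => hmem.2 (heq.symm ▸ h)⟩
  by_contra hmx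
  obtain ⟨l, hl⟩ := hx
  have hlt := (hl.eq_or_lt D.lt (hmem.1 l hl)).resolve_left hne
  exact hlt.not_ge (hmax x ⟨.refl x, hmx⟩)

lemma topDominator_topDominator (D : BridgedLayering R S m Br) (hx : HasChain R S x) :
    topDominator R S m Br (topDominator R S m Br x) = topDominator R S m Br x :=
  not_not.1 fun h => (D.topDominator_spec hx).1.2
    ((D.topDominator_ne_iff (D.hasChain_topDominator hx)).1 h)

lemma unmergedDominators_pred (D : BridgedLayering R S m Br) (hR : R c x) (hc : HasChain R S c)
    (hmx : Merged R S m Br x) :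
    unmergedDominators R S m Br c = unmergedDominators R S m Br x := by
  obtain ⟨a, a', L, K, hbr, hL, hK, hxL, havoid⟩ := id hmx
  obtain ⟨b, L', K', -, hbx, hlt, hL', hK', hmeet⟩ := D.exists_dominates_lt hbr hL hK hxL havoid
  obtain ⟨L₁, L₂, -, -, hreplace, -⟩ := hL.exists_eq_append D.lt hxL
  refine Set.Subset.antisymm (fun d hd => ⟨fun l hl => ?_, hd.2⟩)
    fun d hd => ⟨fun l hl => ?_, hd.2⟩
  · obtain ⟨lc, hlc⟩ := hc
    have hdb : m d ≤ m b := not_lt.1 fun hbd =>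
      hd.2 (merged_of_mem_of_lt D.lt D.symm hbr hL' hK' hmeet (hreplace _ (.step hR hlc))
        (List.mem_append_right _ (List.mem_cons_of_mem _ (hd.1 _ hlc))) hbd)
    have hbc : b ∈ lc := (List.mem_cons.1 (hbx _ (.step hR hlc))).resolve_left
      fun h => hlt.ne (h ▸ rfl)
    exact (Dominates.of_mem D.lt hlc hbc hd.1 hdb).trans D.lt hbx l hl
  · exact (List.mem_cons.1 (hd.1 _ (.step hR hl))).resolve_left fun h => hd.2 (h ▸ hmx)

lemma merged_pred (D : BridgedLayering R S m Br) {x' : V} (hS : ¬ S x)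
    (hpred : ∀ c, R c x → c = x') (hsucc : ∀ a, R x' a → a = x) (hbr : ∀ a, ¬ Br a x')
    (h : Merged R S m Br x) : Merged R S m Br x' := by
  obtain ⟨a, c, L, K, hac, hL, hK, hxL, havoid⟩ := h
  obtain ⟨L₁, L₂, rfl, hL₂, -, hlt⟩ := hL.exists_eq_append D.lt hxL
  obtain hSx | ⟨hR, hl⟩ := hL₂
  · exact absurd hSx hS
  obtain rfl := hpred _ hR
  refine ⟨a, c, _, K, hac, hL, hK,
    List.mem_append_right _ (List.mem_cons_of_mem _ hl.head_mem), fun y hy hle hyK => ?_⟩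
  rcases List.mem_append.1 hy with hy' | hy'
  · exact havoid y hy (hlt y hy').le hyK
  rcases List.mem_cons.1 hy' with rfl | hy'
  · exact havoid y hy le_rfl hyK
  rcases hl.eq_or_lt D.lt hy' with rfl | hylt
  · obtain ⟨z, hzK, hyz⟩ := hK.exists_succ hyK fun hyc => hbr a (hyc ▸ hac)
    obtain rfl := hsucc z hyz
    exact havoid z hxL le_rfl hzK
  · omega

lemma merged_succ (D : BridgedLayering R S m Br) {x' : V} (hsucc : ∀ a, R x' a → a = x)
    (hbr : ∀ a, ¬ Br a x') (h : Merged R S m Br x') : Merged R S m Br x := by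
  obtain ⟨a, c, L, K, hac, hL, hK, hxL, havoid⟩ := h
  obtain ⟨z, hzL, hxz⟩ := hL.exists_succ hxL fun h => hbr c (h ▸ D.symm _ _ hac)
  obtain rfl := hsucc z hxz
  exact ⟨a, c, L, K, hac, hL, hK, hzL,
    fun x hx hle => havoid x hx ((D.lt _ _ hxz).le.trans hle)⟩

end BridgedLayering

end Layering

section Stages

variable {V : Type*} {G : SimpleGraph V} {M : G.Subgraph} {n : ℕ} {f x y : V}

/-- The minlevel as a natural number. -/
noncomputable def minlev (M : G.Subgraph) (x : V) : ℕ := min (elev M x) (olev M x)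

/-- At stage `n`, with classes given by the base function `β`, a node is a vertex that is its own
base and has a level at most `n`. -/
def IsNode (M : G.Subgraph) (n : ℕ) (β : V → V) (x : V) : Prop :=
  β x = x ∧ (elev M x ≤ n ∨ olev M x ≤ n)

/-- The node `c` precedes the node `a` on some shortest alternating path whose vertices are
replaced by their bases. -/
def NodePred (M : G.Subgraph) (n : ℕ) (β : V → V) (c a : V) : Prop :=
  IsNode M n β c ∧ IsNode M n β a ∧ ((elev M a < olev M a ∧ M.Adj c a) ∨
    (olev M a < elev M a ∧ ∃ w, β w = c ∧ G.Adj w a ∧ ¬ M.Adj w a ∧ elev M w + 1 = olev M a))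

/-- The nodes `a` and `c` are the bases of the ends of a bridge of tenacity `2 * n + 1`. -/
def NodeBridge (M : G.Subgraph) (n : ℕ) (β : V → V) (a c : V) : Prop :=
  IsNode M n β a ∧ IsNode M n β c ∧ a ≠ c ∧
    ((elev M a < olev M a ∧ elev M c < olev M c ∧
        ∃ u v, β u = a ∧ β v = c ∧ G.Adj u v ∧ ¬ M.Adj u v ∧ elev M u + elev M v = 2 * n) ∨
      (M.Adj a c ∧ olev M a = n ∧ olev M c = n ∧ olev M a < elev M a ∧ olev M c < elev M c))

open Classical in
/-- The base function of the next stage: the base of a merged node is the highest node that lies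
below both ends of every bridge merging it. -/
noncomputable def nextBase (M : G.Subgraph) (n : ℕ) (β : V → V) (x : V) : V :=
  if IsNode M n β (β x) then
    topDominator (NodePred M n β) (IsUnmatched M) (minlev M) (NodeBridge M n β) (β x)
  else β x

/-- The base function of stage `n`: the base of the largest blossom of tenacity less than `2 * n`
containing `x`, and `x` itself if there is none. -/
noncomputable def classBase (M : G.Subgraph) : ℕ → V → V
  | 0 => id
  | n + 1 => nextBase M n (classBase M n)

open Classical in
/-- The lower bound for lengths of even alternating paths to `x` at stage `n`. It is the even level
once `x` belongs to a blossom, and otherwise the dual variable that grows with `n`. -/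
noncomputable def evenBound (M : G.Subgraph) (n : ℕ) (x : V) : ℕ :=
  if classBase M n x ≠ x then elev M x
  else if elev M x < olev M x then min (elev M x) (n + 1)
  else max (2 * n + 1 - olev M x) (n + 1)

open Classical in
/-- The lower bound for lengths of odd alternating paths to `x` at stage `n`. -/
noncomputable def oddBound (M : G.Subgraph) (n : ℕ) (x : V) : ℕ :=
  if classBase M n x ≠ x then olev M x else 2 * n + 1 - evenBound M n x

lemma classBase_succ_congr (h : classBase M n x = classBase M n y) :
    classBase M (n + 1) x = classBase M (n + 1) y := by
  unfold classBase nextBase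
  rw [h]

lemma classBase_congr {j k : ℕ} (hjk : j ≤ k) (h : classBase M j x = classBase M j y) :
    classBase M k x = classBase M k y := by
  induction k, hjk using Nat.le_induction with
  | base => exact h
  | succ k _ ih => exact classBase_succ_congr ih

lemma evenBound_of_ne (h : classBase M n x ≠ x) : evenBound M n x = elev M x := if_pos h

lemma evenBound_outer (h : classBase M n x = x) (hout : elev M x < olev M x) :
    evenBound M n x = min (elev M x) (n + 1) := by
  rw [evenBound, if_neg (not_not.2 h), if_pos hout]

lemma evenBound_inner (h : classBase M n x = x) (hin : ¬ elev M x < olev M x) :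
    evenBound M n x = max (2 * n + 1 - olev M x) (n + 1) := by
  rw [evenBound, if_neg (not_not.2 h), if_neg hin]

lemma oddBound_of_ne (h : classBase M n x ≠ x) : oddBound M n x = olev M x := if_pos h

lemma oddBound_of_eq (h : classBase M n x = x) : oddBound M n x = 2 * n + 1 - evenBound M n x :=
  if_neg (not_not.2 h)

lemma evenBound_le_of_eq (h : classBase M n x = x) : evenBound M n x ≤ 2 * n + 1 := by
  by_cases hout : elev M x < olev M x
  · rw [evenBound_outer h hout]; omega
  · rw [evenBound_inner h hout]; omega

lemma elev_ne_olev (M : G.Subgraph) (x : V) : elev M x ≠ olev M x := by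
  have heven := elev_mod M x
  have hodd := olev_mod M x
  omega

lemma count_le_sub {P : ℕ → Prop} [DecidablePred P] {a k : ℕ} (h : ∀ j < k, P j → a ≤ j) :
    Nat.count P k ≤ k - a := by
  rw [Nat.count_eq_card_filter_range, ← Nat.card_Ico]
  refine Finset.card_le_card fun j hj => ?_
  rw [Finset.mem_filter, Finset.mem_range] at hj
  exact Finset.mem_Ico.2 ⟨h j hj.1 hj.2, hj.1⟩

open Classical in
lemma sharedCount_classBase_eq_zero (hxy : classBase M n x ≠ classBase M n y) :
    sharedCount n (classBase M) x y = 0 := by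
  have hle : sharedCount n (classBase M) x y ≤ n + 1 - (n + 1) := count_le_sub fun j hj heq =>
    absurd (classBase_congr (Nat.lt_succ_iff.1 hj) heq) hxy
  omega

/-- The base functions of the stages up to `n` are consistent, and those of stage `n` make
`evenBound` and `oddBound` a feasible dual. -/
structure IsFeasible (M : G.Subgraph) (n : ℕ) : Prop where
  matching : M.IsMatching
  le_levelCap : 2 * n + 4 ≤ levelCap V
  le_olev : ∀ f, IsUnmatched M f → 2 * n ≤ olev M f
  idem : ∀ j ≤ n, ∀ x, classBase M j (classBase M j x) = classBase M j x
  mono : ∀ j ≤ n, ∀ x, classBase M j x ≠ x → classBase M n x ≠ x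
  lt_of_ne : ∀ j ≤ n, ∀ x, classBase M j x ≠ x → elev M x + olev M x < 2 * j
  mate : ∀ j ≤ n, ∀ x y, M.Adj x y → classBase M j x ≠ x →
    classBase M j y = classBase M j x ∧ classBase M j y ≠ y
  matched : ∀ x y, M.Adj x y → classBase M n x = x →
    evenBound M n x + evenBound M n y ≤ 2 * n + 2
  unmatched : ∀ x y, G.Adj x y → ¬ M.Adj x y →
    2 * n ≤ evenBound M n x + evenBound M n y + 2 * sharedCount n (classBase M) x y

/-- All vertices of tenacity less than `2 * n` belong to a class of stage `n`. -/
structure IsStage (M : G.Subgraph) (n : ℕ) : Prop extends IsFeasible M n where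
  ne_of_lt : ∀ j ≤ n, ∀ x, elev M x + olev M x < 2 * j → classBase M j x ≠ x

namespace IsFeasible

lemma eq_of_le (S : IsFeasible M n) {j : ℕ} (hj : j ≤ n) (h : classBase M n x = x) :
    classBase M j x = x :=
  not_not.1 fun hne => S.mono j hj x hne h

lemma classBase_eq_self_iff_of_adj (S : IsFeasible M n) (h : M.Adj x y) :
    classBase M n x = x ↔ classBase M n y = y :=
  ⟨fun hx => not_not.1 fun hy => (S.mate n le_rfl y x h.symm hy).2 hx,
    fun hy => not_not.1 fun hx => (S.mate n le_rfl x y h hx).2 hy⟩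

open Classical in
lemma oddBound_add_le (S : IsFeasible M n) (y : V) :
    oddBound M n y + evenBound M n y + 2 * properCount n (classBase M) y ≤ 2 * n + 1 := by
  by_cases hy : classBase M n y = y
  · have hle := evenBound_le_of_eq hy
    have hcount : properCount n (classBase M) y ≤ n + 1 - (n + 1) :=
      count_le_sub fun j hj hne => absurd (S.eq_of_le (Nat.lt_succ_iff.1 hj) hy) hne
    rw [oddBound_of_eq hy]
    omega
  · have hlt := S.lt_of_ne n le_rfl y hy
    have heven := elev_mod M y
    have hodd := olev_mod M y
    have hcount : properCount n (classBase M) y ≤ n + 1 - (elev M y + olev M y + 1) / 2 :=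
      count_le_sub fun j hj hne => by
        have := S.lt_of_ne j (Nat.lt_succ_iff.1 hj) y hne
        omega
    rw [oddBound_of_ne hy, evenBound_of_ne hy]
    omega

lemma isDual (S : IsFeasible M n) :
    IsDual M n (classBase M) (evenBound M n) (oddBound M n) where
  mate := S.mate
  matched x y h := by
    by_cases hx : classBase M n x = x
    · have hxy := S.matched x y h hx
      have hle := evenBound_le_of_eq hx
      rw [oddBound_of_eq hx]
      omega
    · rw [oddBound_of_ne hx, evenBound_of_ne (S.mate n le_rfl x y h hx).2]
      have hmate := elev_mate S.matching h
      have hlt := S.lt_of_ne n le_rfl x hx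
      have hcap := S.le_levelCap
      omega
  unmatched x y h hn := by
    have hxy := S.unmatched x y h hn
    have hy := S.oddBound_add_le y
    omega

lemma classBase_of_isUnmatched (S : IsFeasible M n) (hf : IsUnmatched M f) {j : ℕ} (hj : j ≤ n) :
    classBase M j f = f := by
  by_contra hne
  have hlt := S.lt_of_ne j hj f hne
  have hle := S.le_olev f hf
  omega

lemma evenBound_of_isUnmatched (S : IsFeasible M n) (hf : IsUnmatched M f) :
    evenBound M n f = 0 := by
  have helev := elev_of_isUnmatched hf
  have hodd := olev_mod M f
  rw [evenBound_outer (S.classBase_of_isUnmatched hf le_rfl) (by omega)]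
  omega

variable [Finite V]

lemma levelBound_add_le (S : IsFeasible M n) {p : G.Walk f x} (hp : IsAltPathFromFree M p) :
    levelBound (evenBound M n) (oddBound M n) p.length x +
      2 * totalUnbased n (classBase M) (supportSet p) ≤ p.length := by
  have hbound :=
    S.isDual.levelBound_add_le (fun _ => S.classBase_of_isUnmatched hp.1) hp.unmatchedStart
  rwa [S.evenBound_of_isUnmatched hp.1, Nat.zero_add] at hbound

lemma evenBound_le (S : IsFeasible M n) (hx : elev M x < levelCap V) :
    evenBound M n x ≤ elev M x := by
  obtain ⟨f, p, hp, hlen⟩ := exists_length_eq_elev hx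
  have hbound := S.levelBound_add_le hp
  rw [levelBound_of_even (by rw [hlen, elev_mod])] at hbound
  omega

lemma oddBound_le (S : IsFeasible M n) (hx : olev M x < levelCap V) :
    oddBound M n x ≤ olev M x := by
  obtain ⟨f, p, hp, hlen⟩ := exists_length_eq_olev hx
  have hbound := S.levelBound_add_le hp
  rw [levelBound_of_odd (by rw [hlen, olev_mod])] at hbound
  omega

lemma le_of_classBase_eq (S : IsFeasible M n) (hx : classBase M n x = x) :
    2 * n + 1 ≤ elev M x + olev M x := by
  by_contra hlt
  have hcap := S.le_levelCap
  have heven := S.evenBound_le (x := x) (by omega)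
  have hodd := S.oddBound_le (x := x) (by omega)
  have hle := evenBound_le_of_eq hx
  rw [oddBound_of_eq hx] at hodd
  omega

lemma isTight_of_le (S : IsFeasible M n) {p : G.Walk f x} (hp : IsAltPathFromFree M p)
    (hlen : p.length ≤ levelBound (evenBound M n) (oddBound M n) p.length x) :
    IsTight n (classBase M) (evenBound M n) (oddBound M n) p ∧
      ∀ j ≤ n, unbased (classBase M j) (supportSet p) = ∅ := by
  have hbound := S.levelBound_add_le hp
  have hzero : totalUnbased n (classBase M) (supportSet p) = 0 := by omega
  refine ⟨?_, fun j hj => ?_⟩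
  · rw [IsTight, S.evenBound_of_isUnmatched hp.1]
    omega
  · exact (Set.ncard_eq_zero (Set.toFinite _)).1
      (Finset.sum_eq_zero_iff.1 hzero j (Finset.mem_range_succ_iff.2 hj))

end IsFeasible

namespace IsStage

lemma classBase_ne_iff (S : IsStage M n) {j : ℕ} (hj : j ≤ n) :
    classBase M j x ≠ x ↔ elev M x + olev M x < 2 * j :=
  ⟨S.lt_of_ne j hj x, S.ne_of_lt j hj x⟩

lemma le_of_classBase_eq (S : IsStage M n) {j : ℕ} (hj : j ≤ n) (h : classBase M j x = x) :
    2 * j + 1 ≤ elev M x + olev M x := by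
  have hle : ¬ elev M x + olev M x < 2 * j := fun hlt => S.ne_of_lt j hj x hlt h
  have heven := elev_mod M x
  have hodd := olev_mod M x
  omega

variable [Finite V]

lemma isTight_of_ne (S : IsStage M n) (h : classBase M n x ≠ x) {p : G.Walk f x}
    (hp : IsAltPathFromFree M p) (hlen : p.length = elev M x ∨ p.length = olev M x) :
    IsTight n (classBase M) (evenBound M n) (oddBound M n) p ∧
      ∀ j ≤ n, unbased (classBase M j) (supportSet p) = ∅ := by
  refine S.isTight_of_le hp (le_of_eq ?_)
  rcases hlen with heven | hodd
  · rw [levelBound_of_even (by rw [heven, elev_mod]), evenBound_of_ne h, heven]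
  · rw [levelBound_of_odd (by rw [hodd, olev_mod]), oddBound_of_ne h, hodd]

lemma isTight_of_elev (S : IsStage M n) (h : classBase M n x = x → elev M x ≤ n) {p : G.Walk f x}
    (hp : IsAltPathFromFree M p) (hlen : p.length = elev M x) :
    IsTight n (classBase M) (evenBound M n) (oddBound M n) p := by
  by_cases hx : classBase M n x = x
  · refine (S.isTight_of_le hp ?_).1
    have hout := h hx
    have hle := S.le_of_classBase_eq le_rfl hx
    rw [levelBound_of_even (by rw [hlen, elev_mod]), evenBound_outer hx (by omega)]
    omega
  · exact (S.isTight_of_ne hx hp (Or.inl hlen)).1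

end IsStage

end Stages

section Classes

variable {V : Type*} {G : SimpleGraph V} {M : G.Subgraph} {n j : ℕ} {f x : V}

namespace IsStage

lemma not_altFrom_true_of_class (S : IsStage M n) (hj : j ≤ n) {c : V} {r : G.Walk c x}
    (hne : c ≠ x) (hc : classBase M j c = c) (hr : ∀ z ∈ r.support, classBase M j z = c) :
    ¬ AltFrom M true r := by
  cases r with
  | nil => exact absurd rfl hne
  | @cons _ y _ h r =>
    intro halt
    have hy : classBase M j y = c := hr y (by simp)
    exact (S.mate j hj y c ((altFrom_cons ..).1 halt |>.1.2 rfl).symm (by rw [hy]; exact h.ne)).2 hc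

variable [Finite V]

lemma exists_eq_append_class (S : IsStage M n) (hj : j ≤ n) (hx : classBase M j x ≠ x)
    {p : G.Walk f x} (hp : IsAltPathFromFree M p)
    (hlen : p.length = elev M x ∨ p.length = olev M x) :
    ∃ (q : G.Walk f (classBase M j x)) (r : G.Walk (classBase M j x) x), p = q.append r ∧
      q.length % 2 = 0 ∧ ∀ z ∈ r.support, classBase M j z = classBase M j x := by
  obtain ⟨htight, hunbased⟩ := S.isTight_of_ne (S.mono j hj x hx) hp hlen
  obtain ⟨q, r, rfl, hr⟩ := S.isDual.exists_eq_append_of_tight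
    (fun _ => S.classBase_of_isUnmatched hp.1) hp.unmatchedStart htight hj
    (mem_of_unbased_eq_empty (hunbased j hj) p.end_mem_support)
  refine ⟨q, r, rfl, by_contra fun hodd => ?_, hr⟩
  have halt := (altFrom_append false q r).1 (isAltPathUnmatchedStart_iff.1 hp.unmatchedStart).2
  rw [(bodd_eq_true_iff _).2 (by omega)] at halt
  exact S.not_altFrom_true_of_class hj hx (S.idem j hj x) hr halt.2

lemma elev_classBase_le_length (S : IsStage M n) (hj : j ≤ n) (hx : classBase M j x ≠ x)
    {p : G.Walk f x} (hp : IsAltPathFromFree M p)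
    (hlen : p.length = elev M x ∨ p.length = olev M x) :
    elev M (classBase M j x) ≤ p.length := by
  obtain ⟨q, r, rfl, heven, -⟩ := S.exists_eq_append_class hj hx hp hlen
  have hle := elev_le hp.of_append_left heven
  rw [Walk.length_append]
  omega

lemma elev_classBase_le (S : IsStage M n) (hj : j ≤ n) (x : V) :
    elev M (classBase M j x) ≤ elev M x := by
  by_cases hx : classBase M j x = x
  · rw [hx]
  · have hlt := S.lt_of_ne j hj x hx
    have hcap := S.le_levelCap
    obtain ⟨f, p, hp, hlen⟩ := exists_length_eq_elev (M := M) (v := x) (by omega)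
    exact hlen ▸ S.elev_classBase_le_length hj hx hp (Or.inl hlen)

lemma elev_classBase_le_olev (S : IsStage M n) (hj : j ≤ n) (hx : classBase M j x ≠ x) :
    elev M (classBase M j x) ≤ olev M x := by
  have hlt := S.lt_of_ne j hj x hx
  have hcap := S.le_levelCap
  obtain ⟨f, p, hp, hlen⟩ := exists_length_eq_olev (M := M) (v := x) (by omega)
  exact hlen ▸ S.elev_classBase_le_length hj hx hp (Or.inr hlen)

lemma elev_classBase_lt (S : IsStage M n) (hj : j ≤ n) (hx : classBase M j x ≠ x) :
    elev M (classBase M j x) < j := by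
  have hlt := S.lt_of_ne j hj x hx
  have heven := S.elev_classBase_le hj x
  have hodd := S.elev_classBase_le_olev hj hx
  omega

lemma lt_olev_classBase (S : IsStage M n) (hj : j ≤ n) (hx : classBase M j x ≠ x) :
    j + 1 < olev M (classBase M j x) := by
  have hle := S.le_of_classBase_eq hj (S.idem j hj x)
  have hlt := S.elev_classBase_lt hj hx
  omega

lemma eq_classBase_of_mem (S : IsStage M n) (hj : j ≤ n) (hx : classBase M j x ≠ x)
    {q : G.Walk f (classBase M j x)} (hq : IsAltPathFromFree M q)
    (hlen : q.length = elev M (classBase M j x)) {z : V} (hz : z ∈ q.support)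
    (hzx : classBase M j z = classBase M j x) : z = classBase M j x := by
  have hlt := S.elev_classBase_lt hj hx
  have heven := elev_mod M (classBase M j x)
  exact S.isDual.eq_of_mem_tight_even (fun _ => S.classBase_of_isUnmatched hq.1)
    hq.unmatchedStart (S.isTight_of_elev (fun _ => by omega) hq hlen) (by omega) hj hz hzx

lemma exists_eq_append_elev (S : IsStage M n) (hj : j ≤ n) (hx : classBase M j x ≠ x)
    {p : G.Walk f x} (hp : IsAltPathFromFree M p)
    (hlen : p.length = elev M x ∨ p.length = olev M x) :
    ∃ (q : G.Walk f (classBase M j x)) (r : G.Walk (classBase M j x) x), p = q.append r ∧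
      q.length = elev M (classBase M j x) ∧
      ∀ z ∈ r.support, classBase M j z = classBase M j x := by
  obtain ⟨q, r, rfl, hq, hr⟩ := S.exists_eq_append_class hj hx hp hlen
  refine ⟨q, r, rfl, (elev_le hp.of_append_left hq).antisymm' ?_, hr⟩
  have hlt := S.elev_classBase_lt hj hx
  have hcap := S.le_levelCap
  -- Otherwise a shorter path to the base could be spliced in.
  obtain ⟨g, q', hq', hlen'⟩ := exists_length_eq_elev (M := M) (v := classBase M j x) (by omega)
  have heven := elev_mod M (classBase M j x)
  have hnew : IsAltPathFromFree M (q'.append r) :=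
    hq'.append (hp.unmatchedStart.of_append_right hq) (by omega)
      fun z hz hzr => S.eq_classBase_of_mem hj hx hq' hlen' hz (hr z hzr)
  have hpar := elev_mod M x
  have hpar' := olev_mod M x
  rw [Walk.length_append] at hlen
  rcases hlen with hlen | hlen
  · have hle := elev_le hnew (by rw [Walk.length_append]; omega)
    rw [Walk.length_append] at hle
    omega
  · have hle := olev_le hnew (by rw [Walk.length_append]; omega)
    rw [Walk.length_append] at hle
    omega

lemma hasAltPath_class (S : IsStage M n) (hj : j ≤ n) (hx : elev M x < levelCap V) :
    HasAltPath M false (elev M x - elev M (classBase M j x))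
      {z | classBase M j z = classBase M j x} (classBase M j x) x := by
  by_cases hne : classBase M j x = x
  · rw [hne, Nat.sub_self]
    exact HasAltPath.nil false hne
  · obtain ⟨f, p, hp, hlen⟩ := exists_length_eq_elev hx
    obtain ⟨q, r, rfl, hq, hr⟩ := S.exists_eq_append_elev hj hne hp (Or.inl hlen)
    obtain ⟨hpath, halt⟩ := isAltPathUnmatchedStart_iff.1
      (hp.unmatchedStart.of_append_right (by rw [hq, elev_mod]))
    rw [Walk.length_append] at hlen
    exact ⟨r, hpath, halt, by omega, hr⟩

end IsStage

end Classes

section Nodes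

variable {V : Type*} {G : SimpleGraph V} {M : G.Subgraph} {n : ℕ} {a c w x z : V} {L K : List V}

/-- The descending chains of nodes of stage `n`, ending in an unmatched vertex. -/
abbrev NodeChain (M : G.Subgraph) (n : ℕ) : V → List V → Prop :=
  DescChain (NodePred M n (classBase M n)) (IsUnmatched M)

lemma bodd_sub {k m : ℕ} (h : k ≤ m) : (m - k).bodd = (m.bodd ^^ k.bodd) := by
  obtain ⟨d, rfl⟩ := Nat.exists_eq_add_of_le h
  rw [Nat.add_sub_cancel_left, Nat.bodd_add]
  cases k.bodd <;> cases d.bodd <;> rfl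

lemma DescChain.exists_source {R : V → V → Prop} {S : V → Prop} (h : DescChain R S a L) :
    ∃ f ∈ L, S f := by
  induction h with
  | base ha => exact ⟨_, List.mem_singleton_self _, ha⟩
  | step _ _ ih =>
    obtain ⟨f, hf, hS⟩ := ih
    exact ⟨f, List.mem_cons_of_mem _ hf, hS⟩

lemma minlev_of_isUnmatched (h : IsUnmatched M x) : minlev M x = 0 := by
  rw [minlev, elev_of_isUnmatched h, Nat.zero_min]

lemma nodeBridge_symm {β : V → V} (h : NodeBridge M n β a c) : NodeBridge M n β c a := by
  obtain ⟨ha, hc, hne, ⟨haout, hcout, u, v, hu, hv, huv, hn, hlev⟩ |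
    ⟨hac, hae, hce, hain, hcin⟩⟩ := h
  · exact ⟨hc, ha, hne.symm,
      Or.inl ⟨hcout, haout, v, u, hv, hu, huv.symm, fun h => hn h.symm, by omega⟩⟩
  · exact ⟨hc, ha, hne.symm, Or.inr ⟨hac.symm, hce, hae, hcin, hain⟩⟩

lemma minlev_add_le_of_nodeBridge {β : V → V} (h : NodeBridge M n β a c) :
    minlev M a + minlev M c ≤ 2 * n := by
  have ha := h.1.2
  have hc := h.2.1.2
  unfold minlev
  omega

namespace IsStage

lemma isNode_outer (S : IsStage M n) (h : IsNode M n (classBase M n) x)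
    (hout : elev M x < olev M x) : elev M x ≤ n ∧ n + 1 ≤ olev M x := by
  have hle := S.le_of_classBase_eq le_rfl h.1
  have hlev := h.2
  omega

lemma isNode_inner (S : IsStage M n) (h : IsNode M n (classBase M n) x)
    (hin : ¬ elev M x < olev M x) : olev M x ≤ n ∧ n + 1 ≤ elev M x := by
  have hle := S.le_of_classBase_eq le_rfl h.1
  have hlev := h.2
  have hne := elev_ne_olev M x
  omega

lemma isNode_of_isUnmatched (S : IsStage M n) (h : IsUnmatched M x) :
    IsNode M n (classBase M n) x :=
  ⟨S.classBase_of_isUnmatched h le_rfl, Or.inl (by rw [elev_of_isUnmatched h]; omega)⟩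

lemma isNode_of_hasChain (S : IsStage M n)
    (h : HasChain (NodePred M n (classBase M n)) (IsUnmatched M) a) :
    IsNode M n (classBase M n) a := by
  obtain ⟨_, h | ⟨h, _⟩⟩ := h
  exacts [S.isNode_of_isUnmatched h, h.2.1]

lemma exists_nodePred_outer (S : IsStage M n) (ha : IsNode M n (classBase M n) a)
    (hout : elev M a < olev M a) (hf : ¬ IsUnmatched M a) :
    ∃ c, NodePred M n (classBase M n) c a := by
  obtain ⟨c, hac⟩ := not_forall_not.1 hf
  have hmate := elev_mate S.matching hac.symm
  have hlev := S.isNode_outer ha hout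
  have hcap := S.le_levelCap
  refine ⟨c, ⟨by_contra fun hne => ?_, Or.inr (by omega)⟩, ha, Or.inl ⟨hout, hac.symm⟩⟩
  exact (S.mate n le_rfl c a hac.symm hne).2 ha.1

variable [Finite V]

lemma isNode_classBase (S : IsStage M n) (h : classBase M n x = x → elev M x ≤ n) :
    IsNode M n (classBase M n) (classBase M n x) ∧
      elev M (classBase M n x) < olev M (classBase M n x) := by
  by_cases hx : classBase M n x = x
  · have hle := S.le_of_classBase_eq le_rfl hx
    have hlev := h hx
    rw [hx]
    exact ⟨⟨hx, Or.inl hlev⟩, by omega⟩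
  · have helev := S.elev_classBase_lt le_rfl hx
    have hodd := S.lt_olev_classBase le_rfl hx
    exact ⟨⟨S.idem n le_rfl x, Or.inl (by omega)⟩, by omega⟩

lemma isNode_classBase_of_succ_eq (S : IsStage M n) (h : elev M w + 1 = olev M a)
    (ha : IsNode M n (classBase M n) a) (hin : olev M a < elev M a) :
    IsNode M n (classBase M n) (classBase M n w) ∧
      elev M (classBase M n w) < olev M (classBase M n w) := by
  have hlev := S.isNode_inner ha (by omega)
  exact S.isNode_classBase fun _ => by omega

lemma minlev_lt_of_nodePred (S : IsStage M n) (c a : V)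
    (h : NodePred M n (classBase M n) c a) : minlev M c < minlev M a := by
  obtain ⟨-, ha, ⟨hout, hca⟩ | ⟨hin, w, rfl, -, -, hw⟩⟩ := h
  · have hmate := elev_mate S.matching hca
    have hlev := S.isNode_outer ha hout
    have hcap := S.le_levelCap
    unfold minlev
    omega
  · have hle := S.elev_classBase_le le_rfl w
    unfold minlev
    omega

lemma exists_nodePred_inner (S : IsStage M n) (ha : IsNode M n (classBase M n) a)
    (hin : ¬ elev M a < olev M a) : ∃ c, NodePred M n (classBase M n) c a := by
  have hcap := S.le_levelCap
  have hlev := S.isNode_inner ha hin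
  have hmod := olev_mod M a
  obtain ⟨f, p, hp, hlen⟩ := exists_length_eq_olev (M := M) (v := a) (by omega)
  obtain ⟨w, q, h, rfl⟩ := exists_eq_concat p (by omega)
  obtain ⟨hq, -, hlast⟩ := isAltPathFromFree_concat_iff.1 hp
  rw [Walk.length_concat] at hlen
  have hw := elev_le hq (by omega)
  have hn : ¬ M.Adj w a := by rw [hlast]; omega
  have hne : classBase M n w ≠ classBase M n a := by
    rw [ha.1]
    intro hwa
    have hodd := S.lt_olev_classBase le_rfl (x := w) (by rw [hwa]; exact h.ne.symm)
    rw [hwa] at hodd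
    omega
  have hcount := sharedCount_classBase_eq_zero hne
  have hbound := S.unmatched w a h hn
  have hle := S.evenBound_le (x := w) (by omega)
  rw [evenBound_inner ha.1 hin] at hbound
  have hsucc : elev M w + 1 = olev M a := by omega
  exact ⟨classBase M n w, (S.isNode_classBase_of_succ_eq hsucc ha (by omega)).1, ha,
    Or.inr ⟨by omega, w, rfl, h, hn, hsucc⟩⟩

lemma hasChain_of_isNode (S : IsStage M n) (ha : IsNode M n (classBase M n) a) :
    HasChain (NodePred M n (classBase M n)) (IsUnmatched M) a := by
  induction hN : minlev M a using Nat.strong_induction_on generalizing a with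
  | _ N ih =>
  by_cases hf : IsUnmatched M a
  · exact ⟨_, .base hf⟩
  · obtain ⟨c, hc⟩ : ∃ c, NodePred M n (classBase M n) c a := by
      by_cases hout : elev M a < olev M a
      exacts [S.exists_nodePred_outer ha hout hf, S.exists_nodePred_inner ha hout]
    obtain ⟨l, hl⟩ := ih _ (hN ▸ S.minlev_lt_of_nodePred c a hc) hc.1 rfl
    exact ⟨_, .step hc hl⟩

lemma hasAltPath_nodePred (S : IsStage M n) (h : NodePred M n (classBase M n) c a) :
    HasAltPath M (minlev M c).bodd (minlev M a - minlev M c) {x | x = a ∨ classBase M n x = c}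
      c a := by
  have hcap := S.le_levelCap
  obtain ⟨hc, ha, ⟨hout, hca⟩ | ⟨hin, w, rfl, hwa, hn, hw⟩⟩ := h
  · have hmate := elev_mate S.matching hca
    have hmate' := elev_mate S.matching hca.symm
    have hlev := S.isNode_outer ha hout
    have hlevel : minlev M c = olev M c := by unfold minlev; omega
    have hdiff : minlev M a - olev M c = 1 := by unfold minlev; omega
    rw [hlevel, hdiff, (bodd_eq_true_iff _).2 (olev_mod M c)]
    exact HasAltPath.single hca.adj_sub (by simp [hca]) (Or.inr hc.1) (Or.inl rfl)
  · have hout := (S.isNode_classBase_of_succ_eq hw ha hin).2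
    have hlev := S.isNode_inner ha (by omega)
    have hle := S.elev_classBase_le le_rfl w
    have hlevel : minlev M (classBase M n w) = elev M (classBase M n w) := by unfold minlev; omega
    have hdiff : minlev M a - elev M (classBase M n w) =
        elev M w - elev M (classBase M n w) + 1 := by unfold minlev; omega
    have hmod := elev_mod M w
    have hmod' := elev_mod M (classBase M n w)
    rw [hlevel, hdiff, (bodd_eq_false_iff _).2 hmod']
    have hedge : HasAltPath M false 1 {w, a} w a :=
      .single hwa (by simp [hn]) (by simp) (by simp)
    refine ((S.hasAltPath_class le_rfl (by omega)).trans hedge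
      (by rw [(bodd_eq_false_iff _).2 (by omega)]; rfl) ?_).mono ?_
    · rintro y hy (rfl | rfl)
      · rfl
      · rw [← hy.symm.trans ha.1] at hin
        omega
    · rintro y (hy | rfl | rfl)
      exacts [Or.inr hy, Or.inr rfl, Or.inl rfl]

lemma hasAltPath_nodeChain (S : IsStage M n) (hL : NodeChain M n a L) (hz : z ∈ L) :
    HasAltPath M (minlev M z).bodd (minlev M a - minlev M z)
      {x | x = a ∨ (classBase M n x ∈ L ∧ minlev M z ≤ minlev M (classBase M n x) ∧
        minlev M (classBase M n x) < minlev M a)} z a := by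
  induction hL with
  | @base a _ =>
    obtain rfl := List.mem_singleton.1 hz
    rw [Nat.sub_self]
    exact .nil _ (Or.inl rfl)
  | @step c a l hca hl ih =>
    rcases List.mem_cons.1 hz with rfl | hz
    · rw [Nat.sub_self]
      exact .nil _ (Or.inl rfl)
    have hlt := S.minlev_lt_of_nodePred c a hca
    have hle := hl.le S.minlev_lt_of_nodePred hz
    have hc : c ∈ a :: l := List.mem_cons_of_mem _ hl.head_mem
    rw [show minlev M a - minlev M z =
      (minlev M c - minlev M z) + (minlev M a - minlev M c) by omega]
    refine ((ih hz).trans (S.hasAltPath_nodePred hca) ?_ ?_).mono ?_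
    · rw [bodd_sub hle]
      cases (minlev M z).bodd <;> cases (minlev M c).bodd <;> rfl
    · rintro x (hx | ⟨-, -, hx⟩) (rfl | rfl)
      · exact hx
      · exact hx
      · rw [hca.2.1.1] at hx; omega
      · omega
    · rintro x ((rfl | ⟨hxl, hzx, hxc⟩) | (rfl | rfl))
      · exact Or.inr ⟨by rwa [hca.1.1], by rwa [hca.1.1], by rwa [hca.1.1]⟩
      · exact Or.inr ⟨List.mem_cons_of_mem _ hxl, hzx, by omega⟩
      · exact Or.inl rfl
      · exact Or.inr ⟨hc, hle, hlt⟩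

lemma hasAltPath_nodeBridge (S : IsStage M n) (h : NodeBridge M n (classBase M n) a c) :
    HasAltPath M (minlev M a).bodd (2 * n + 1 - minlev M a - minlev M c)
      {x | classBase M n x = a ∨ classBase M n x = c} a c := by
  have hcap := S.le_levelCap
  obtain ⟨ha, hc, hne, ⟨haout, hcout, u, v, rfl, rfl, huv, hn, hlev⟩ |
    ⟨hac, hae, hce, hain, hcin⟩⟩ := h
  · have hu := S.elev_classBase_le le_rfl u
    have hv := S.elev_classBase_le le_rfl v
    have hmu := elev_mod M u
    have hmv := elev_mod M v
    have hmbu := elev_mod M (classBase M n u)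
    have hmbv := elev_mod M (classBase M n v)
    rw [minlev, min_eq_left haout.le, minlev, min_eq_left hcout.le, (bodd_eq_false_iff _).2 hmbu,
      show 2 * n + 1 - elev M (classBase M n u) - elev M (classBase M n v) =
        (elev M u - elev M (classBase M n u)) +
          (1 + (elev M v - elev M (classBase M n v))) by omega]
    have hedge : HasAltPath M false 1 {u, v} u v := .single huv (by simp [hn]) (by simp) (by simp)
    have hedge_class := hedge.trans (S.hasAltPath_class le_rfl (by omega)).reverse
      (by rw [(bodd_eq_false_iff _).2 (by omega)]; rfl) (by
        rintro y (rfl | hy) hy'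
        exacts [absurd hy' hne, hy])
    refine ((S.hasAltPath_class le_rfl (by omega)).trans hedge_class
      (by rw [(bodd_eq_false_iff _).2 (by omega)]; rfl) ?_).mono ?_
    · rintro y hy ((rfl | rfl) | hy')
      exacts [rfl, absurd hy.symm hne, absurd (hy.symm.trans hy') hne]
    · rintro y (hy | (rfl | rfl) | hy)
      exacts [Or.inl hy, Or.inl rfl, Or.inr rfl, Or.inr hy]
  · rw [minlev, min_eq_right hain.le, minlev, min_eq_right hcin.le, hae, hce,
      show 2 * n + 1 - n - n = 1 by omega, (bodd_eq_true_iff _).2 (hae ▸ olev_mod M a)]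
    exact .single hac.adj_sub (by simp [hac]) (Or.inl ha.1) (Or.inr hc.1)

lemma exists_hasAltPath_chain_bridge (S : IsStage M n)
    (hbr : NodeBridge M n (classBase M n) a c) (hK : NodeChain M n c K) (haK : a ∉ K) :
    ∃ f, IsUnmatched M f ∧ HasAltPath M false (2 * n + 1 - minlev M a)
      {x | classBase M n x = a ∨ classBase M n x ∈ K} f a := by
  obtain ⟨f, hfK, hf⟩ := hK.exists_source
  have hchain := S.hasAltPath_nodeChain hK hfK
  rw [minlev_of_isUnmatched hf, Nat.sub_zero] at hchain
  have hle := minlev_add_le_of_nodeBridge hbr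
  have hpath := hchain.trans (S.hasAltPath_nodeBridge (nodeBridge_symm hbr))
    (Bool.false_xor _).symm (by
      rintro x (hx | ⟨hxK, -, hx⟩) (rfl | rfl)
      exacts [hx, hx, absurd hx (lt_irrefl _), absurd hxK haK])
  rw [show minlev M c + (2 * n + 1 - minlev M c - minlev M a) = 2 * n + 1 - minlev M a by omega]
    at hpath
  refine ⟨f, hf, hpath.mono ?_⟩
  rintro x ((rfl | ⟨hxK, -⟩) | (hx | hx))
  · exact Or.inr (by rw [hbr.2.1.1]; exact hK.head_mem)
  · exact Or.inr hxK
  · exact Or.inr (hx ▸ hK.head_mem)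
  · exact Or.inl hx

lemma exists_isAltPathFromFree_of_nodeBridge (S : IsStage M n)
    (hbr : NodeBridge M n (classBase M n) a c) (hL : NodeChain M n a L) (hK : NodeChain M n c K)
    (hz : z ∈ L) (havoid : ∀ x ∈ L, minlev M z ≤ minlev M x → x ∉ K) :
    ∃ (f : V) (p : G.Walk f z), IsAltPathFromFree M p ∧ p.length = 2 * n + 1 - minlev M z := by
  have hle := hL.le S.minlev_lt_of_nodePred hz
  have hlev := minlev_add_le_of_nodeBridge hbr
  obtain ⟨f, hf, hup⟩ := S.exists_hasAltPath_chain_bridge hbr hK (havoid a hL.head_mem hle)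
  obtain ⟨p, hp, halt, hlen, -⟩ := hup.trans (S.hasAltPath_nodeChain hL hz).reverse
    (by
      rw [bodd_sub hle, bodd_sub (by omega : minlev M a ≤ 2 * n + 1)]
      cases (minlev M z).bodd <;> cases (minlev M a).bodd <;> simp)
    (by
      rintro x hx (hxa | ⟨hxL, hzx, hxa⟩)
      · exact hxa
      · rcases hx with rfl | hxK
        exacts [absurd hxa (lt_irrefl _), absurd hxK (havoid _ hxL hzx)])
  exact ⟨f, p, isAltPathFromFree_iff.2 ⟨hf, isAltPathUnmatchedStart_iff.2 ⟨hp, halt⟩⟩, by omega⟩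

lemma elev_add_olev_le_of_merged (S : IsStage M n)
    (h : Merged (NodePred M n (classBase M n)) (IsUnmatched M) (minlev M)
      (NodeBridge M n (classBase M n)) z) : elev M z + olev M z ≤ 2 * n + 1 := by
  obtain ⟨a, c, L, K, hbr, hL, hK, hz, havoid⟩ := h
  obtain ⟨f, p, hp, hlen⟩ := S.exists_isAltPathFromFree_of_nodeBridge hbr hL hK hz havoid
  have hlev := minlev_add_le_of_nodeBridge hbr
  have hle := hL.le S.minlev_lt_of_nodePred hz
  have heven := elev_mod M z
  have hodd := olev_mod M z
  rcases Nat.mod_two_eq_zero_or_one p.length with h | h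
  · have hp_le := elev_le hp h
    unfold minlev at *
    omega
  · have hp_le := olev_le hp h
    unfold minlev at *
    omega

lemma bridgedLayering (S : IsStage M n) (hfree : ∀ f, IsUnmatched M f → 2 * (n + 1) ≤ olev M f) :
    BridgedLayering (NodePred M n (classBase M n)) (IsUnmatched M) (minlev M)
      (NodeBridge M n (classBase M n)) where
  lt := S.minlev_lt_of_nodePred
  symm _ _ := nodeBridge_symm
  hasChain _ _ h := S.hasChain_of_isNode h.1
  meet a c h L K hL hK := by
    by_contra hdisjoint
    obtain ⟨z, hzL, hz⟩ := hL.exists_source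
    obtain ⟨f, p, hp, hlen⟩ := S.exists_isAltPathFromFree_of_nodeBridge h hL hK hzL
      fun x hx _ hxK => hdisjoint ⟨x, hx, hxK⟩
    rw [minlev_of_isUnmatched hz] at hlen
    have hle := olev_le hp (by omega)
    have hz_le := hfree z hz
    omega

end IsStage

end Nodes

section NextStage

variable {V : Type*} {G : SimpleGraph V} {M : G.Subgraph} {n : ℕ} {x y : V}

lemma classBase_succ_of_isNode (h : IsNode M n (classBase M n) (classBase M n x)) :
    classBase M (n + 1) x = topDominator (NodePred M n (classBase M n)) (IsUnmatched M) (minlev M)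
      (NodeBridge M n (classBase M n)) (classBase M n x) :=
  if_pos h

lemma classBase_succ_of_not_isNode (h : ¬ IsNode M n (classBase M n) (classBase M n x)) :
    classBase M (n + 1) x = classBase M n x :=
  if_neg h

lemma isNode_of_classBase_succ_ne (h : classBase M n x = x) (hne : classBase M (n + 1) x ≠ x) :
    IsNode M n (classBase M n) x := by
  by_contra hx
  rw [classBase_succ_of_not_isNode (by rwa [h])] at hne
  exact hne h

namespace IsStage

lemma eq_of_nodePred_outer (S : IsStage M n) (h : M.Adj x y) (hxout : elev M x < olev M x) {z : V}
    (hz : NodePred M n (classBase M n) z x) : z = y := by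
  obtain ⟨-, -, ⟨-, hzx⟩ | ⟨hxin, -⟩⟩ := hz
  · exact S.matching.eq_of_adj_right hzx h.symm
  · omega

lemma not_nodeBridge_inner (S : IsStage M n) (h : M.Adj x y) (hxout : elev M x < olev M x)
    (hyin : olev M y < elev M y) (z : V) : ¬ NodeBridge M n (classBase M n) z y := by
  rintro ⟨-, -, -, ⟨-, hyout, -⟩ | ⟨hzy, -, -, hzin, -⟩⟩
  · omega
  · obtain rfl := S.matching.eq_of_adj_right hzy h
    omega

lemma eq_of_nodePred_inner [Finite V] (S : IsStage M n) (h : M.Adj x y)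
    (hyin : olev M y < elev M y) {z : V} (hz : NodePred M n (classBase M n) y z) : z = x := by
  obtain ⟨-, hznode, ⟨-, hyz⟩ | ⟨hzin, w, hw, -, -, hlev⟩⟩ := hz
  · exact S.matching.eq_of_adj_left hyz h.symm
  · have hyout := (S.isNode_classBase_of_succ_eq hlev hznode hzin).2
    rw [hw] at hyout
    omega

variable [Finite V] (S : IsStage M n) (hfree : ∀ f, IsUnmatched M f → 2 * (n + 1) ≤ olev M f)

include S hfree

lemma isNode_topDominator (hx : IsNode M n (classBase M n) x) :
    IsNode M n (classBase M n) (topDominator (NodePred M n (classBase M n)) (IsUnmatched M)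
      (minlev M) (NodeBridge M n (classBase M n)) x) :=
  S.isNode_of_hasChain ((S.bridgedLayering hfree).hasChain_topDominator (S.hasChain_of_isNode hx))

lemma classBase_classBase_succ (x : V) :
    classBase M n (classBase M (n + 1) x) = classBase M (n + 1) x := by
  by_cases hx : IsNode M n (classBase M n) (classBase M n x)
  · rw [classBase_succ_of_isNode hx]
    exact (S.isNode_topDominator hfree hx).1
  · rw [classBase_succ_of_not_isNode hx]
    exact S.idem n le_rfl x

lemma classBase_succ_idem (x : V) :
    classBase M (n + 1) (classBase M (n + 1) x) = classBase M (n + 1) x := by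
  by_cases hx : IsNode M n (classBase M n) (classBase M n x)
  · have htop := S.isNode_topDominator hfree hx
    rw [classBase_succ_of_isNode hx, classBase_succ_of_isNode (by rwa [htop.1]), htop.1]
    exact (S.bridgedLayering hfree).topDominator_topDominator (S.hasChain_of_isNode hx)
  · rw [classBase_succ_of_not_isNode hx, classBase_succ_congr (S.idem n le_rfl x),
      classBase_succ_of_not_isNode hx]

lemma classBase_succ_ne (h : classBase M n x ≠ x) : classBase M (n + 1) x ≠ x := fun hx =>
  h (by simpa only [hx] using S.classBase_classBase_succ hfree x)

lemma eq_of_classBase_succ_eq (h : classBase M (n + 1) x = x) : classBase M n x = x :=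
  not_not.1 fun hne => S.classBase_succ_ne hfree hne h

lemma classBase_succ_ne_iff_merged (hx : IsNode M n (classBase M n) x) :
    classBase M (n + 1) x ≠ x ↔ Merged (NodePred M n (classBase M n)) (IsUnmatched M) (minlev M)
      (NodeBridge M n (classBase M n)) x := by
  rw [classBase_succ_of_isNode (by rwa [hx.1]), hx.1]
  exact (S.bridgedLayering hfree).topDominator_ne_iff (S.hasChain_of_isNode hx)

lemma elev_add_olev_of_classBase_succ_ne (h : classBase M n x = x)
    (hne : classBase M (n + 1) x ≠ x) : elev M x + olev M x = 2 * n + 1 :=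
  (S.elev_add_olev_le_of_merged ((S.classBase_succ_ne_iff_merged hfree
    (isNode_of_classBase_succ_ne h hne)).1 hne)).antisymm (S.le_of_classBase_eq le_rfl h)

lemma elev_add_olev_lt_of_classBase_succ_ne (hne : classBase M (n + 1) x ≠ x) :
    elev M x + olev M x < 2 * (n + 1) := by
  by_cases h : classBase M n x = x
  · have heq := S.elev_add_olev_of_classBase_succ_ne hfree h hne
    omega
  · have hlt := S.lt_of_ne n le_rfl x h
    omega

lemma classBase_succ_eq_of_nodeBridge
    (h : NodeBridge M n (classBase M n) (classBase M n x) (classBase M n y)) :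
    classBase M (n + 1) x = classBase M (n + 1) y := by
  rw [classBase_succ_of_isNode h.1, classBase_succ_of_isNode h.2.1]
  exact topDominator_congr ((S.bridgedLayering hfree).unmergedDominators_bridge h)

lemma classBase_succ_eq_of_nodePred (h : NodePred M n (classBase M n) (classBase M n x) y)
    (hne : classBase M (n + 1) y ≠ y) : classBase M (n + 1) x = classBase M (n + 1) y := by
  rw [classBase_succ_of_isNode h.1, classBase_succ_of_isNode (by rw [h.2.1.1]; exact h.2.1),
    h.2.1.1]
  exact topDominator_congr ((S.bridgedLayering hfree).unmergedDominators_pred h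
    (S.hasChain_of_isNode h.1) ((S.classBase_succ_ne_iff_merged hfree h.2.1).1 hne))

lemma classBase_succ_ne_mate_iff (h : M.Adj x y) (hx : IsNode M n (classBase M n) x)
    (hy : IsNode M n (classBase M n) y) (hxout : elev M x < olev M x)
    (hyin : olev M y < elev M y) :
    classBase M (n + 1) x ≠ x ↔ classBase M (n + 1) y ≠ y := by
  have D := S.bridgedLayering hfree
  have hsucc : ∀ a, NodePred M n (classBase M n) y a → a = x :=
    fun _ => S.eq_of_nodePred_inner h hyin
  have hbr := S.not_nodeBridge_inner h hxout hyin
  rw [S.classBase_succ_ne_iff_merged hfree hx, S.classBase_succ_ne_iff_merged hfree hy]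
  exact ⟨D.merged_pred (fun hf => hf y h) (fun _ => S.eq_of_nodePred_outer h hxout) hsucc hbr,
    D.merged_succ hsucc hbr⟩

lemma isNode_of_matched_outer (h : M.Adj x y) (hx : classBase M n x = x)
    (hy : classBase M n y = y) (hxout : elev M x < olev M x) (hyin : olev M y < elev M y)
    (hne : classBase M (n + 1) x ≠ x ∨ classBase M (n + 1) y ≠ y) :
    IsNode M n (classBase M n) x ∧ IsNode M n (classBase M n) y := by
  have hcap := S.le_levelCap
  have hmate := elev_mate S.matching h
  have hmate' := elev_mate S.matching h.symm
  have htenacity := hne.imp (S.elev_add_olev_of_classBase_succ_ne hfree hx)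
    (S.elev_add_olev_of_classBase_succ_ne hfree hy)
  exact ⟨⟨hx, Or.inl (by omega)⟩, hy, Or.inr (by omega)⟩

lemma classBase_succ_mate_outer (h : M.Adj x y) (hx : classBase M n x = x)
    (hy : classBase M n y = y) (hxout : elev M x < olev M x) (hyin : olev M y < elev M y)
    (hne : classBase M (n + 1) x ≠ x ∨ classBase M (n + 1) y ≠ y) :
    classBase M (n + 1) y = classBase M (n + 1) x ∧ classBase M (n + 1) x ≠ x ∧
      classBase M (n + 1) y ≠ y := by
  obtain ⟨hxnode, hynode⟩ := S.isNode_of_matched_outer hfree h hx hy hxout hyin hne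
  have hiff := S.classBase_succ_ne_mate_iff hfree h hxnode hynode hxout hyin
  have hx_ne : classBase M (n + 1) x ≠ x := hne.elim id hiff.2
  exact ⟨S.classBase_succ_eq_of_nodePred hfree
    (by rw [hy]; exact ⟨hynode, hxnode, Or.inl ⟨hxout, h.symm⟩⟩) hx_ne, hx_ne, hiff.1 hx_ne⟩

lemma classBase_succ_ne_of_nodeBridge (h : NodeBridge M n (classBase M n) x y)
    (hlev : minlev M x = minlev M y) : classBase M (n + 1) x ≠ y := by
  have hx := S.hasChain_of_isNode h.1
  intro heq
  rw [classBase_succ_of_isNode (by rw [h.1.1]; exact h.1), h.1.1] at heq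
  obtain ⟨l, hl⟩ := id hx
  have hy := ((S.bridgedLayering hfree).topDominator_spec hx).1.1 l hl
  rw [heq] at hy
  rcases hl.eq_or_lt S.minlev_lt_of_nodePred hy with hyx | hlt
  · exact h.2.2.1 hyx.symm
  · omega

lemma classBase_succ_mate_inner (h : M.Adj x y) (hx : classBase M n x = x)
    (hy : classBase M n y = y) (hxin : olev M x < elev M x) (hyin : olev M y < elev M y)
    (hxn : olev M x = n) (hyn : olev M y = n) :
    classBase M (n + 1) y = classBase M (n + 1) x ∧ classBase M (n + 1) y ≠ y := by
  have hbr : NodeBridge M n (classBase M n) x y :=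
    ⟨⟨hx, Or.inr hxn.le⟩, ⟨hy, Or.inr hyn.le⟩, h.ne, Or.inr ⟨h, hxn, hyn, hxin, hyin⟩⟩
  have heq := S.classBase_succ_eq_of_nodeBridge hfree (x := x) (y := y) (by rwa [hx, hy])
  have hne := S.classBase_succ_ne_of_nodeBridge hfree hbr (by unfold minlev; omega)
  exact ⟨heq.symm, heq ▸ hne⟩

lemma classBase_succ_mate (h : M.Adj x y) (hne : classBase M (n + 1) x ≠ x) :
    classBase M (n + 1) y = classBase M (n + 1) x ∧ classBase M (n + 1) y ≠ y := by
  by_cases hx : classBase M n x = x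
  · have hy : classBase M n y = y :=
      not_not.1 fun hy => (S.mate n le_rfl y x h.symm hy).2 hx
    have hcap := S.le_levelCap
    have hmate := elev_mate S.matching h
    have hmate' := elev_mate S.matching h.symm
    have htenacity := S.elev_add_olev_of_classBase_succ_ne hfree hx hne
    have hx_lev := elev_ne_olev M x
    have hy_lev := elev_ne_olev M y
    by_cases hxout : elev M x < olev M x
    · obtain ⟨heq, -, hyne⟩ :=
        S.classBase_succ_mate_outer hfree h hx hy hxout (by omega) (Or.inl hne)
      exact ⟨heq, hyne⟩
    by_cases hyout : elev M y < olev M y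
    · obtain ⟨heq, hyne, -⟩ :=
        S.classBase_succ_mate_outer hfree h.symm hy hx hyout (by omega) (Or.inr hne)
      exact ⟨heq.symm, hyne⟩
    exact S.classBase_succ_mate_inner hfree h hx hy (by omega) (by omega) (by omega) (by omega)
  · obtain ⟨heq, hyne⟩ := S.mate n le_rfl x y h hx
    exact ⟨classBase_succ_congr heq, S.classBase_succ_ne hfree hyne⟩

lemma evenBound_succ_matched (h : M.Adj x y) (hx : classBase M (n + 1) x = x) :
    evenBound M (n + 1) x + evenBound M (n + 1) y ≤ 2 * (n + 1) + 2 := by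
  have hy : classBase M (n + 1) y = y :=
    not_not.1 fun hy => (S.classBase_succ_mate hfree h.symm hy).2 hx
  have hx_prev := S.eq_of_classBase_succ_eq hfree hx
  have hy_prev := S.eq_of_classBase_succ_eq hfree hy
  have hnot : ¬ (olev M x = n ∧ olev M y = n ∧ olev M x < elev M x ∧ olev M y < elev M y) :=
    fun ⟨hxn, hyn, hxin, hyin⟩ =>
      (S.classBase_succ_mate_inner hfree h hx_prev hy_prev hxin hyin hxn hyn).2 hy
  have hcap := S.le_levelCap
  have hmate := elev_mate S.matching h
  have hmate' := elev_mate S.matching h.symm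
  have hx_ten := S.le_of_classBase_eq le_rfl hx_prev
  have hx_lev := elev_ne_olev M x
  have hy_lev := elev_ne_olev M y
  by_cases hxout : elev M x < olev M x <;> by_cases hyout : elev M y < olev M y
  · rw [evenBound_outer hx hxout, evenBound_outer hy hyout]; omega
  · rw [evenBound_outer hx hxout, evenBound_inner hy hyout]; omega
  · rw [evenBound_inner hx hxout, evenBound_outer hy hyout]; omega
  · rw [evenBound_inner hx hxout, evenBound_inner hy hyout]; omega

lemma evenBound_succ_cases (x : V) :
    (evenBound M (n + 1) x = elev M x ∧ evenBound M n x = elev M x ∧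
      (classBase M n x = x → elev M x < olev M x ∧ elev M x ≤ n + 1)) ∨
    (evenBound M (n + 1) x = elev M x ∧ evenBound M n x = elev M x ∧
      classBase M (n + 1) x ≠ x ∧ IsNode M n (classBase M n) x ∧ olev M x < elev M x ∧
      elev M x + olev M x = 2 * n + 1) ∨
    evenBound M (n + 1) x = evenBound M n x + 2 ∨
    (evenBound M (n + 1) x = n + 2 ∧ evenBound M n x = n + 1 ∧ n < olev M x ∧
      (olev M x < elev M x ∨ (elev M x < olev M x ∧ n + 1 < elev M x))) := by
  have hlev := elev_ne_olev M x
  by_cases hx : classBase M (n + 1) x = x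
  · have hx_prev := S.eq_of_classBase_succ_eq hfree hx
    by_cases hout : elev M x < olev M x
    · rw [evenBound_outer hx hout, evenBound_outer hx_prev hout]
      omega
    · rw [evenBound_inner hx hout, evenBound_inner hx_prev hout]
      omega
  · rw [evenBound_of_ne hx]
    by_cases hx_prev : classBase M n x = x
    · have hten := S.elev_add_olev_of_classBase_succ_ne hfree hx_prev hx
      have hnode := isNode_of_classBase_succ_ne hx_prev hx
      by_cases hout : elev M x < olev M x
      · rw [evenBound_outer hx_prev hout]
        omega
      · rw [evenBound_inner hx_prev hout]
        exact Or.inr (Or.inl ⟨rfl, by omega, hx, hnode, by omega, hten⟩)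
    · rw [evenBound_of_ne hx_prev]
      exact Or.inl ⟨rfl, rfl, fun h => absurd h hx_prev⟩

lemma classBase_succ_eq_of_elev_add_elev (h : G.Adj x y) (hn : ¬ M.Adj x y)
    (hx : classBase M n x = x → elev M x ≤ n) (hy : classBase M n y = y → elev M y ≤ n)
    (hlev : elev M x + elev M y = 2 * n) : classBase M (n + 1) x = classBase M (n + 1) y := by
  by_cases hxy : classBase M n x = classBase M n y
  · exact classBase_succ_congr hxy
  · have hx := S.isNode_classBase hx
    have hy := S.isNode_classBase hy
    exact S.classBase_succ_eq_of_nodeBridge hfree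
      ⟨hx.1, hy.1, hxy, Or.inl ⟨hx.2, hy.2, x, y, rfl, rfl, h, hn, hlev⟩⟩

lemma classBase_succ_eq_of_elev_succ (h : G.Adj x y) (hn : ¬ M.Adj x y)
    (hy : IsNode M n (classBase M n) y) (hyin : olev M y < elev M y)
    (hne : classBase M (n + 1) y ≠ y) (hlev : elev M x + 1 = olev M y) :
    classBase M (n + 1) x = classBase M (n + 1) y :=
  S.classBase_succ_eq_of_nodePred hfree
    ⟨(S.isNode_classBase_of_succ_eq hlev hy hyin).1, hy, Or.inr ⟨hyin, x, rfl, h, hn, hlev⟩⟩ hne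

lemma le_evenBound_succ_add_of_ne (h : G.Adj x y) (hn : ¬ M.Adj x y)
    (hne : classBase M (n + 1) x ≠ classBase M (n + 1) y)
    (hprev : 2 * n ≤ evenBound M n x + evenBound M n y) :
    2 * (n + 1) ≤ evenBound M (n + 1) x + evenBound M (n + 1) y := by
  by_contra hlt
  have hcap := S.le_levelCap
  have hx_even := elev_mod M x
  have hy_even := elev_mod M y
  have hx_odd := olev_mod M x
  have hy_odd := olev_mod M y
  have hn' : ¬ M.Adj y x := fun h => hn h.symm
  have hxy := olev_le_of_adj h hn
  have hyx := olev_le_of_adj h.symm hn'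
  rcases S.evenBound_succ_cases hfree x with ⟨hx, hx', hxout⟩ |
    ⟨hx, hx', hxne, hxnode, hxin, hxten⟩ | hx | ⟨hx, hx', hx_lt, hx_lev⟩ <;>
  rcases S.evenBound_succ_cases hfree y with ⟨hy, hy', hyout⟩ |
    ⟨hy, hy', hyne, hynode, hyin, hyten⟩ | hy | ⟨hy, hy', hy_lt, hy_lev⟩ <;>
  try omega
  · exact hne (S.classBase_succ_eq_of_elev_add_elev hfree h hn
      (fun hb => by have := hxout hb; omega) (fun hb => by have := hyout hb; omega) (by omega))
  · exact hne (S.classBase_succ_eq_of_elev_succ hfree h hn hynode hyin hyne (by omega))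
  · exact hne
      (S.classBase_succ_eq_of_elev_succ hfree h.symm hn' hxnode hxin hxne (by omega)).symm

lemma evenBound_succ_unmatched (h : G.Adj x y) (hn : ¬ M.Adj x y) :
    2 * (n + 1) ≤ evenBound M (n + 1) x + evenBound M (n + 1) y +
      2 * sharedCount (n + 1) (classBase M) x y := by
  have hprev := S.unmatched x y h hn
  by_cases hxy : classBase M (n + 1) x = classBase M (n + 1) y
  · have hcount : sharedCount (n + 1) (classBase M) x y =
        sharedCount n (classBase M) x y + 1 := by
      rw [sharedCount, Nat.count_succ, if_pos hxy]
      rfl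
    have hx := S.evenBound_succ_cases hfree x
    have hy := S.evenBound_succ_cases hfree y
    omega
  · have hcount := sharedCount_classBase_eq_zero (mt classBase_succ_congr hxy)
    have hle := S.le_evenBound_succ_add_of_ne hfree h hn hxy (by omega)
    omega

lemma isFeasible_succ (hcap : 2 * (n + 1) + 4 ≤ levelCap V) : IsFeasible M (n + 1) where
  matching := S.matching
  le_levelCap := hcap
  le_olev := hfree
  idem j hj x := by
    rcases Nat.le_succ_iff.1 hj with hj | rfl
    exacts [S.idem j hj x, S.classBase_succ_idem hfree x]
  mono j hj x hx := by
    rcases Nat.le_succ_iff.1 hj with hj | rfl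
    exacts [S.classBase_succ_ne hfree (S.mono j hj x hx), hx]
  lt_of_ne j hj x hx := by
    rcases Nat.le_succ_iff.1 hj with hj | rfl
    exacts [S.lt_of_ne j hj x hx, S.elev_add_olev_lt_of_classBase_succ_ne hfree hx]
  mate j hj x y hxy hx := by
    rcases Nat.le_succ_iff.1 hj with hj | rfl
    exacts [S.mate j hj x y hxy hx, S.classBase_succ_mate hfree hxy hx]
  matched _ _ hxy hx := S.evenBound_succ_matched hfree hxy hx
  unmatched _ _ hxy hn := S.evenBound_succ_unmatched hfree hxy hn

lemma succ (hcap : 2 * (n + 1) + 4 ≤ levelCap V) : IsStage M (n + 1) where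
  toIsFeasible := S.isFeasible_succ hfree hcap
  ne_of_lt j hj x hlt := by
    rcases Nat.le_succ_iff.1 hj with hj | rfl
    · exact S.ne_of_lt j hj x hlt
    · intro hx
      have hle := (S.isFeasible_succ hfree hcap).le_of_classBase_eq hx
      omega

end IsStage

lemma isStage_zero (hM : M.IsMatching) : IsStage M 0 where
  matching := hM
  le_levelCap := by unfold levelCap; omega
  le_olev _ _ := Nat.zero_le _
  idem j hj _ := by obtain rfl := Nat.le_zero.1 hj; rfl
  mono j hj _ hx := by obtain rfl := Nat.le_zero.1 hj; exact hx
  lt_of_ne j hj _ hx := by obtain rfl := Nat.le_zero.1 hj; exact absurd rfl hx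
  mate j hj _ _ _ hx := by obtain rfl := Nat.le_zero.1 hj; exact absurd rfl hx
  matched x y _ _ := by
    have hx := evenBound_le_of_eq (M := M) (n := 0) (x := x) rfl
    have hy := evenBound_le_of_eq (M := M) (n := 0) (x := y) rfl
    omega
  unmatched _ _ _ _ := Nat.zero_le _
  ne_of_lt j hj _ hlt := by omega

lemma isStage [Finite V] (hM : M.IsMatching) (hcap : 2 * n + 4 ≤ levelCap V)
    (hfree : ∀ f, IsUnmatched M f → 2 * n ≤ olev M f) : IsStage M n := by
  induction n with
  | zero => exact isStage_zero hM
  | succ n ih =>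
    have S := ih (by omega) fun f hf => by have := hfree f hf; omega
    exact S.succ hfree hcap

end NextStage

section Bridges

variable {V : Type*} {G : SimpleGraph V} {M : G.Subgraph} {n t : ℕ} {b f v x y : V}

lemma edgeTenacity_of_adj (h : M.Adj x y) :
    edgeTenacity M s(x, y) = oddlevel M x + oddlevel M y + 1 := by
  rw [edgeTenacity, if_pos (Subgraph.mem_edgeSet.2 h), Sym2.lift_mk]

lemma edgeTenacity_of_not_adj (h : ¬ M.Adj x y) :
    edgeTenacity M s(x, y) = evenlevel M x + evenlevel M y + 1 := by
  rw [edgeTenacity, if_neg (by rwa [Subgraph.mem_edgeSet]), Sym2.lift_mk]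

lemma edgeTenacity_eq_iff_of_adj (h : M.Adj x y) (ht : t < levelCap V) :
    edgeTenacity M s(x, y) = t ↔ olev M x + olev M y + 1 = t := by
  rw [edgeTenacity_of_adj h]
  obtain hx | ⟨hx, hx'⟩ := oddlevel_cases M x
  · obtain hy | ⟨hy, hy'⟩ := oddlevel_cases M y
    · rw [hx, hy]
      norm_cast
    · simp only [hy, add_top, top_add, ENat.top_ne_natCast, false_iff]
      omega
  · simp only [hx, top_add, ENat.top_ne_natCast, false_iff]
    omega

lemma edgeTenacity_eq_iff_of_not_adj (h : ¬ M.Adj x y) (ht : t < levelCap V) :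
    edgeTenacity M s(x, y) = t ↔ elev M x + elev M y + 1 = t := by
  rw [edgeTenacity_of_not_adj h]
  obtain hx | ⟨hx, hx'⟩ := evenlevel_cases M x
  · obtain hy | ⟨hy, hy'⟩ := evenlevel_cases M y
    · rw [hx, hy]
      norm_cast
    · simp only [hy, add_top, top_add, ENat.top_ne_natCast, false_iff]
      omega
  · simp only [hx, top_add, ENat.top_ne_natCast, false_iff]
    omega

lemma IsMaxlevelPath.elev_le_length {p : G.Walk f v} (hp : IsMaxlevelPath M p) :
    elev M v ≤ p.length := by
  have hle : evenlevel M v ≤ p.length := hp.2.symm ▸ le_max_left _ _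
  obtain h | ⟨h, -⟩ := evenlevel_cases M v
  · exact_mod_cast h ▸ hle
  · simp [h] at hle

lemma IsMaxlevelPath.olev_le_length {p : G.Walk f v} (hp : IsMaxlevelPath M p) :
    olev M v ≤ p.length := by
  have hle : oddlevel M v ≤ p.length := hp.2.symm ▸ le_max_right _ _
  obtain h | ⟨h, -⟩ := oddlevel_cases M v
  · exact_mod_cast h ▸ hle
  · simp [h] at hle

lemma isBridgeEdge_iff_of_adj (h : G.Adj x y) :
    IsBridgeEdge M s(x, y) ↔ ¬ IsPredecessor M x y ∧ ¬ IsPredecessor M y x := by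
  refine ⟨fun hb => ⟨fun hxy => hb.2 ⟨x, y, hxy, rfl⟩, fun hyx => hb.2 ⟨y, x, hyx, Sym2.eq_swap⟩⟩,
    fun ⟨hxy, hyx⟩ => ⟨h, ?_⟩⟩
  rintro ⟨u, w, huw, heq⟩
  rcases Sym2.eq_iff.1 heq with ⟨rfl, rfl⟩ | ⟨rfl, rfl⟩
  exacts [hxy huw, hyx huw]

/-- At stage `n`, the vertex `x` lies in no blossom and is inner. -/
def IsInnerBase (M : G.Subgraph) (n : ℕ) (x : V) : Prop :=
  classBase M n x = x ∧ olev M x < elev M x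

/-- At stage `n`, the vertex `x` lies in no blossom, and `k` has the parity of its larger level. -/
def HasMaxParity (M : G.Subgraph) (n k : ℕ) (x : V) : Prop :=
  classBase M n x = x ∧ (k % 2 = 1 ↔ elev M x < olev M x)

/-- `e` is a bridge of tenacity `t`. -/
def IsBridgeOfTenacity (M : G.Subgraph) (t : ℕ) (e : Sym2 V) : Prop :=
  IsBridgeEdge M e ∧ edgeTenacity M e = t

lemma hasMaxParity_of_even {k : ℕ} (h : k % 2 = 0) :
    HasMaxParity M n k x ↔ IsInnerBase M n x := by
  have hne := elev_ne_olev M x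
  refine and_congr_right fun _ => ?_
  omega

lemma hasMaxParity_of_odd {k : ℕ} (h : k % 2 = 1) :
    HasMaxParity M n k x ↔ classBase M n x = x ∧ elev M x < olev M x := by
  rw [HasMaxParity, h, eq_self, true_iff]

open Classical in
lemma hasMaxParity_add_isInnerBase_add {k : ℕ} (h : k % 2 = 1) :
    (if HasMaxParity M n k x then 1 else 0) + (if IsInnerBase M n x then 1 else 0) +
      (if classBase M n x ≠ x then 1 else 0) = 1 := by
  have hne := elev_ne_olev M x
  rw [hasMaxParity_of_odd h, IsInnerBase]
  by_cases hb : classBase M n x = x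
  · rcases hne.lt_or_gt with hlt | hlt <;> simp [hb, hlt, hlt.not_gt]
  · simp [hb]

lemma evenBound_cases (M : G.Subgraph) (n : ℕ) (x : V) :
    (¬ IsInnerBase M n x ∧ (evenBound M n x = elev M x ∨
        (evenBound M n x = n + 1 ∧ elev M x < olev M x ∧ n + 1 ≤ elev M x))) ∨
      (IsInnerBase M n x ∧ evenBound M n x = max (2 * n + 1 - olev M x) (n + 1)) := by
  by_cases hb : classBase M n x = x
  · by_cases hout : elev M x < olev M x
    · refine Or.inl ⟨fun h => by have := h.2; omega, ?_⟩
      rw [evenBound_outer hb hout]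
      omega
    · have hne := elev_ne_olev M x
      exact Or.inr ⟨⟨hb, by omega⟩, evenBound_inner hb hout⟩
  · exact Or.inl ⟨fun h => hb h.1, Or.inl (evenBound_of_ne hb)⟩

lemma unmatched_edge_cases (hcap : 2 * n + 4 ≤ levelCap V) (h : G.Adj x y) (hn : ¬ M.Adj x y)
    (hsum : evenBound M n x + evenBound M n y = 2 * n) :
    (¬ IsInnerBase M n x ∧ ¬ IsInnerBase M n y ∧ elev M x + elev M y = 2 * n) ∨
      (¬ IsInnerBase M n x ∧ IsInnerBase M n y ∧ elev M x + 1 = olev M y ∧ olev M y ≤ n) ∨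
      (IsInnerBase M n x ∧ ¬ IsInnerBase M n y ∧ elev M y + 1 = olev M x ∧ olev M x ≤ n) := by
  have hxy : elev M x < levelCap V → _ := olev_le_of_adj h hn
  have hyx : elev M y < levelCap V → _ := olev_le_of_adj h.symm fun hm => hn hm.symm
  rcases evenBound_cases M n x with ⟨hx, hEx | hEx⟩ | ⟨hx, hEx⟩ <;>
    rcases evenBound_cases M n y with ⟨hy, hEy | hEy⟩ | ⟨hy, hEy⟩
  · exact Or.inl ⟨hx, hy, by omega⟩
  · omega
  · have := hy.2
    exact Or.inr (Or.inl ⟨hx, hy, by omega, by omega⟩)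
  all_goals try omega
  have := hx.2
  exact Or.inr (Or.inr ⟨hx, hy, by omega, by omega⟩)

variable [Finite V]

lemma IsMinlevelPath.length_eq {p : G.Walk f v} (hp : IsMinlevelPath M p) :
    p.length = minlev M v := by
  have hlt := two_mul_length_lt_levelCap hp.1.isAltPathFromFree.2.1
  have heven : p.length ≤ elev M v := by
    have hle : (p.length : ℕ∞) ≤ evenlevel M v := hp.2.trans_le (min_le_left _ _)
    obtain h | ⟨-, h⟩ := evenlevel_cases M v
    · exact_mod_cast h ▸ hle
    · omega
  have hodd : p.length ≤ olev M v := by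
    have hle : (p.length : ℕ∞) ≤ oddlevel M v := hp.2.trans_le (min_le_right _ _)
    obtain h | ⟨-, h⟩ := oddlevel_cases M v
    · exact_mod_cast h ▸ hle
    · omega
  have hlen := hp.1.length_eq
  unfold minlev
  omega

lemma isMinlevelPath_of_length_eq {p : G.Walk f v} (hp : IsAltPathFromFree M p)
    (hlen : p.length = minlev M v) : IsMinlevelPath M p := by
  rcases min_choice (elev M v) (olev M v) with h | h
  · have heven := isEvenlevelPath_of_length_eq hp (hlen.trans h)
    refine ⟨Or.inl heven, heven.2.2.trans (min_eq_left ?_).symm⟩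
    rw [← heven.2.2]
    obtain ho | ⟨ho, -⟩ := oddlevel_cases M v
    · exact_mod_cast ho ▸ Nat.cast_le.2 (hlen.trans_le (min_le_right _ _))
    · exact ho ▸ le_top
  · have hodd := isOddlevelPath_of_length_eq hp (hlen.trans h)
    refine ⟨Or.inr hodd, hodd.2.2.trans (min_eq_right ?_).symm⟩
    rw [← hodd.2.2]
    obtain he | ⟨he, -⟩ := evenlevel_cases M v
    · exact_mod_cast he ▸ Nat.cast_le.2 (hlen.trans_le (min_le_left _ _))
    · exact he ▸ le_top

lemma isPredecessor_iff : IsPredecessor M x y ↔ ∃ (f : V) (q : G.Walk f x) (h : G.Adj x y),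
    IsAltPathFromFree M (q.concat h) ∧ (q.concat h).length = minlev M y := by
  constructor
  · rintro ⟨f, p, hp, hnil, hpen⟩
    obtain ⟨w, q, h, rfl⟩ := exists_eq_concat p fun h0 => hnil (Walk.length_eq_zero_iff.1 h0)
    obtain rfl : w = x := by rw [← hpen, Walk.penultimate_concat]
    exact ⟨f, q, h, hp.1.isAltPathFromFree, hp.length_eq⟩
  · rintro ⟨f, q, h, hp, hlen⟩
    exact ⟨f, q.concat h, isMinlevelPath_of_length_eq hp hlen,
      fun hnil => by simpa using Walk.length_eq_zero_iff.2 hnil, Walk.penultimate_concat q h⟩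

lemma isPredecessor_unmatched (h : G.Adj x y) (hn : ¬ M.Adj x y) (hx : elev M x < levelCap V)
    (hxy : elev M x + 1 = olev M y) (hy : olev M y < elev M y) : IsPredecessor M x y := by
  obtain ⟨f, p, hp, hlen⟩ := exists_length_eq_elev hx
  have heven := elev_mod M x
  have hyp : y ∉ p.support := fun hmem => by
    have := elev_or_olev_le_of_mem hp hmem
    omega
  refine isPredecessor_iff.2 ⟨f, p, h,
    isAltPathFromFree_concat_iff.2 ⟨hp, hyp, iff_of_false hn (by omega)⟩, ?_⟩
  rw [Walk.length_concat, minlev]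
  omega

lemma isPredecessor_matched (hM : M.IsMatching) (h : M.Adj x y) (hy : elev M y < levelCap V)
    (hout : elev M y < olev M y) : IsPredecessor M x y := by
  obtain ⟨f, p, hp, hlen⟩ := exists_length_eq_elev hy
  have heven := elev_mod M y
  have hpos := elev_ne_zero_of_adj h.symm
  obtain ⟨w, q, hwy, rfl⟩ := exists_eq_concat p (by omega)
  have hlast := (isAltPathFromFree_concat_iff.1 hp).2.2
  rw [Walk.length_concat] at hlen
  obtain rfl := hM.eq_of_adj_right h (hlast.2 (by omega))
  refine isPredecessor_iff.2 ⟨f, q, hwy, hp, ?_⟩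
  rw [Walk.length_concat, minlev]
  omega

lemma IsPredecessor.lt_iff (h : IsPredecessor M x y) : elev M y < olev M y ↔ M.Adj x y := by
  obtain ⟨f, q, hxy, hp, hlen⟩ := isPredecessor_iff.1 h
  rw [(isAltPathFromFree_concat_iff.1 hp).2.2]
  rw [Walk.length_concat, minlev] at hlen
  have heven := elev_mod M y
  have hodd := olev_mod M y
  omega

lemma isBridgeEdge_matched (h : M.Adj x y) (hx : olev M x < elev M x) (hy : olev M y < elev M y) :
    IsBridgeEdge M s(x, y) := by
  refine (isBridgeEdge_iff_of_adj h.adj_sub).2 ⟨fun hxy => ?_, fun hyx => ?_⟩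
  · exact hy.not_gt (hxy.lt_iff.2 h)
  · exact hx.not_gt (hyx.lt_iff.2 h.symm)

namespace IsStage

lemma not_isPredecessor (S : IsStage M n) (hn : ¬ M.Adj x y)
    (hxy : classBase M n x ≠ classBase M n y) (hy : ¬ IsInnerBase M n y) :
    ¬ IsPredecessor M x y := by
  intro hpred
  have hlt : olev M y < elev M y :=
    lt_of_le_of_ne (not_lt.1 fun h => hn (hpred.lt_iff.1 h)) (elev_ne_olev M y).symm
  obtain ⟨f, q, h, hp, hlen⟩ := isPredecessor_iff.1 hpred
  have hyb : classBase M n y ≠ y := fun hb => hy ⟨hb, hlt⟩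
  -- The path reaches `y` through the base of its class, so it stays in that class afterwards.
  obtain ⟨q', r, hqr, -, hr⟩ := S.exists_eq_append_class le_rfl hyb hp
    (Or.inr (hlen.trans (min_eq_right hlt.le)))
  obtain ⟨w, r', hwy, rfl⟩ := exists_eq_concat r fun h0 => hyb (Walk.eq_of_length_eq_zero h0)
  rw [Walk.append_concat] at hqr
  have hw := congrArg Walk.penultimate hqr
  rw [Walk.penultimate_concat, Walk.penultimate_concat] at hw
  subst hw
  exact hxy (hr x ((mem_support_concat _ _).2 (Or.inl r'.end_mem_support)))

lemma isBridgeEdge_unmatched (S : IsStage M n) (h : G.Adj x y) (hn : ¬ M.Adj x y)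
    (hxy : classBase M n x ≠ classBase M n y) (hx : ¬ IsInnerBase M n x)
    (hy : ¬ IsInnerBase M n y) : IsBridgeEdge M s(x, y) :=
  (isBridgeEdge_iff_of_adj h).2 ⟨S.not_isPredecessor hn hxy hy,
    S.not_isPredecessor (fun hm => hn hm.symm) hxy.symm hx⟩

lemma evenBound_eq_elev (S : IsStage M n) (hxy : classBase M n x = classBase M n y)
    (hne : x ≠ y) : ¬ IsInnerBase M n x ∧ evenBound M n x = elev M x := by
  by_cases hx : classBase M n x = x
  · have hy : classBase M n y ≠ y := by rwa [← hxy, hx]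
    have hlt := S.elev_classBase_lt le_rfl hy
    have hlt' := S.lt_olev_classBase le_rfl hy
    rw [← hxy, hx] at hlt hlt'
    refine ⟨fun h => by have := h.2; omega, ?_⟩
    rw [evenBound_outer hx (by omega)]
    omega
  · exact ⟨fun h => hx h.1, evenBound_of_ne hx⟩

lemma tight_unmatched (S : IsStage M n) {p : G.Walk b x} {h : G.Adj x y}
    (hb : ∀ j ≤ n, classBase M j b = b) (hp : IsAltPathUnmatchedStart M (p.concat h))
    (ht : IsTight n (classBase M) (evenBound M n) (oddBound M n) (p.concat h))
    (heven : p.length % 2 = 0) :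
    ¬ M.Adj x y ∧
      evenBound M n x + evenBound M n y + 2 * sharedCount n (classBase M) x y = 2 * n := by
  have hn : ¬ M.Adj x y := by
    rw [(isAltPathUnmatchedStart_concat_iff.1 hp).2.2]
    omega
  have heq := (S.isDual.tight_unmatched hb hp ht heven).1
  have hle := S.unmatched x y h hn
  have hodd := S.oddBound_add_le y
  exact ⟨hn, by omega⟩

lemma elev_add_elev_lt (S : IsStage M n) (hxy : classBase M n x = classBase M n y) (hne : x ≠ y)
    (hsum : evenBound M n x + evenBound M n y + 2 * sharedCount n (classBase M) x y = 2 * n) :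
    elev M x + elev M y + 1 < 2 * n := by
  have hshared : 0 < sharedCount n (classBase M) x y := by
    rw [sharedCount, Nat.count_succ, if_pos hxy]
    exact Nat.succ_pos _
  have hx := (S.evenBound_eq_elev hxy hne).2
  have hy := (S.evenBound_eq_elev hxy.symm hne.symm).2
  omega

open Classical in
lemma isBridgeOfTenacity_add_of_not_adj (S : IsStage M n) (h : G.Adj x y) (hn : ¬ M.Adj x y)
    (hsum : evenBound M n x + evenBound M n y + 2 * sharedCount n (classBase M) x y = 2 * n) :
    (if IsBridgeOfTenacity M (2 * n + 1) s(x, y) then 1 else 0) +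
      (if IsInnerBase M n x then 1 else 0) + (if IsInnerBase M n y then 1 else 0) +
      (if classBase M n x = classBase M n y then 1 else 0) = 1 := by
  have hcap := S.le_levelCap
  by_cases hxy : classBase M n x = classBase M n y
  · have hx := (S.evenBound_eq_elev hxy h.ne).1
    have hy := (S.evenBound_eq_elev hxy.symm h.ne').1
    have hbr : ¬ IsBridgeOfTenacity M (2 * n + 1) s(x, y) := fun hbr => by
      have hten := (edgeTenacity_eq_iff_of_not_adj hn (by omega)).1 hbr.2
      have hlt := S.elev_add_elev_lt hxy h.ne hsum
      omega
    simp [hxy, hx, hy, hbr]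
  rw [sharedCount_classBase_eq_zero hxy] at hsum
  rcases unmatched_edge_cases hcap h hn (by omega) with
    ⟨hx, hy, hlev⟩ | ⟨hx, hy, hlev, hle⟩ | ⟨hx, hy, hlev, hle⟩
  · have hbr : IsBridgeOfTenacity M (2 * n + 1) s(x, y) :=
      ⟨S.isBridgeEdge_unmatched h hn hxy hx hy,
        (edgeTenacity_eq_iff_of_not_adj hn (by omega)).2 (by omega)⟩
    simp [hxy, hx, hy, hbr]
  · have hbr : ¬ IsBridgeOfTenacity M (2 * n + 1) s(x, y) := fun hbr =>
      ((isBridgeEdge_iff_of_adj h).1 hbr.1).1 (isPredecessor_unmatched h hn (by omega) hlev hy.2)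
    simp [hxy, hx, hy, hbr]
  · have hbr : ¬ IsBridgeOfTenacity M (2 * n + 1) s(x, y) := fun hbr =>
      ((isBridgeEdge_iff_of_adj h).1 hbr.1).2
        (isPredecessor_unmatched h.symm (fun hm => hn hm.symm) (by omega) hlev hx.2)
    simp [hxy, hx, hy, hbr]

lemma olev_le_of_tight (S : IsStage M n) {p : G.Walk f x} (hp : IsAltPathFromFree M p)
    (ht : IsTight n (classBase M) (evenBound M n) (oddBound M n) p) (hodd : p.length % 2 = 1)
    (hx : IsInnerBase M n x) : olev M x ≤ n := by
  obtain ⟨w, q, h, rfl⟩ := exists_eq_concat p (by omega)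
  rw [Walk.length_concat] at hodd
  obtain ⟨hn, hsum⟩ := S.tight_unmatched (fun _ => S.classBase_of_isUnmatched hp.1)
    hp.unmatchedStart ht (by omega)
  have hwx : classBase M n w ≠ classBase M n x :=
    fun hwx => (S.evenBound_eq_elev hwx.symm h.ne').1 hx
  rw [sharedCount_classBase_eq_zero hwx] at hsum
  rcases unmatched_edge_cases S.le_levelCap h hn (by omega) with
    ⟨-, hx', -⟩ | ⟨-, -, -, hle⟩ | ⟨-, hx', -⟩
  exacts [absurd hx hx', hle, absurd hx hx']

lemma isBridgeOfTenacity_matched_iff (S : IsStage M n) (h : M.Adj x y)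
    (hxn : IsInnerBase M n x → olev M x ≤ n) :
    IsBridgeOfTenacity M (2 * n + 1) s(x, y) ↔ IsInnerBase M n x ∧ IsInnerBase M n y := by
  have hcap := S.le_levelCap
  have hy := elev_mate S.matching h
  have hmod := levelCap_mod V
  have hten : edgeTenacity M s(x, y) = (2 * n + 1 : ℕ) ↔ _ :=
    edgeTenacity_eq_iff_of_adj h (by omega)
  have hb := S.classBase_eq_self_iff_of_adj h
  constructor
  · rintro ⟨hbr, hbt⟩
    have hsum := hten.1 hbt
    obtain ⟨hxy, hyx⟩ := (isBridgeEdge_iff_of_adj h.adj_sub).1 hbr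
    have hxin : ¬ elev M x < olev M x := fun hout =>
      hyx (isPredecessor_matched S.matching h.symm (by omega) hout)
    have hyin : ¬ elev M y < olev M y := fun hout =>
      hxy (isPredecessor_matched S.matching h (by omega) hout)
    have hxb : classBase M n x = x := not_not.1 fun hxb => by
      have := S.lt_of_ne n le_rfl x hxb
      omega
    have hnx := elev_ne_olev M x
    have hny := elev_ne_olev M y
    exact ⟨⟨hxb, by omega⟩, hb.1 hxb, by omega⟩
  · rintro ⟨hxin, hyin⟩
    have hle := hxn hxin
    have hsum' := S.le_of_classBase_eq le_rfl hyin.1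
    refine ⟨isBridgeEdge_matched h hxin.2 hyin.2, hten.2 ?_⟩
    have := hxin.2
    have := hyin.2
    omega

open Classical in
lemma isBridgeOfTenacity_add_of_adj (S : IsStage M n) {p : G.Walk f x} (h : M.Adj x y)
    (hp : IsAltPathFromFree M p)
    (ht : IsTight n (classBase M) (evenBound M n) (oddBound M n) p) (hodd : p.length % 2 = 1) :
    (if IsBridgeOfTenacity M (2 * n + 1) s(x, y) then 1 else 0) +
      (if HasMaxParity M n p.length x then 1 else 0) =
      if HasMaxParity M n (p.length + 1) y then 1 else 0 := by
  have hbr := S.isBridgeOfTenacity_matched_iff h (S.olev_le_of_tight hp ht hodd)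
  have hlev := elev_mate S.matching h
  have hlev' := elev_mate S.matching h.symm
  have hodd' : (p.length + 1) % 2 = 0 := by omega
  have hle := olev_le hp hodd
  have hlt := two_mul_length_lt_levelCap hp.2.1
  have hb := S.classBase_eq_self_iff_of_adj h
  have hne := elev_ne_olev M x
  have hne' := elev_ne_olev M y
  rw [IsInnerBase, hb] at hbr
  simp only [hbr, hasMaxParity_of_odd hodd, hasMaxParity_of_even hodd', hb, IsInnerBase]
  split_ifs <;> grind

open Classical in
lemma countP_isBridgeOfTenacity (S : IsStage M n) {p : G.Walk f x} (hp : IsAltPathFromFree M p)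
    (ht : IsTight n (classBase M) (evenBound M n) (oddBound M n) p) :
    p.edges.countP (IsBridgeOfTenacity M (2 * n + 1)) =
      (if HasMaxParity M n p.length x then 1 else 0) +
        (unbased (classBase M n) (supportSet p)).ncard := by
  have hb : ∀ j ≤ n, _ := fun _ => S.classBase_of_isUnmatched hp.1
  induction p using Walk.concatRec with
  | @Hnil u =>
    have hmax : ¬ HasMaxParity M n (Walk.nil : G.Walk u u).length u := fun hmax => by
      have hlt := hmax.2.2
      have heven := elev_of_isUnmatched hp.1
      have hodd := olev_mod M u
      rw [Walk.length_nil] at hlt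
      omega
    rw [if_neg hmax, unbased_nil (hb n le_rfl), Set.ncard_empty]
    simp
  | @Hconcat u v w p h ih =>
    have hp' := (isAltPathFromFree_concat_iff.1 hp).1
    have ht' := S.isDual.isTight_of_concat hb hp.unmatchedStart ht
    have hcount := ih hp' ht' hb
    rw [Walk.edges_concat, List.concat_eq_append, List.countP_append, List.countP_singleton,
      hcount, Walk.length_concat]
    simp only [decide_eq_true_eq]
    rcases Nat.mod_two_eq_zero_or_one p.length with heven | hodd
    · obtain ⟨hn, hsum⟩ := S.tight_unmatched hb hp.unmatchedStart ht heven
      have hone := S.isBridgeOfTenacity_add_of_not_adj h hn hsum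
      have hunbased := (S.isDual.tight_unmatched hb hp.unmatchedStart ht heven).2 n le_rfl
      have hw := hasMaxParity_add_isInnerBase_add (M := M) (n := n) (x := w)
        (k := p.length + 1) (by omega)
      simp only [hasMaxParity_of_even heven]
      omega
    · have hm := (isAltPathFromFree_concat_iff.1 hp).2.2.2 hodd
      rw [(S.isDual.tight_matched hb hp.unmatchedStart ht hodd).2 n le_rfl,
        ← S.isBridgeOfTenacity_add_of_adj hm hp' ht' hodd]
      omega

lemma isTight_of_elev_add_olev (S : IsStage M n) (hx : elev M x + olev M x = 2 * n + 1)
    {p : G.Walk f x} (hp : IsAltPathFromFree M p)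
    (hlen : p.length = elev M x ∨ p.length = olev M x) :
    classBase M n x = x ∧ IsTight n (classBase M) (evenBound M n) (oddBound M n) p ∧
      ∀ j ≤ n, unbased (classBase M j) (supportSet p) = ∅ := by
  have hb : classBase M n x = x := not_not.1 fun h => by
    have := S.lt_of_ne n le_rfl x h
    omega
  have hE : evenBound M n x = elev M x := by
    by_cases hout : elev M x < olev M x
    · rw [evenBound_outer hb hout]
      omega
    · rw [evenBound_inner hb hout]
      have := elev_ne_olev M x
      omega
  refine ⟨hb, S.isTight_of_le hp (le_of_eq ?_)⟩
  rcases hlen with heven | hodd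
  · rw [levelBound_of_even (by rw [heven, elev_mod]), hE, heven]
  · rw [levelBound_of_odd (by rw [hodd, olev_mod]), oddBound_of_eq hb, hE]
    omega

open Classical in
lemma existsUnique_bridge (S : IsStage M n) (hv : tenacity M v = (2 * n + 1 : ℕ))
    {p : G.Walk f v} (hp : IsMaxlevelPath M p) :
    ∃! e, e ∈ p.edges ∧ IsBridgeEdge M e ∧ edgeTenacity M e = (2 * n + 1 : ℕ) := by
  have hfree := hp.1.isAltPathFromFree
  obtain ⟨hb, ht, hunbased⟩ :=
    S.isTight_of_elev_add_olev (elev_add_olev_of_tenacity hv) hfree hp.1.length_eq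
  have hmax : HasMaxParity M n p.length v := by
    have heven := elev_mod M v
    have hodd := olev_mod M v
    have hle := hp.elev_le_length
    have hle' := hp.olev_le_length
    have hlen := hp.1.length_eq
    refine ⟨hb, ?_⟩
    omega
  have hcount := S.countP_isBridgeOfTenacity hfree ht
  rw [if_pos hmax, hunbased n le_rfl, Set.ncard_empty, List.countP_eq_length_filter,
    Nat.add_zero, List.length_eq_one_iff] at hcount
  obtain ⟨e, he⟩ := hcount
  have key (b : Sym2 V) :
      b ∈ p.edges ∧ IsBridgeEdge M b ∧ edgeTenacity M b = (2 * n + 1 : ℕ) ↔ b = e := by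
    rw [← List.mem_singleton (a := b), ← he, List.mem_filter, decide_eq_true_iff,
      IsBridgeOfTenacity]
  exact ⟨e, (key e).2 rfl, fun b hb => (key b).1 hb⟩

end IsStage

end Bridges

section Bases

variable {V : Type*} {G : SimpleGraph V} {M : G.Subgraph} {n j k : ℕ} {b c f u v w x : V}

lemma IsBaseOn.eq {p : G.Walk f x} (hb : IsBaseOn M p b) (hc : IsBaseOn M p c) : b = c := by
  obtain ⟨hbx, q, r, rfl, hr⟩ := hb
  obtain ⟨hcx, q', r', heq, hr'⟩ := hc
  have hsuffix : r.support <:+ (q.append r).support := by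
    rw [Walk.support_append_eq_support_dropLast_append]
    exact List.suffix_append _ _
  have hsuffix' : r'.support <:+ (q.append r).support := by
    rw [heq, Walk.support_append_eq_support_dropLast_append]
    exact List.suffix_append _ _
  rcases List.suffix_or_suffix_of_suffix hsuffix hsuffix' with h | h
  · exact hr' b (h.subset r.start_mem_support) hbx
  · exact (hr c (h.subset r'.start_mem_support) hcx).symm

lemma isOuter_of_lt (hout : elev M x < olev M x) (hcap : elev M x < levelCap V) :
    IsOuter M x := by
  rw [IsOuter, evenlevel_of_lt hcap]
  obtain h | ⟨h, -⟩ := oddlevel_cases M x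
  · exact_mod_cast h ▸ Nat.cast_lt.2 hout
  · exact h ▸ ENat.natCast_lt_top _

namespace IsStage

lemma two_mul_le_tenacity_iff (S : IsStage M n) (hj : j ≤ n) :
    ((2 * j : ℕ) : ℕ∞) ≤ tenacity M x ↔ classBase M j x = x := by
  refine ⟨fun hle => not_not.1 fun hne => ?_,
    fun hx => le_tenacity_of_le ((Nat.le_succ _).trans (S.le_of_classBase_eq hj hx))⟩
  have hlt := S.lt_of_ne j hj x hne
  have hcap := S.le_levelCap
  rw [tenacity_of_lt (by omega), Nat.cast_le] at hle
  omega

lemma lt_tenacity_iff (S : IsStage M n) (hj : j < n) :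
    ((2 * j + 1 : ℕ) : ℕ∞) < tenacity M x ↔ classBase M (j + 1) x = x := by
  rw [← S.two_mul_le_tenacity_iff hj, ← ENat.add_one_le_iff (ENat.natCast_ne_top _)]
  norm_cast

lemma tenacity_eq_iff (S : IsStage M n) (hj : j < n) :
    tenacity M x = (2 * j + 1 : ℕ) ↔ classBase M j x = x ∧ classBase M (j + 1) x ≠ x := by
  constructor
  · intro h
    rw [ne_eq, ← S.two_mul_le_tenacity_iff hj.le, ← S.lt_tenacity_iff hj, h]
    exact ⟨Nat.cast_le.2 (Nat.le_succ _), lt_irrefl _⟩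
  · rintro ⟨hx, hne⟩
    have hle := S.le_of_classBase_eq hj.le hx
    have hlt := S.lt_of_ne (j + 1) hj x hne
    have hcap := S.le_levelCap
    rw [tenacity_of_lt (by omega), Nat.cast_inj]
    omega

lemma exists_tenacity_eq (S : IsStage M n) (hx : classBase M n x ≠ x) :
    ∃ j < n, tenacity M x = (2 * j + 1 : ℕ) := by
  have hlt := S.lt_of_ne n le_rfl x hx
  have hcap := S.le_levelCap
  have heven := elev_mod M x
  have hodd := olev_mod M x
  refine ⟨(elev M x + olev M x) / 2, by omega, ?_⟩
  rw [tenacity_of_lt (by omega), Nat.cast_inj]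
  omega

lemma classBase_classBase (S : IsStage M n) (hjk : j ≤ k) (hk : k ≤ n) (x : V) :
    classBase M k (classBase M j x) = classBase M k x :=
  classBase_congr hjk (S.idem j (hjk.trans hk) x)

lemma classBase_eq_of_le (S : IsStage M n) (hjk : j ≤ k) (hk : k ≤ n)
    (hx : classBase M k x = x) : classBase M j x = x := by
  rw [← not_not (a := _ = _), ← ne_eq, S.classBase_ne_iff (hjk.trans hk)]
  have hle := S.le_of_classBase_eq hk hx
  omega

lemma disjoint_or_subset_of_le (S : IsStage M n) (hjk : j ≤ k) (hk : k ≤ n)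
    (hc : classBase M k c = c) :
    Disjoint {x | classBase M j x = b ∧ x ≠ b} {x | classBase M k x = c ∧ x ≠ c} ∨
      {x | classBase M j x = b ∧ x ≠ b} ⊆ {x | classBase M k x = c ∧ x ≠ c} := by
  by_cases hbc : classBase M k b = c
  · right
    rintro x ⟨rfl, hne⟩
    refine ⟨(S.classBase_classBase hjk hk x).symm.trans hbc, ?_⟩
    rintro rfl
    exact hne (S.classBase_eq_of_le hjk hk hc).symm
  · left
    refine Set.disjoint_left.2 ?_
    rintro x ⟨rfl, -⟩ ⟨hx, -⟩
    exact hbc ((S.classBase_classBase hjk hk x).trans hx)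

lemma classBase_one (S : IsStage M n) (hn : 1 ≤ n) (x : V) : classBase M 1 x = x := by
  by_contra hne
  have hlt := S.lt_of_ne 1 hn x hne
  have hodd := olev_mod M x
  have hle := S.le_olev x (isUnmatched_of_elev_eq_zero (by omega))
  omega

variable [Finite V]

lemma isOuter_classBase (S : IsStage M n) (hj : j ≤ n) (hx : classBase M j x ≠ x) :
    IsOuter M (classBase M j x) := by
  have hlt := S.elev_classBase_lt hj hx
  have hlt' := S.lt_olev_classBase hj hx
  have hcap := S.le_levelCap
  exact isOuter_of_lt (by omega) (by omega)

lemma isBaseOn (S : IsStage M n) (hj : j < n) (hx : tenacity M x = (2 * j + 1 : ℕ))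
    {p : G.Walk f x} (hp : IsLevelPath M p) : IsBaseOn M p (classBase M (j + 1) x) := by
  obtain ⟨q, r, rfl, -, hr⟩ := S.exists_eq_append_class hj ((S.tenacity_eq_iff hj).1 hx).2
    hp.isAltPathFromFree hp.length_eq
  refine ⟨hx ▸ (S.lt_tenacity_iff hj).2 (S.idem _ hj x), q, r, rfl, fun z hz hlt => ?_⟩
  rw [← hr z hz, (S.lt_tenacity_iff hj).1 (hx ▸ hlt)]

lemma hasBase_iff (S : IsStage M n) (hj : j < n) (hx : tenacity M x = (2 * j + 1 : ℕ)) :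
    HasBase M x b ↔ classBase M (j + 1) x = b := by
  have hbase : baseSet M x = {classBase M (j + 1) x} := by
    refine Set.Subset.antisymm ?_ (Set.singleton_subset_iff.2 ?_)
    · rintro c ⟨f, p, hp, hc⟩
      exact hc.eq (S.isBaseOn hj hx hp)
    · obtain ⟨f, p, hp⟩ := exists_evenlevelPath (M := M) (v := x) fun htop => by
        rw [tenacity, htop, top_add] at hx
        exact ENat.top_ne_natCast _ hx
      exact ⟨f, p, Or.inl hp, S.isBaseOn hj hx (Or.inl hp)⟩
  rw [HasBase, hbase, Set.singleton_eq_singleton_iff]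

lemma mem_blossomCore_iff (S : IsStage M n) (hj : j < n) :
    x ∈ blossomCore M b (2 * j + 1) ↔
      classBase M j x = x ∧ classBase M (j + 1) x = b ∧ x ≠ b := by
  constructor
  · rintro ⟨hten, hb⟩
    obtain ⟨hx, hne⟩ := (S.tenacity_eq_iff hj).1 hten
    rw [S.hasBase_iff hj hten] at hb
    exact ⟨hx, hb, fun h => hne (hb.trans h.symm)⟩
  · rintro ⟨hx, rfl, hne⟩
    have hten := (S.tenacity_eq_iff hj).2 ⟨hx, hne.symm⟩
    exact ⟨hten, (S.hasBase_iff hj hten).2 rfl⟩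

lemma blossom_eq (S : IsStage M n) (hk : k < n) (hb : classBase M (k + 1) b = b) :
    blossom M (2 * k + 1) b = {x | classBase M (k + 1) x = b ∧ x ≠ b} := by
  induction k generalizing b with
  | zero =>
    refine (Set.eq_empty_iff_forall_notMem.2 ?_).symm
    rintro x ⟨hx, hne⟩
    exact hne ((S.classBase_one hk x).symm.trans hx)
  | succ k ih =>
    have hkn := Nat.lt_of_succ_lt hk
    have htrans := S.classBase_classBase (Nat.le_succ (k + 1)) hk
    have hbk := S.classBase_eq_of_le (Nat.le_succ (k + 1)) hk hb
    ext x
    rw [show 2 * (k + 1) + 1 = 2 * k + 1 + 2 by ring, blossom,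
      show 2 * k + 1 + 2 = 2 * (k + 1) + 1 by ring]
    simp only [Set.mem_union, Set.mem_iUnion, Set.mem_ofPred_eq, Set.mem_singleton_iff,
      S.mem_blossomCore_iff hk]
    constructor
    · rintro (⟨-, hx⟩ | ⟨w, ⟨hw, -⟩, hx⟩)
      · exact hx
      · have hwk : classBase M (k + 1) w = w := by
          rcases hw with h | rfl
          exacts [h.1, hbk]
        have hwb : classBase M (k + 1 + 1) w = b := by
          rcases hw with h | rfl
          exacts [h.2.1, hb]
        rw [ih hkn hwk] at hx
        obtain ⟨rfl, hne⟩ := hx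
        refine ⟨(htrans x).symm.trans hwb, ?_⟩
        rintro rfl
        exact hne hbk.symm
    · rintro ⟨hxb, hne⟩
      by_cases hx : classBase M (k + 1) x = x
      · exact Or.inl ⟨hx, hxb, hne⟩
      · refine Or.inr ⟨classBase M (k + 1) x, ⟨?_, S.isOuter_classBase hkn hx⟩, ?_⟩
        · by_cases h : classBase M (k + 1) x = b
          · exact Or.inr h
          · exact Or.inl ⟨S.idem _ hkn x, (htrans x).trans hxb, h⟩
        · rw [ih hkn (S.idem _ hkn x)]
          exact ⟨rfl, Ne.symm hx⟩

lemma isLaminar_blossomFamily (S : IsStage M n) {t : ℕ} (ht : t < 2 * n) :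
    IsLaminar (blossomFamily M t) := by
  have key : ∀ A ∈ blossomFamily M t, ∃ k < n, ∃ b, classBase M (k + 1) b = b ∧
      A = {x | classBase M (k + 1) x = b ∧ x ≠ b} := by
    rintro A ⟨b, t', ⟨k, rfl⟩, hle, -, hb, rfl⟩
    have hk : k < n := by omega
    rw [S.lt_tenacity_iff hk] at hb
    exact ⟨k, hk, b, hb, S.blossom_eq hk hb⟩
  intro A hA A' hA'
  obtain ⟨j, hj, b, hb, rfl⟩ := key A hA
  obtain ⟨k, hk, c, hc, rfl⟩ := key A' hA'
  rcases le_total j k with hjk | hkj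
  · exact (S.disjoint_or_subset_of_le (Nat.succ_le_succ hjk) hk hc).imp_right Or.inl
  · exact (S.disjoint_or_subset_of_le (Nat.succ_le_succ hkj) hj hb).imp (fun h => h.symm) Or.inr

lemma evenBound_classBase (S : IsStage M n) (hx : classBase M n x ≠ x) :
    evenBound M n (classBase M n x) = elev M (classBase M n x) := by
  have hlt := S.elev_classBase_lt le_rfl hx
  have hlt' := S.lt_olev_classBase le_rfl hx
  rw [evenBound_outer (S.idem n le_rfl x) (by omega)]
  omega

lemma levelBound_le_of_from_base (S : IsStage M n) (hx : classBase M n x ≠ x)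
    {r : G.Walk (classBase M n x) x} (hr : IsAltPathUnmatchedStart M r) :
    levelBound (elev M) (olev M) r.length x ≤ elev M (classBase M n x) + r.length := by
  have hbound := S.isDual.levelBound_add_le (fun _ hj => S.eq_of_le hj (S.idem n le_rfl x)) hr
  rw [S.evenBound_classBase hx] at hbound
  unfold levelBound at hbound ⊢
  rw [evenBound_of_ne hx, oddBound_of_ne hx] at hbound
  omega

lemma isTight_of_from_base (S : IsStage M n) (hx : classBase M n x ≠ x)
    {r : G.Walk (classBase M n x) x} (hr : IsAltPathUnmatchedStart M r)
    (hlen : elev M (classBase M n x) + r.length ≤ levelBound (elev M) (olev M) r.length x) :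
    IsTight n (classBase M) (evenBound M n) (oddBound M n) r := by
  have hbound := S.isDual.levelBound_add_le (fun _ hj => S.eq_of_le hj (S.idem n le_rfl x)) hr
  rw [IsTight]
  rw [S.evenBound_classBase hx] at hbound ⊢
  unfold levelBound at hlen hbound ⊢
  rw [evenBound_of_ne hx, oddBound_of_ne hx] at hbound ⊢
  omega

lemma exists_eq_append_shortest (S : IsStage M n) (hx : classBase M n x ≠ x) {p : G.Walk f x}
    (hp : IsAltPathFromFree M p) (hlen : p.length = elev M x ∨ p.length = olev M x) :
    ∃ (q : G.Walk f (classBase M n x)) (r : G.Walk (classBase M n x) x), p = q.append r ∧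
      IsEvenlevelPath M q ∧ IsAltPathUnmatchedStart M r ∧ r.length % 2 = p.length % 2 ∧
      ∀ r' : G.Walk (classBase M n x) x, IsAltPathUnmatchedStart M r' →
        r'.length % 2 = p.length % 2 → r.length ≤ r'.length := by
  obtain ⟨q, r, rfl, hq, -⟩ := S.exists_eq_append_elev le_rfl hx hp hlen
  have hlevel := elev_mod M (classBase M n x)
  have heven := elev_mod M x
  have hodd := olev_mod M x
  have hsum := Walk.length_append q r
  refine ⟨q, r, rfl, isEvenlevelPath_of_length_eq hp.of_append_left hq,
    hp.unmatchedStart.of_append_right (by omega), by omega, fun r' hr' hpar => ?_⟩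
  have hle := S.levelBound_le_of_from_base hx hr'
  unfold levelBound at hle
  split_ifs at hle <;> omega

lemma exists_eq_append_of_isEvenlevelPath (S : IsStage M n) (hx : classBase M n x ≠ x)
    {p : G.Walk f x} (hp : IsEvenlevelPath M p) :
    ∃ (q : G.Walk f (classBase M n x)) (r : G.Walk (classBase M n x) x), p = q.append r ∧
      IsEvenlevelPath M q ∧ IsEvenlevelPathFrom M r := by
  obtain ⟨q, r, hqr, hq, hr, hpar, hmin⟩ :=
    S.exists_eq_append_shortest hx hp.1 (Or.inl hp.length_eq)
  have heven := Nat.even_iff.1 hp.2.1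
  exact ⟨q, r, hqr, hq, hr, Nat.even_iff.2 (hpar.trans heven), fun r' hr' hpar' =>
    hmin r' hr' ((Nat.even_iff.1 hpar').trans heven.symm)⟩

lemma exists_eq_append_of_isOddlevelPath (S : IsStage M n) (hx : classBase M n x ≠ x)
    {p : G.Walk f x} (hp : IsOddlevelPath M p) :
    ∃ (q : G.Walk f (classBase M n x)) (r : G.Walk (classBase M n x) x), p = q.append r ∧
      IsEvenlevelPath M q ∧ IsOddlevelPathFrom M r := by
  obtain ⟨q, r, hqr, hq, hr, hpar, hmin⟩ :=
    S.exists_eq_append_shortest hx hp.1 (Or.inr hp.length_eq)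
  have hodd := Nat.odd_iff.1 hp.2.1
  exact ⟨q, r, hqr, hq, hr, Nat.odd_iff.2 (hpar.trans hodd), fun r' hr' hpar' =>
    hmin r' hr' ((Nat.odd_iff.1 hpar').trans hodd.symm)⟩

lemma isTight_of_isLevelPathFrom (S : IsStage M n) (hx : classBase M n x ≠ x)
    {r : G.Walk (classBase M n x) x} (hr : IsEvenlevelPathFrom M r ∨ IsOddlevelPathFrom M r) :
    IsAltPathUnmatchedStart M r ∧
      IsTight n (classBase M) (evenBound M n) (oddBound M n) r := by
  have hlt := S.lt_of_ne n le_rfl x hx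
  have hcap := S.le_levelCap
  rcases hr with ⟨hr, heven, hmin⟩ | ⟨hr, hodd, hmin⟩
  · obtain ⟨f, p, hp⟩ := exists_evenlevelPath (M := M) (v := x) <| by
      rw [evenlevel_of_lt (by omega)]
      exact ENat.natCast_ne_top _
    obtain ⟨q, r', rfl, hq, hr', heven', -⟩ := S.exists_eq_append_of_isEvenlevelPath hx hp
    have hle := hmin r' hr' heven'
    have hlen := hp.length_eq
    rw [Walk.length_append, hq.length_eq] at hlen
    refine ⟨hr, S.isTight_of_from_base hx hr ?_⟩
    rw [levelBound_of_even (Nat.even_iff.1 heven)]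
    omega
  · obtain ⟨f, p, hp⟩ := exists_oddlevelPath (M := M) (v := x) <| by
      rw [oddlevel_of_lt (by omega)]
      exact ENat.natCast_ne_top _
    obtain ⟨q, r', rfl, hq, hr', hodd', -⟩ := S.exists_eq_append_of_isOddlevelPath hx hp
    have hle := hmin r' hr' hodd'
    have hlen := hp.length_eq
    rw [Walk.length_append, hq.length_eq] at hlen
    refine ⟨hr, S.isTight_of_from_base hx hr ?_⟩
    rw [levelBound_of_odd (Nat.odd_iff.1 hodd)]
    omega

lemma classBase_eq_of_mem_support (S : IsStage M n) (hx : classBase M n x ≠ x)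
    {r : G.Walk (classBase M n x) x} (hr : IsEvenlevelPathFrom M r ∨ IsOddlevelPathFrom M r) :
    ∀ z ∈ r.support, classBase M n z = classBase M n x := by
  obtain ⟨hpath, ht⟩ := S.isTight_of_isLevelPathFrom hx hr
  obtain ⟨q, r', rfl, hr'⟩ := S.isDual.exists_eq_append_of_tight
    (fun _ hj => S.eq_of_le hj (S.idem n le_rfl x)) hpath ht le_rfl r.start_mem_support
  have hq : q.Nil := Walk.isPath_iff_nil.1 hpath.1.1.of_append_left
  intro z hz
  rcases (Walk.mem_support_append_iff _ _).1 hz with hz | hz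
  · rw [Walk.nil_iff_support_eq.1 hq, List.mem_singleton] at hz
    rw [hz, S.idem n le_rfl x]
  · exact hr' z hz

lemma edgeTenacity_lt_of_tight_concat (S : IsStage M n) {p : G.Walk b v} {h : G.Adj v w}
    (hb : classBase M n b = b) (hp : IsAltPathUnmatchedStart M (p.concat h))
    (ht : IsTight n (classBase M) (evenBound M n) (oddBound M n) (p.concat h))
    (hv : classBase M n v = b) (hw : classBase M n w = b) :
    edgeTenacity M s(v, w) < (2 * n : ℕ) := by
  have hcap := S.le_levelCap
  have hb' : ∀ j ≤ n, classBase M j b = b := fun _ hj => S.eq_of_le hj hb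
  obtain ⟨-, hwp, hlast⟩ := isAltPathUnmatchedStart_concat_iff.1 hp
  rcases Nat.mod_two_eq_zero_or_one p.length with heven | hodd
  · obtain ⟨hn, hsum⟩ := S.tight_unmatched hb' hp ht heven
    have hlt := S.elev_add_elev_lt (hv.trans hw.symm) h.ne hsum
    rw [edgeTenacity_of_not_adj hn, evenlevel_of_lt (by omega), evenlevel_of_lt (by omega)]
    exact_mod_cast hlt
  · have hm := hlast.2 hodd
    have hwb : w ≠ b := fun heq => hwp (heq ▸ p.start_mem_support)
    have hlt := S.lt_of_ne n le_rfl w (by rw [hw]; exact hwb.symm)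
    have hmate := elev_mate S.matching hm
    rw [edgeTenacity_of_adj hm, oddlevel_of_lt (by omega), oddlevel_of_lt (by omega)]
    exact_mod_cast (by omega : olev M v + olev M w + 1 < 2 * n)

lemma edgeTenacity_lt_of_tight (S : IsStage M n) {p : G.Walk b x} (hb : classBase M n b = b)
    (hp : IsAltPathUnmatchedStart M p)
    (ht : IsTight n (classBase M) (evenBound M n) (oddBound M n) p)
    (hclass : ∀ z ∈ p.support, classBase M n z = b) :
    ∀ e ∈ p.edges, edgeTenacity M e < (2 * n : ℕ) := by
  induction p using Walk.concatRec with
  | Hnil => simp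
  | Hconcat p h ih =>
    have hclass' := fun z hz => hclass z ((mem_support_concat p h).2 (Or.inl hz))
    intro e he
    rw [Walk.edges_concat, List.concat_eq_append, List.mem_append, List.mem_singleton] at he
    rcases he with he | rfl
    · exact ih hb (isAltPathUnmatchedStart_concat_iff.1 hp).1
        (S.isDual.isTight_of_concat (fun _ hj => S.eq_of_le hj hb) hp ht) hclass' e he
    · exact S.edgeTenacity_lt_of_tight_concat hb hp ht (hclass' _ p.end_mem_support)
        (hclass _ (Walk.end_mem_support _))

lemma edgeTenacity_lt_of_isLevelPathFrom (S : IsStage M n) (hx : classBase M n x ≠ x)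
    {r : G.Walk (classBase M n x) x} (hr : IsEvenlevelPathFrom M r ∨ IsOddlevelPathFrom M r) :
    ∀ e ∈ r.edges, edgeTenacity M e < (2 * n : ℕ) := by
  obtain ⟨hpath, ht⟩ := S.isTight_of_isLevelPathFrom hx hr
  exact S.edgeTenacity_lt_of_tight (S.idem n le_rfl x) hpath ht
    (S.classBase_eq_of_mem_support hx hr)

lemma exists_eq_append_hasBase (S : IsStage M n) (hx : classBase M n x ≠ x) {p : G.Walk f x}
    (hp : IsLevelPath M p) :
    ∃ (q : G.Walk f (classBase M n x)) (r : G.Walk (classBase M n x) x), p = q.append r ∧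
      ∀ u ∈ r.support, u ≠ classBase M n x → ∃ c, HasBase M u c ∧ c ∈ r.support := by
  have hfree := hp.isAltPathFromFree
  obtain ⟨-, hunbased⟩ := S.isTight_of_ne hx hfree hp.length_eq
  obtain ⟨q, r, rfl, hq, hr⟩ := S.exists_eq_append_elev le_rfl hx hfree hp.length_eq
  refine ⟨q, r, rfl, fun u hu hne => ?_⟩
  obtain ⟨j, hj, hten⟩ := S.exists_tenacity_eq (x := u) (by rw [hr u hu]; exact hne.symm)
  refine ⟨classBase M (j + 1) u, (S.hasBase_iff hj hten).2 rfl, ?_⟩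
  have hup : u ∈ supportSet (q.append r) := (Walk.mem_support_append_iff _ _).2 (Or.inr hu)
  rcases (Walk.mem_support_append_iff _ _).1
    (mem_of_unbased_eq_empty (hunbased (j + 1) hj) hup) with hmem | hmem
  · rw [S.eq_classBase_of_mem le_rfl hx hfree.of_append_left hq hmem
      ((S.classBase_classBase hj le_rfl u).trans (hr u hu))]
    exact r.start_mem_support
  · exact hmem

end IsStage

end Bases

section Main

variable {V : Type*} {G : SimpleGraph V} {M : G.Subgraph} {n k : ℕ} {f v : V}

lemma le_olev_of_le_lm (hk : (k : ℕ∞) ≤ lm M) (hcap : k ≤ levelCap V) (hf : IsUnmatched M f) :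
    k ≤ olev M f := by
  by_cases h : oddlevel M f = ⊤
  · rw [olev, if_pos h]
    omega
  obtain ⟨g, p, hp⟩ := exists_oddlevelPath h
  have hne : g ≠ f := by
    rintro rfl
    have hzero := Walk.length_eq_zero_iff.2 (Walk.isPath_iff_nil.1 hp.1.2.1)
    have hodd := Nat.odd_iff.1 hp.2.1
    omega
  have hle : lm M ≤ p.length := sInf_le ⟨g, f, p, ⟨hp.1.2, hp.1.1, hf, hne⟩, rfl⟩
  rw [← hp.length_eq]
  exact_mod_cast hk.trans hle

lemma IsMaxlevelPath.exists_tenacity_eq {p : G.Walk f v} (hp : IsMaxlevelPath M p) :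
    ∃ n : ℕ, tenacity M v = (2 * n + 1 : ℕ) := by
  have hfin : maxlevel M v ≠ ⊤ := hp.2 ▸ ENat.natCast_ne_top _
  rw [maxlevel, ne_eq, max_eq_top, not_or] at hfin
  have heven := (evenlevel_cases M v).resolve_right fun h => hfin.1 h.1
  have hodd := (oddlevel_cases M v).resolve_right fun h => hfin.2 h.1
  have hmod := elev_mod M v
  have hmod' := olev_mod M v
  refine ⟨(elev M v + olev M v) / 2, ?_⟩
  rw [tenacity, heven, hodd, ← Nat.cast_add, Nat.cast_inj]
  omega

variable [Finite V]

lemma two_mul_add_four_le_levelCap (hv : tenacity M v = (2 * n + 1 : ℕ)) :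
    2 * (n + 1) + 4 ≤ levelCap V := by
  have hfin : tenacity M v ≠ ⊤ := hv ▸ ENat.natCast_ne_top _
  rw [tenacity, ne_eq, ENat.add_eq_top, not_or] at hfin
  obtain ⟨f, p, hp⟩ := exists_evenlevelPath hfin.1
  obtain ⟨g, q, hq⟩ := exists_oddlevelPath hfin.2
  have hplt := two_mul_length_lt_levelCap hp.1.2.1
  have hqlt := two_mul_length_lt_levelCap hq.1.2.1
  have hsum := elev_add_olev_of_tenacity hv
  rw [← hp.length_eq, ← hq.length_eq] at hsum
  omega

lemma isStage_of_le_lm (hM : M.IsMatching) (hv : tenacity M v = (2 * k + 1 : ℕ))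
    (hnk : n ≤ k + 1) (hn : ((2 * n : ℕ) : ℕ∞) ≤ lm M) : IsStage M n := by
  have hcap := two_mul_add_four_le_levelCap hv
  exact isStage hM (by omega) fun f hf => le_olev_of_le_lm hn (by omega) hf

lemma IsStage.isLevelPathFrom_blossom (S : IsStage M (k + 1)) (hv : classBase M (k + 1) v ≠ v)
    {r : G.Walk (classBase M (k + 1) v) v}
    (hr : IsEvenlevelPathFrom M r ∨ IsOddlevelPathFrom M r) :
    (∀ x ∈ r.support,
      x ∈ blossom M (2 * k + 1) (classBase M (k + 1) v) ∪ {classBase M (k + 1) v}) ∧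
      ∀ e ∈ r.edges, edgeTenacity M e ≤ (2 * k + 1 : ℕ) := by
  rw [S.blossom_eq k.lt_succ_self (S.idem _ le_rfl v)]
  refine ⟨fun x hx => ?_, fun e he => ?_⟩
  · rw [Set.union_singleton, Set.mem_insert_iff, or_iff_not_imp_left]
    exact fun hne => ⟨S.classBase_eq_of_mem_support hv hr x hx, hne⟩
  · exact Order.le_of_lt_add_one (by exact_mod_cast S.edgeTenacity_lt_of_isLevelPathFrom hv hr e he)

end Main

end MV

theorem mainTheorem1 {V : Type*} [Finite V] (G : SimpleGraph V) (M : G.Subgraph)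
    (hM : M.IsMatching) :
    (∀ t : ℕ, MV.Eligible M t → ∀ v : V, MV.tenacity M v = t →
      -- Statement 1
      ((∀ (f : V) (p : G.Walk f v), MV.IsLevelPath M p → ∃! b, MV.IsBaseOn M p b) ∧
        ∃ b, MV.baseSet M v = {b}) ∧
      -- Statement 2
      (∀ (f : V) (p : G.Walk f v), MV.IsMaxlevelPath M p →
        ∃! e, e ∈ p.edges ∧ MV.IsBridgeEdge M e ∧ MV.edgeTenacity M e = t) ∧
      -- Statement 3
      MV.IsLaminar (MV.blossomFamily M t) ∧
      -- Statement 4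
      (∀ b, MV.HasBase M v b → ∀ u ∈ MV.blossom M t b,
        (∀ (f : V) (p : G.Walk f u), MV.IsEvenlevelPath M p →
          ∃ (q : G.Walk f b) (r : G.Walk b u), p = q.append r ∧
            MV.IsEvenlevelPath M q ∧ MV.IsEvenlevelPathFrom M r) ∧
        (∀ (f : V) (p : G.Walk f u), MV.IsOddlevelPath M p →
          ∃ (q : G.Walk f b) (r : G.Walk b u), p = q.append r ∧
            MV.IsEvenlevelPath M q ∧ MV.IsOddlevelPathFrom M r) ∧
        (∀ r : G.Walk b u, MV.IsEvenlevelPathFrom M r ∨ MV.IsOddlevelPathFrom M r →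
          (∀ x ∈ r.support, x ∈ MV.blossom M t b ∪ {b}) ∧
          (∀ e ∈ r.edges, MV.edgeTenacity M e ≤ t))) ∧
      -- Statement 5
      (∀ b, MV.HasBase M v b → ∀ (f : V) (p : G.Walk f v), MV.IsLevelPath M p →
        ∃ (q : G.Walk f b) (r : G.Walk b v), p = q.append r ∧
          ∀ u ∈ r.support, u ≠ b → ∃ c, MV.HasBase M u c ∧ c ∈ r.support)) ∧
    -- Statement 2 at tenacity `l_m`
    (∀ v : V, MV.tenacity M v = MV.lm M → ∀ (f : V) (p : G.Walk f v), MV.IsMaxlevelPath M p →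
      ∃! e, e ∈ p.edges ∧ MV.IsBridgeEdge M e ∧ MV.edgeTenacity M e = MV.lm M) := by
  refine ⟨?_, fun v hv f p hp => ?_⟩
  · rintro t ⟨⟨k, rfl⟩, -, hlt⟩ v hv
    have S : MV.IsStage M (k + 1) :=
      MV.isStage_of_le_lm hM hv le_rfl (by exact_mod_cast Order.add_one_le_of_lt hlt)
    have S' : MV.IsStage M k := MV.isStage_of_le_lm hM hv k.le_succ
      ((Nat.cast_le.2 (Nat.le_succ _)).trans hlt.le)
    have hbase {b : V} : MV.HasBase M v b ↔ MV.classBase M (k + 1) v = b :=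
      S.hasBase_iff k.lt_succ_self hv
    have hne := ((S.tenacity_eq_iff k.lt_succ_self).1 hv).2
    have hF {f : V} {p : G.Walk f v} (hp : MV.IsLevelPath M p) := S.isBaseOn k.lt_succ_self hv hp
    refine ⟨⟨fun f p hp => ⟨_, hF hp, fun c hc => hc.eq (hF hp)⟩, _, hbase.2 rfl⟩,
      fun f p hp => S'.existsUnique_bridge hv hp, S.isLaminar_blossomFamily (by omega),
      fun b hb u hu => ?_, fun b hb f p hp => ?_⟩
    · rw [hbase] at hb
      rw [S.blossom_eq k.lt_succ_self (hb ▸ S.idem _ le_rfl v)] at hu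
      obtain ⟨rfl, hub⟩ := hu
      exact ⟨fun f p hp => S.exists_eq_append_of_isEvenlevelPath hub.symm hp,
        fun f p hp => S.exists_eq_append_of_isOddlevelPath hub.symm hp,
        fun r hr => S.isLevelPathFrom_blossom hub.symm hr⟩
    · obtain rfl := hbase.1 hb
      exact S.exists_eq_append_hasBase hne hp
  · obtain ⟨n, hn⟩ := hp.exists_tenacity_eq
    have hlm : MV.lm M = (2 * n + 1 : ℕ) := hv ▸ hn
    rw [hlm]
    exact (MV.isStage_of_le_lm hM hn n.le_succ (hlm ▸ Nat.cast_le.2 (Nat.le_succ _))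
      ).existsUnique_bridge hn hp
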